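/- **Definitions.** All vector spaces are over $\mathbb{C}$. Let $I$ be a set and let $M_2(I)$ be the set of matrices $K=\begin{pmatrix} k & l\\ m& n\end{pmatrix}$ over $I$. For such $K$ write $K_l=(k;m)$, $K_r=(l;n)$ for its columns and $K_u=(k,l)$, $K_d=(m,n)$ for its rows. If $K_r=L_l$, let $K\cdot L$ be the matrix with columns $K_l,L_r$; if $K_d=L_u$, let $K*L$ be the matrix with rows $K_u,L_d$. Put $K^{\circ}=\begin{pmatrix} l&k\\ n&m\end{pmatrix}$, $K^{\bullet}=\begin{pmatrix} m&n\\ k&l\end{pmatrix}$ and $K^{\circ\bullet}=\begin{pmatrix} n&m\\ l&k\end{pmatrix}$. A *partial bialgebra* $\mathscr{A}$ with object set $I$ consists of vector spaces $A(K)$ ($K\in M_2(I)$); associative multiplications $A(K)\otimes A(L)\to A(K\cdot L)$ (for $K_r=L_l$) with units $\mathbf 1(k;m)\in A\begin{pmatrix}k&k\\m&m\end{pmatrix}$; and comultiplications $\Delta_{rs}:A\begin{pmatrix}k&l\\m&n\end{pmatrix}\to A\begin{pmatrix}k&l\\r&s\end{pmatrix}\otimes A\begin{pmatrix}r&s\\m&n\end{pmatrix}$,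 coassociative and with counits $\epsilon: A(K)\to\mathbb{C}$ ($K_u=K_d$; set $\epsilon=0$ on $A(K)$ if $K_u\ne K_d$), such that 1. $\Delta_{l,l'}(\mathbf 1(k;m))=\delta_{l,l'}\mathbf 1(k;l)\otimes\mathbf 1(l;m)$; 2. $\epsilon(ab)=\epsilon(a)\epsilon(b)$ for $a\in A(K)$, $b\in A(L)$, $K_r=L_l$; 3. $\epsilon(\mathbf 1(k;k))=1$ for all $k\in I$; 4. for $a\in A(K)$ and fixed $r$ (resp. fixed $s$), $\Delta_{rs}(a)\neq0$ for only finitely many $s$ (resp. $r$); 5. $\Delta_{rs}(ab)=\sum_t\Delta_{rt}(a)\Delta_{ts}(b)$ for $a\in A(K)$, $b\in A(L)$, $K_r=L_l$. Its *total algebra* is $A=\bigoplus_K A(K)$, with product zero on $A(K)\otimes A(L)$ if $K_r\ne L_l$. In the multiplier algebras $M(A)$ and $M(A\otimes A)$ there are the strictly convergent sums $\lambda_k=\sum_l\mathbf 1(k;l)$, $\rho_l=\sum_k\mathbf 1(k;l)$, the *total comultiplication* $\Delta(a)=\sum_{r,s}\Delta_{rs}(a)$ and $\Delta(1)=\sum_p\rho_p\otimes\lambda_p$.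 Define linear maps $A\otimes A\to A\otimes A$ by $T_1(a\otimes b)=\Delta(a)(1\otimes b)$, $T_2(a\otimes b)=(a\otimes1)\Delta(b)$, $$E_1(a\otimes b)=\Delta(1)(a\otimes b),\quad E_2(a\otimes b)=(a\otimes b)\Delta(1),\quad G_1(a\otimes b)=\sum_p a\rho_p\otimes\rho_pb,\quad G_2(a\otimes b)=\sum_p a\lambda_p\otimes\lambda_pb .$$ An *antipode* for $\mathscr{A}$ is a family of linear maps $S:A(K)\to A(K^{\circ\bullet})$ such that for all $M,P\in M_2(I)$ and $a\in A(M)$, with $M=\begin{pmatrix}k&l\\m&n\end{pmatrix}$, $$\sum_{K*L=M,\;K\cdot L^{\circ\bullet}=P}a_{(1)K}S(a_{(2)L})=\begin{cases}\epsilon(a)\mathbf 1(P_l)&\text{if }P_l=P_r\text{ has upper entry }k,\\0&\text{otherwise,}\end{cases}$$ $$\sum_{K*L=M,\;K^{\circ\bullet}\cdot L=P}S(a_{(1)K})a_{(2)L}=\begin{cases}\epsilon(a)\mathbf 1(P_r)&\text{if }P_l=P_r\text{ has lower entry }n,\\0&\text{otherwise.}\end{cases}$$ (Here $\Delta_{K_d}(a)=a_{(1)K}\otimes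 a_{(2)L}$ for $K*L=M$.) Its extension $S:A\to A$ is the *total antipode*. $\mathscr{A}$ is a *partial Hopf algebra* if it admits an antipode. Let $A$ be a non-degenerate idempotent algebra, $\Delta:A\to M(A\otimes A)$ a homomorphism and $\epsilon:A\to\mathbb{C}$ linear. $(A,\Delta,\epsilon)$ is a *weak multiplier Hopf algebra* (Van Daele–Wang) if * $T_1(a\otimes b)=\Delta(a)(1\otimes b)$ and $T_2(a\otimes b)=(a\otimes1)\Delta(b)$ lie in $A\otimes A$, and $(a\otimes1\otimes1)(\Delta\otimes\mathrm{id})(\Delta(b)(1\otimes c))=(\mathrm{id}\otimes\Delta)((a\otimes1)\Delta(b))(1\otimes1\otimes c)$; * $\Delta$ is full: a subspace $V$ with $T_1(A\otimes A)\subseteq V\otimes A$, or with $T_2(A\otimes A)\subseteq A\otimes V$, equals $A$; * $(\epsilon\otimes\mathrm{id})T_1(a\otimes b)=ab=(\mathrm{id}\otimes\epsilon)T_2(a\otimes b)$; * there is an idempotent $E\in M(A\otimes A)$ with $T_1(A\otimes A)=E(A\otimes A)$, $T_2(A\otimes A)=(A\otimes A)E$ and $(\Delta\otimes\mathrm{id})(E)=(\mathrm{id}\otimes\Delta)(E)=(E\otimes1)(1\otimes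 E)=(1\otimes E)(E\otimes1)$, where $\Delta\otimes\mathrm{id}$ and $\mathrm{id}\otimes\Delta$ are extended to $M(A\otimes A)$ with values $E\otimes1$ and $1\otimes E$ at $1$; * there are linear maps $\mathcal G_1,\mathcal G_2$ on $A\otimes A$ with $(\mathcal G_1\otimes\mathrm{id})(\Delta_{13}(a)(1\otimes b\otimes c))=\Delta_{13}(a)(1\otimes E)(1\otimes b\otimes c)$, $(\mathrm{id}\otimes \mathcal G_2)((a\otimes b\otimes1)\Delta_{13}(c))=(a\otimes b\otimes1)(E\otimes1)\Delta_{13}(c)$ and $\ker T_i=(1-\mathcal G_i)(A\otimes A)$ for $i=1,2$. Its *antipode* is the linear map $S:A\to M(A)$ with $S(a)b=(\epsilon\otimes\mathrm{id})R_1(a\otimes b)$ and $bS(a)=(\mathrm{id}\otimes\epsilon)R_2(b\otimes a)$, where $R_i$ is the linear map with $T_iR_i=E_i$, $R_iT_i=\mathcal G_i$, $T_iR_iT_i=T_i$, $R_iT_iR_i=R_i$, and $E_1$, $E_2$ are left and right multiplication by $E$. **Theorem.** Let $\mathscr{A}$ be a partial bialgebra with total algebra $A$, total comultiplication $\Delta$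 and counit $\epsilon$ (extended linearly to $A$). The following are equivalent: 1. $\mathscr{A}$ is a partial Hopf algebra. 2. There exist linear maps $R_1,R_2:A\otimes A\to A\otimes A$ such that, for $i=1,2$, $T_iR_i=E_i$, $R_iT_i=G_i$, $T_iR_iT_i=T_i$ and $R_iT_iR_i=R_i$. 3. $(A,\Delta,\epsilon)$ is a weak multiplier Hopf algebra. If these conditions hold, then the total antipode of $\mathscr{A}$ coincides with the antipode of $(A,\Delta,\epsilon)$ (viewing $A\subseteq M(A)$). -/

import Mathlib

open scoped TensorProduct DirectSum

universe u v

noncomputable section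

/-! ### Locally finite sums of linear maps -/

/-- The pointwise sum `x ↦ ∑ i, f i x` of a family of linear maps such that, for each `x`, all but
finitely many `f i x` vanish. -/
def locFinSum {ι : Type*} {V W : Type*} [AddCommGroup V] [Module ℂ V] [AddCommGroup W] [Module ℂ W]
    (f : ι → V →ₗ[ℂ] W) (hf : ∀ x, {i | f i x ≠ 0}.Finite) : V →ₗ[ℂ] W where
  toFun x := ∑ᶠ i, f i x
  map_add' x y := by
    simp only [map_add]
    exact finsum_add_distrib (hf x) (hf y)
  map_smul' c x := by
    simp only [map_smul, RingHom.id_apply]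
    exact (smul_finsum' c (hf x)).symm

/-! ### Multipliers -/

section Multiplier

variable (A : Type*) [NonUnitalRing A] [Module ℂ A] [SMulCommClass ℂ A A] [IsScalarTower ℂ A A]

/-- The linear space of the pairs `(L, R)` of linear maps with `R(a) b = a L(b)`. -/
def multiplierSubmodule : Submodule ℂ ((A →ₗ[ℂ] A) × (A →ₗ[ℂ] A)) where
  carrier := {m | ∀ a b, m.2 a * b = a * m.1 b}
  add_mem' {m n} hm hn a b := by
    have h1 := hm a b
    have h2 := hn a b
    simp [add_mul, mul_add, h1, h2]
  zero_mem' a b := by simp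
  smul_mem' c m hm a b := by
    have h1 := hm a b
    simp [smul_mul_assoc, mul_smul_comm, h1]

/-- The algebra `M(A)` of multipliers of `A`: pairs `m = (L, R)` of linear maps, thought of as
`L a = m a` and `R a = a m`, such that `(a m) b = a (m b)`. -/
def Multiplier : Type _ := multiplierSubmodule A

instance : AddCommGroup (Multiplier A) := inferInstanceAs (AddCommGroup (multiplierSubmodule A))

instance : Module ℂ (Multiplier A) := inferInstanceAs (Module ℂ (multiplierSubmodule A))

variable {A}

namespace Multiplier

/-- `a ↦ m a`. -/
def left (m : Multiplier A) : A →ₗ[ℂ] A := m.1.1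

/-- `a ↦ a m`. -/
def right (m : Multiplier A) : A →ₗ[ℂ] A := m.1.2

theorem right_mul (m : Multiplier A) (a b : A) : m.right a * b = a * m.left b := m.2 a b

/-- The multiplier with given left and right actions. -/
def mk (L R : A →ₗ[ℂ] A) (h : ∀ a b, R a * b = a * L b) : Multiplier A := ⟨(L, R), h⟩

theorem ext {m n : Multiplier A} (hl : ∀ a, m.left a = n.left a)
    (hr : ∀ a, m.right a = n.right a) : m = n :=
  Subtype.ext (Prod.ext (LinearMap.ext hl) (LinearMap.ext hr))

/-- `(m n) a = m (n a)` and `a (m n) = (a m) n`. -/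
instance : Mul (Multiplier A) where
  mul m n := mk (m.left ∘ₗ n.left) (n.right ∘ₗ m.right) fun a b => by
    simp [right_mul]

instance : One (Multiplier A) where
  one := mk LinearMap.id LinearMap.id fun _ _ => rfl

/-- The natural map `A → M(A)`. -/
def of : A →ₗ[ℂ] Multiplier A where
  toFun a := mk (LinearMap.mulLeft ℂ a) (LinearMap.mulRight ℂ a) fun x y => by
    simp [_root_.mul_assoc]
  map_add' a b := ext (fun x => add_mul a b x) (fun x => mul_add x a b)
  map_smul' c a := ext (fun x => smul_mul_assoc c a x) (fun x => mul_smul_comm c x a)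

/-- The strictly convergent sum of a family of multipliers `m i` such that, for each `a`, one has
`m i a = 0` and `a m i = 0` for almost all `i`. -/
def strictSum {ι : Type*} (m : ι → Multiplier A) (hl : ∀ a, {i | (m i).left a ≠ 0}.Finite)
    (hr : ∀ a, {i | (m i).right a ≠ 0}.Finite) : Multiplier A :=
  mk (locFinSum (fun i => (m i).left) hl) (locFinSum (fun i => (m i).right) hr) fun a b => by
    change (∑ᶠ i, (m i).right a) * b = a * ∑ᶠ i, (m i).left b
    rw [finsum_mul' _ _ (hr a), mul_finsum' _ _ (hl b)]
    simp [right_mul]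

variable {B : Type*} [NonUnitalRing B] [Module ℂ B] [SMulCommClass ℂ B B] [IsScalarTower ℂ B B]

/-- The multiplier `m ⊗ n` of `A ⊗ B`. -/
def tensor : Multiplier A →ₗ[ℂ] Multiplier B →ₗ[ℂ] Multiplier (A ⊗[ℂ] B) :=
  LinearMap.mk₂ ℂ
    (fun m n => mk (TensorProduct.map m.left n.left) (TensorProduct.map m.right n.right)
      fun x y => by
        induction x with
        | zero => simp
        | add x x' h h' => simp [add_mul, h, h']
        | tmul a b =>
          induction y with
          | zero => simp
          | add y y' h h' => simp only [map_add, mul_add, h, h']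
          | tmul c d => simp [right_mul])
    (fun _ _ _ => ext (fun x => LinearMap.congr_fun (TensorProduct.map_add_left _ _ _) x)
      (fun x => LinearMap.congr_fun (TensorProduct.map_add_left _ _ _) x))
    (fun c _ _ => ext (fun x => LinearMap.congr_fun (TensorProduct.map_smul_left c _ _) x)
      (fun x => LinearMap.congr_fun (TensorProduct.map_smul_left c _ _) x))
    (fun _ _ _ => ext (fun x => LinearMap.congr_fun (TensorProduct.map_add_right _ _ _) x)
      (fun x => LinearMap.congr_fun (TensorProduct.map_add_right _ _ _) x))
    (fun c _ _ => ext (fun x => LinearMap.congr_fun (TensorProduct.map_smul_right c _ _) x)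
      (fun x => LinearMap.congr_fun (TensorProduct.map_smul_right c _ _) x))

/-- The multiplier of `(A ⊗ A) ⊗ A` that corresponds to a multiplier of `A ⊗ (A ⊗ A)`. -/
def reassoc : Multiplier (A ⊗[ℂ] (A ⊗[ℂ] A)) →ₗ[ℂ] Multiplier ((A ⊗[ℂ] A) ⊗[ℂ] A) where
  toFun m :=
    mk ((TensorProduct.assoc ℂ A A A).symm.toLinearMap ∘ₗ m.left ∘ₗ
        (TensorProduct.assoc ℂ A A A).toLinearMap)
      ((TensorProduct.assoc ℂ A A A).symm.toLinearMap ∘ₗ m.right ∘ₗ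
        (TensorProduct.assoc ℂ A A A).toLinearMap) fun x y => by
      have hmul : ∀ x y : (A ⊗[ℂ] A) ⊗[ℂ] A, TensorProduct.assoc ℂ A A A (x * y) =
          TensorProduct.assoc ℂ A A A x * TensorProduct.assoc ℂ A A A y := by
        intro x y
        induction x with
        | zero => simp
        | add x x' h h' => simp only [add_mul, map_add, h, h']
        | tmul x a =>
          induction y with
          | zero => simp
          | add y y' h h' => simp only [map_add, mul_add, h, h']
          | tmul y b =>
            induction x with
            | zero => simp
            | add x x' h h' => simp only [add_mul, map_add, TensorProduct.add_tmul, h, h']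
            | tmul x a =>
              induction y with
              | zero => simp
              | add y y' h h' => simp only [map_add, mul_add, TensorProduct.add_tmul, h, h']
              | tmul y b => simp
      apply (TensorProduct.assoc ℂ A A A).injective
      simp [hmul, right_mul]
  map_add' _ _ := ext (fun _ => map_add (TensorProduct.assoc ℂ A A A).symm _ _)
    (fun _ => map_add (TensorProduct.assoc ℂ A A A).symm _ _)
  map_smul' c _ := ext (fun _ => map_smul (TensorProduct.assoc ℂ A A A).symm c _)
    (fun _ => map_smul (TensorProduct.assoc ℂ A A A).symm c _)

end Multiplier

end Multiplier

/-! ### Weak multiplier Hopf algebras -/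

section WeakMultiplierHopf

variable {A : Type*} [NonUnitalRing A] [Module ℂ A] [SMulCommClass ℂ A A] [IsScalarTower ℂ A A]

/-- `T` applied to the first and second legs of `A ⊗ A ⊗ A`. -/
def onLegs12 (T : A ⊗[ℂ] A →ₗ[ℂ] A ⊗[ℂ] A) : (A ⊗[ℂ] A) ⊗[ℂ] A →ₗ[ℂ] (A ⊗[ℂ] A) ⊗[ℂ] A :=
  T.rTensor A

/-- `T` applied to the second and third legs of `A ⊗ A ⊗ A`. -/
def onLegs23 (T : A ⊗[ℂ] A →ₗ[ℂ] A ⊗[ℂ] A) : (A ⊗[ℂ] A) ⊗[ℂ] A →ₗ[ℂ] (A ⊗[ℂ] A) ⊗[ℂ] A :=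
  (TensorProduct.assoc ℂ A A A).symm.toLinearMap ∘ₗ T.lTensor A ∘ₗ
    (TensorProduct.assoc ℂ A A A).toLinearMap

/-- `T` applied to the first and third legs of `A ⊗ A ⊗ A`. -/
def onLegs13 (T : A ⊗[ℂ] A →ₗ[ℂ] A ⊗[ℂ] A) : (A ⊗[ℂ] A) ⊗[ℂ] A →ₗ[ℂ] (A ⊗[ℂ] A) ⊗[ℂ] A :=
  (TensorProduct.rightComm ℂ A A A).toLinearMap ∘ₗ T.rTensor A ∘ₗ
    (TensorProduct.rightComm ℂ A A A).toLinearMap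

/-- The slice map `ε ⊗ id`. -/
def sliceLeft (ε : A →ₗ[ℂ] ℂ) : A ⊗[ℂ] A →ₗ[ℂ] A :=
  (TensorProduct.lid ℂ A).toLinearMap ∘ₗ ε.rTensor A

/-- The slice map `id ⊗ ε`. -/
def sliceRight (ε : A →ₗ[ℂ] ℂ) : A ⊗[ℂ] A →ₗ[ℂ] A :=
  (TensorProduct.rid ℂ A).toLinearMap ∘ₗ ε.lTensor A

/-- The map `Δ ⊗ id : A ⊗ A → M(A ⊗ A ⊗ A)`. -/
def comulTensorId (Δ : A →ₗ[ℂ] Multiplier (A ⊗[ℂ] A)) :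
    A ⊗[ℂ] A →ₗ[ℂ] Multiplier ((A ⊗[ℂ] A) ⊗[ℂ] A) :=
  TensorProduct.lift (Multiplier.tensor.compl₁₂ Δ Multiplier.of)

/-- The map `id ⊗ Δ : A ⊗ A → M(A ⊗ A ⊗ A)`. -/
def idTensorComul (Δ : A →ₗ[ℂ] Multiplier (A ⊗[ℂ] A)) :
    A ⊗[ℂ] A →ₗ[ℂ] Multiplier ((A ⊗[ℂ] A) ⊗[ℂ] A) :=
  Multiplier.reassoc ∘ₗ TensorProduct.lift (Multiplier.tensor.compl₁₂ Multiplier.of Δ)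

/-- The multiplier `E ⊗ 1` of `A ⊗ A ⊗ A`. -/
def leg12 (E : Multiplier (A ⊗[ℂ] A)) : Multiplier ((A ⊗[ℂ] A) ⊗[ℂ] A) :=
  Multiplier.tensor E 1

/-- The multiplier `1 ⊗ E` of `A ⊗ A ⊗ A`. -/
def leg23 (E : Multiplier (A ⊗[ℂ] A)) : Multiplier ((A ⊗[ℂ] A) ⊗[ℂ] A) :=
  Multiplier.reassoc (Multiplier.tensor 1 E)

/-- For a homomorphism `φ : B → M(C)` and an idempotent `e ∈ M(C)` with `φ(B) C = e C` and
`C φ(B) = C e`, there is a unique homomorphism `M(B) → M(C)` that extends `φ` and sends `1` to `e`.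
This says that it sends `m` to `n`. (The conditions determine `n`: they prescribe `n` on
`e C = φ(B) C` and make it zero on `(1 - e) C`.) -/
structure ExtendsTo {B C : Type*}
    [NonUnitalRing B] [Module ℂ B] [SMulCommClass ℂ B B] [IsScalarTower ℂ B B]
    [NonUnitalRing C] [Module ℂ C] [SMulCommClass ℂ C C] [IsScalarTower ℂ C C]
    (φ : B →ₗ[ℂ] Multiplier C) (e : Multiplier C) (m : Multiplier B) (n : Multiplier C) :
    Prop where
  mul_unit : n * e = n
  unit_mul : e * n = n
  mul_apply : ∀ x, n * φ x = φ (m.left x)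
  apply_mul : ∀ x, φ x * n = φ (m.right x)

/-- The structure maps that witness that `(A, Δ, ε)` is a weak multiplier Hopf algebra in the sense
of Van Daele and Wang. They are determined by `A`, `Δ` and `ε`: the canonical maps `T₁`, `T₂`, the
canonical idempotent `E` and the projections `G₁`, `G₂`. -/
structure WeakMultiplierHopfData (Δ : A →ₗ[ℂ] Multiplier (A ⊗[ℂ] A)) (ε : A →ₗ[ℂ] ℂ) where
  /-- The algebra is non-degenerate and idempotent. -/
  left_nondeg : ∀ a : A, (∀ b, a * b = 0) → a = 0
  right_nondeg : ∀ a : A, (∀ b, b * a = 0) → a = 0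
  idempotent : Submodule.span ℂ {x : A | ∃ a b, a * b = x} = ⊤
  /-- `Δ` is a homomorphism. -/
  map_mul : ∀ a b, Δ (a * b) = Δ a * Δ b
  /-- The elements `Δ(a)(1 ⊗ b)` and `(a ⊗ 1)Δ(b)` lie in `A ⊗ A`; this defines `T₁`, `T₂`. -/
  T₁ : A ⊗[ℂ] A →ₗ[ℂ] A ⊗[ℂ] A
  T₂ : A ⊗[ℂ] A →ₗ[ℂ] A ⊗[ℂ] A
  T₁_spec : ∀ a b, Multiplier.of (T₁ (a ⊗ₜ b)) = Δ a * Multiplier.tensor 1 (Multiplier.of b)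
  T₂_spec : ∀ a b, Multiplier.of (T₂ (a ⊗ₜ b)) = Multiplier.tensor (Multiplier.of a) 1 * Δ b
  /-- Coassociativity:
  `(a ⊗ 1 ⊗ 1)(Δ ⊗ id)(Δ(b)(1 ⊗ c)) = (id ⊗ Δ)((a ⊗ 1)Δ(b))(1 ⊗ 1 ⊗ c)`. -/
  coassoc : onLegs12 T₂ ∘ₗ onLegs23 T₁ = onLegs23 T₁ ∘ₗ onLegs12 T₂
  /-- `Δ` is full: its left and right legs are all of `A`. -/
  left_full : ∀ V : Submodule ℂ A,
    (∀ a b, T₁ (a ⊗ₜ b) ∈ LinearMap.range (V.subtype.rTensor A)) → V = ⊤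
  right_full : ∀ W : Submodule ℂ A,
    (∀ a b, T₂ (a ⊗ₜ b) ∈ LinearMap.range (W.subtype.lTensor A)) → W = ⊤
  /-- `ε` is a counit. -/
  counit_left : ∀ a b, sliceLeft ε (T₁ (a ⊗ₜ b)) = a * b
  counit_right : ∀ a b, sliceRight ε (T₂ (a ⊗ₜ b)) = a * b
  /-- The idempotent `E` gives the ranges of the canonical maps:
  `T₁(A ⊗ A) = E(A ⊗ A)` and `T₂(A ⊗ A) = (A ⊗ A)E`. -/
  E : Multiplier (A ⊗[ℂ] A)
  E_idem : E * E = E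
  range_T₁ : LinearMap.range T₁ = LinearMap.range E.left
  range_T₂ : LinearMap.range T₂ = LinearMap.range E.right
  /-- `(Δ ⊗ id)(E) = (id ⊗ Δ)(E) = (E ⊗ 1)(1 ⊗ E) = (1 ⊗ E)(E ⊗ 1)`, where `Δ ⊗ id` and `id ⊗ Δ`
  are extended to `M(A ⊗ A)` with values `E ⊗ 1` and `1 ⊗ E` at the unit. -/
  comulTensorId_E : ExtendsTo (comulTensorId Δ) (leg12 E) E (leg12 E * leg23 E)
  idTensorComul_E : ExtendsTo (idTensorComul Δ) (leg23 E) E (leg12 E * leg23 E)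
  E_comm : leg12 E * leg23 E = leg23 E * leg12 E
  /-- The maps `G₁`, `G₂` are given by
  `(G₁ ⊗ id)(Δ₁₃(a)(1 ⊗ b ⊗ c)) = Δ₁₃(a)(1 ⊗ E)(1 ⊗ b ⊗ c)` and
  `(id ⊗ G₂)((a ⊗ b ⊗ 1)Δ₁₃(c)) = (a ⊗ b ⊗ 1)(E ⊗ 1)Δ₁₃(c)`, and give the kernels:
  `ker Tᵢ = (1 - Gᵢ)(A ⊗ A)`. -/
  G₁ : A ⊗[ℂ] A →ₗ[ℂ] A ⊗[ℂ] A
  G₂ : A ⊗[ℂ] A →ₗ[ℂ] A ⊗[ℂ] A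
  G₁_spec : onLegs12 G₁ ∘ₗ onLegs13 T₁ = onLegs13 T₁ ∘ₗ onLegs23 E.left
  G₂_spec : onLegs23 G₂ ∘ₗ onLegs13 T₂ = onLegs13 T₂ ∘ₗ onLegs12 E.right
  ker_T₁ : LinearMap.ker T₁ = LinearMap.range (LinearMap.id - G₁)
  ker_T₂ : LinearMap.ker T₂ = LinearMap.range (LinearMap.id - G₂)

/-- `(A, Δ, ε)` is a weak multiplier Hopf algebra. -/
def IsWeakMultiplierHopf (Δ : A →ₗ[ℂ] Multiplier (A ⊗[ℂ] A)) (ε : A →ₗ[ℂ] ℂ) : Prop :=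
  Nonempty (WeakMultiplierHopfData Δ ε)

/-- `T` has range projection `E`, kernel `(1 - G)(A ⊗ A)`, and `R` is the corresponding generalized
inverse. -/
structure IsGenInverse {V : Type*} [AddCommGroup V] [Module ℂ V] (T E G R : V →ₗ[ℂ] V) :
    Prop where
  TR : T ∘ₗ R = E
  RT : R ∘ₗ T = G
  TRT : T ∘ₗ R ∘ₗ T = T
  RTR : R ∘ₗ T ∘ₗ R = R

/-- `S : A → M(A)` is the antipode of the weak multiplier Hopf algebra `(A, Δ, ε)`, that is,
`S(a) b = (ε ⊗ id) R₁(a ⊗ b)` and `b S(a) = (id ⊗ ε) R₂(b ⊗ a)`, where `R₁`, `R₂` are the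
generalized inverses of `T₁`, `T₂` determined by `E`, `G₁`, `G₂`. -/
def IsWeakMultiplierHopfAntipode (Δ : A →ₗ[ℂ] Multiplier (A ⊗[ℂ] A)) (ε : A →ₗ[ℂ] ℂ)
    (S : A →ₗ[ℂ] Multiplier A) : Prop :=
  ∃ (D : WeakMultiplierHopfData Δ ε) (R₁ R₂ : A ⊗[ℂ] A →ₗ[ℂ] A ⊗[ℂ] A),
    IsGenInverse D.T₁ D.E.left D.G₁ R₁ ∧ IsGenInverse D.T₂ D.E.right D.G₂ R₂ ∧
    (∀ a b, (S a).left b = sliceLeft ε (R₁ (a ⊗ₜ b))) ∧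
    (∀ a b, (S a).right b = sliceRight ε (R₂ (b ⊗ₜ a)))

end WeakMultiplierHopf

/-! ### Partial bialgebras -/

/-- The set `M₂(I)` of `2 × 2`-matrices `(k l; m n)` over `I`, written `⟨k, l, m, n⟩`. -/
@[ext]
structure M₂ (I : Type u) where
  lu : I
  ru : I
  ld : I
  rd : I

/-- A partial bialgebra over `ℂ` with object set `I`. The spaces `A ⟨k, l, m, n⟩` form a partial
algebra with respect to the columns `(k; m)` and `(l; n)`, and a partial coalgebra with respect to
the rows `(k, l)` and `(m, n)`; the counit is extended by zero to the components with unequal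
rows. -/
structure PartialBialgebra (I : Type u) where
  A : M₂ I → Type v
  [addCommGroup : ∀ K, AddCommGroup (A K)]
  [module : ∀ K, Module ℂ (A K)]
  /-- The multiplication `A(K) ⊗ A(L) → A(K · L)` for `K_r = L_l`. -/
  mul : ∀ {k l m n p q : I}, A ⟨k, l, m, n⟩ →ₗ[ℂ] A ⟨l, p, n, q⟩ →ₗ[ℂ] A ⟨k, p, m, q⟩
  /-- The unit at the column `(k; m)`. -/
  one : ∀ k m : I, A ⟨k, k, m, m⟩
  mul_assoc : ∀ {k l m n p q s t : I} (a : A ⟨k, l, m, n⟩) (b : A ⟨l, p, n, q⟩)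
    (c : A ⟨p, s, q, t⟩), mul (mul a b) c = mul a (mul b c)
  one_mul : ∀ {k l m n : I} (a : A ⟨k, l, m, n⟩), mul (one k m) a = a
  mul_one : ∀ {k l m n : I} (a : A ⟨k, l, m, n⟩), mul a (one l n) = a
  /-- The comultiplication `Δ_{rs}`. -/
  comul : ∀ {k l m n : I} (r s : I),
    A ⟨k, l, m, n⟩ →ₗ[ℂ] A ⟨k, l, r, s⟩ ⊗[ℂ] A ⟨r, s, m, n⟩
  counit : ∀ {k l m n : I}, A ⟨k, l, m, n⟩ →ₗ[ℂ] ℂ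
  counit_of_ne : ∀ {k l m n : I} (a : A ⟨k, l, m, n⟩), (k, l) ≠ (m, n) → counit a = 0
  /-- `(Δ_{pq} ⊗ id)Δ_{rs} = (id ⊗ Δ_{rs})Δ_{pq}`. -/
  coassoc : ∀ {k l m n : I} (p q r s : I) (a : A ⟨k, l, m, n⟩),
    TensorProduct.assoc ℂ _ _ _ ((comul p q).rTensor (A ⟨r, s, m, n⟩) (comul r s a)) =
      (comul r s).lTensor (A ⟨k, l, p, q⟩) (comul p q a)
  counit_comul : ∀ {k l m n : I} (a : A ⟨k, l, m, n⟩),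
    TensorProduct.lid ℂ _ ((counit : A ⟨k, l, k, l⟩ →ₗ[ℂ] ℂ).rTensor (A ⟨k, l, m, n⟩)
      (comul k l a)) = a
  comul_counit : ∀ {k l m n : I} (a : A ⟨k, l, m, n⟩),
    TensorProduct.rid ℂ _ ((counit : A ⟨m, n, m, n⟩ →ₗ[ℂ] ℂ).lTensor (A ⟨k, l, m, n⟩)
      (comul m n a)) = a
  /-- Comultiplication of units. -/
  comul_one : ∀ k l m : I, comul l l (one k m) = one k l ⊗ₜ[ℂ] one l m
  comul_one_of_ne : ∀ k l l' m : I, l ≠ l' → comul l l' (one k m) = 0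
  /-- Counit of multiplication. -/
  counit_mul : ∀ {k l m n p q : I} (a : A ⟨k, l, m, n⟩) (b : A ⟨l, p, n, q⟩),
    counit (mul a b) = counit a * counit b
  /-- Non-degeneracy. -/
  counit_one : ∀ k : I, counit (one k k) = 1
  /-- Finiteness: `(r, s) ↦ Δ_{rs}(a)` is row- and column-finite. -/
  finite_row : ∀ {k l m n : I} (a : A ⟨k, l, m, n⟩) (r : I), {s | comul r s a ≠ 0}.Finite
  finite_col : ∀ {k l m n : I} (a : A ⟨k, l, m, n⟩) (s : I), {r | comul r s a ≠ 0}.Finite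
  /-- Comultiplication is multiplicative: `Δ_{rs}(ab) = ∑ t, Δ_{rt}(a)Δ_{ts}(b)`. -/
  comul_mul : ∀ {k l m n p q : I} (r s : I) (a : A ⟨k, l, m, n⟩) (b : A ⟨l, p, n, q⟩),
    comul r s (mul a b) =
      ∑ᶠ t : I, TensorProduct.map₂ (mul : A ⟨k, l, r, t⟩ →ₗ[ℂ] A ⟨l, p, t, s⟩ →ₗ[ℂ] A ⟨k, p, r, s⟩)
        (mul : A ⟨r, t, m, n⟩ →ₗ[ℂ] A ⟨t, s, n, q⟩ →ₗ[ℂ] A ⟨r, s, m, q⟩)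
        (comul r t a) (comul t s b)

namespace PartialBialgebra

attribute [instance] PartialBialgebra.addCommGroup PartialBialgebra.module

variable {I : Type u} (𝒜 : PartialBialgebra.{u, v} I)

open scoped Classical in
/-- The underlying space of the total algebra. -/
def Total : Type (max u v) := ⨁ K : M₂ I, 𝒜.A K

instance : AddCommGroup 𝒜.Total := inferInstanceAs (AddCommGroup (⨁ K : M₂ I, 𝒜.A K))

instance : Module ℂ 𝒜.Total := inferInstanceAs (Module ℂ (⨁ K : M₂ I, 𝒜.A K))

open scoped Classical in
/-- The inclusion of the component `A(K)` in the total algebra. -/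
def incl (K : M₂ I) : 𝒜.A K →ₗ[ℂ] 𝒜.Total := DirectSum.lof ℂ (M₂ I) 𝒜.A K

open scoped Classical in
/-- The linear map on the total algebra with given restrictions to the components. -/
def totalLift {V : Type*} [AddCommGroup V] [Module ℂ V] (f : ∀ K, 𝒜.A K →ₗ[ℂ] V) :
    𝒜.Total →ₗ[ℂ] V := DirectSum.toModule ℂ (M₂ I) V f

theorem totalLift_incl {V : Type*} [AddCommGroup V] [Module ℂ V] (f : ∀ K, 𝒜.A K →ₗ[ℂ] V)
    (K : M₂ I) (a : 𝒜.A K) : 𝒜.totalLift f (𝒜.incl K a) = f K a := by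
  classical
  exact DirectSum.toModule_lof ℂ K a

variable {𝒜} in
theorem total_induction {p : 𝒜.Total → Prop} (x : 𝒜.Total) (zero : p 0)
    (incl : ∀ K a, p (𝒜.incl K a)) (add : ∀ x y, p x → p y → p (x + y)) : p x := by
  classical
  exact DirectSum.induction_on x zero incl add

open scoped Classical in
/-- The product of two components, as elements of the total algebra; it is zero if the columns do
not match. -/
def mulComp : ∀ K L : M₂ I, 𝒜.A K →ₗ[ℂ] 𝒜.A L →ₗ[ℂ] 𝒜.Total
  | ⟨k, l, m, n⟩, ⟨l', p, n', q⟩ =>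
    if h : l = l' ∧ n = n' then by
      cases h.1
      cases h.2
      exact (𝒜.mul (k := k) (l := l) (m := m) (n := n) (p := p) (q := q)).compr₂
        (𝒜.incl ⟨k, p, m, q⟩)
    else 0

theorem mulComp_eq {k l m n p q : I} (a : 𝒜.A ⟨k, l, m, n⟩) (b : 𝒜.A ⟨l, p, n, q⟩) :
    𝒜.mulComp ⟨k, l, m, n⟩ ⟨l, p, n, q⟩ a b = 𝒜.incl ⟨k, p, m, q⟩ (𝒜.mul a b) := by
  have h : 𝒜.mulComp ⟨k, l, m, n⟩ ⟨l, p, n, q⟩ = 𝒜.mul.compr₂ (𝒜.incl ⟨k, p, m, q⟩) :=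
    dif_pos ⟨rfl, rfl⟩
  rw [h]
  rfl

theorem mulComp_of_ne {K L : M₂ I} (h : ¬ (K.ru = L.lu ∧ K.rd = L.ld)) :
    𝒜.mulComp K L = 0 := by
  obtain ⟨k, l, m, n⟩ := K
  obtain ⟨l', p, n', q⟩ := L
  exact dif_neg h

/-- The multiplication of the total algebra. -/
def totalMul : 𝒜.Total →ₗ[ℂ] 𝒜.Total →ₗ[ℂ] 𝒜.Total :=
  𝒜.totalLift fun K => (𝒜.totalLift fun L => (𝒜.mulComp K L).flip).flip

instance : Mul 𝒜.Total := ⟨fun x y => 𝒜.totalMul x y⟩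

theorem incl_mul (K L : M₂ I) (a : 𝒜.A K) (b : 𝒜.A L) :
    𝒜.incl K a * 𝒜.incl L b = 𝒜.mulComp K L a b := by
  change 𝒜.totalMul _ _ = _
  simp [totalMul, totalLift_incl]

instance : NonUnitalNonAssocRing 𝒜.Total where
  left_distrib x y z := map_add (𝒜.totalMul x) y z
  right_distrib x y z := 𝒜.totalMul.map_add₂ x y z
  zero_mul x := 𝒜.totalMul.map_zero₂ x
  mul_zero x := map_zero (𝒜.totalMul x)

instance : NonUnitalRing 𝒜.Total where
  mul_assoc x y z := by
    induction x using total_induction with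
    | zero => simp only [zero_mul]
    | add x x' h h' => simp only [add_mul, h, h']
    | incl K a =>
    induction y using total_induction with
    | zero => simp only [zero_mul, mul_zero]
    | add x x' h h' => simp only [add_mul, mul_add, h, h']
    | incl L b =>
    induction z using total_induction with
    | zero => simp only [mul_zero]
    | add x x' h h' => simp only [mul_add, h, h']
    | incl M c =>
    obtain ⟨k, l, m, n⟩ := K
    obtain ⟨l', p, n', q⟩ := L
    obtain ⟨p', s, q', t⟩ := M
    by_cases h1 : l = l' ∧ n = n'
    · obtain ⟨rfl, rfl⟩ := h1
      by_cases h2 : p = p' ∧ q = q'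
      · obtain ⟨rfl, rfl⟩ := h2
        simp only [incl_mul, mulComp_eq, 𝒜.mul_assoc]
      · rw [incl_mul, incl_mul, mulComp_eq, incl_mul, mulComp_of_ne _ h2, mulComp_of_ne _ h2]
        simp
    · rw [incl_mul, mulComp_of_ne _ h1, incl_mul]
      by_cases h2 : p = p' ∧ q = q'
      · obtain ⟨rfl, rfl⟩ := h2
        rw [mulComp_eq, incl_mul, mulComp_of_ne _ h1]
        simp
      · rw [mulComp_of_ne _ h2]
        simp

instance : SMulCommClass ℂ 𝒜.Total 𝒜.Total :=
  ⟨fun c x y => (map_smul (𝒜.totalMul x) c y).symm⟩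

instance : IsScalarTower ℂ 𝒜.Total 𝒜.Total :=
  ⟨fun c x y => 𝒜.totalMul.map_smul₂ c x y⟩

/-! ### The multipliers `λ_k` and `ρ_l` -/

/-- The unit `𝟏(k; l)` as an element of the total algebra. -/
def unit (k l : I) : 𝒜.Total := 𝒜.incl ⟨k, k, l, l⟩ (𝒜.one k l)

theorem unit_mul_incl (k l : I) (K : M₂ I) (a : 𝒜.A K) [Decidable (k = K.lu ∧ l = K.ld)] :
    𝒜.unit k l * 𝒜.incl K a = if k = K.lu ∧ l = K.ld then 𝒜.incl K a else 0 := by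
  obtain ⟨p, q, r, s⟩ := K
  split_ifs with h
  · obtain ⟨rfl, rfl⟩ := h
    rw [unit, incl_mul, mulComp_eq, 𝒜.one_mul]
  · rw [unit, incl_mul, mulComp_of_ne _ h]
    rfl

theorem incl_mul_unit (k l : I) (K : M₂ I) (a : 𝒜.A K) [Decidable (K.ru = k ∧ K.rd = l)] :
    𝒜.incl K a * 𝒜.unit k l = if K.ru = k ∧ K.rd = l then 𝒜.incl K a else 0 := by
  obtain ⟨p, q, r, s⟩ := K
  split_ifs with h
  · obtain ⟨rfl, rfl⟩ := h
    rw [unit, incl_mul, mulComp_eq, 𝒜.mul_one]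
  · rw [unit, incl_mul, mulComp_of_ne _ h]
    rfl

variable {𝒜} in
/-- Families of linear maps on the total algebra that are locally finite on components are locally
finite. -/
theorem finite_of_incl {ι : Type*} {V : Type*} [AddCommGroup V] [Module ℂ V]
    (f : ι → 𝒜.Total →ₗ[ℂ] V) (h : ∀ K a, {i | f i (𝒜.incl K a) ≠ 0}.Finite) (x : 𝒜.Total) :
    {i | f i x ≠ 0}.Finite := by
  induction x using total_induction with
  | zero => simp
  | incl K a => exact h K a
  | add x y hx hy =>
    refine (hx.union hy).subset fun i hi => ?_
    by_contra hc
    simp only [Set.mem_union, Set.mem_ofPred_eq, not_or, not_not] at hc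
    exact hi (by rw [map_add, hc.1, hc.2, add_zero])

variable {𝒜} in
theorem finite_of_incl₂ {ι : Type*} {V : Type*} [AddCommGroup V] [Module ℂ V]
    (f : ι → 𝒜.Total ⊗[ℂ] 𝒜.Total →ₗ[ℂ] V)
    (h : ∀ K a L b, {i | f i (𝒜.incl K a ⊗ₜ 𝒜.incl L b) ≠ 0}.Finite)
    (x : 𝒜.Total ⊗[ℂ] 𝒜.Total) : {i | f i x ≠ 0}.Finite := by
  induction x with
  | zero => simp
  | add x y hx hy =>
    refine (hx.union hy).subset fun i hi => ?_
    by_contra hc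
    simp only [Set.mem_union, Set.mem_ofPred_eq, not_or, not_not] at hc
    exact hi (by rw [map_add, hc.1, hc.2, add_zero])
  | tmul a b =>
    refine finite_of_incl
      (fun i => f i ∘ₗ (TensorProduct.mk ℂ 𝒜.Total 𝒜.Total).flip b) (fun K a => ?_) a
    exact finite_of_incl (fun i => f i ∘ₗ TensorProduct.mk ℂ 𝒜.Total 𝒜.Total (𝒜.incl K a))
      (fun L b => h K a L b) b

/-- `λ_k = ∑ l, 𝟏(k; l)`, a strictly convergent sum in `M(A)`. -/
def lam (k : I) : Multiplier 𝒜.Total :=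
  Multiplier.strictSum (fun l => Multiplier.of (𝒜.unit k l))
    (finite_of_incl _ fun K a => (Set.finite_singleton K.ld).subset fun l hl => by
      classical
      by_contra hc
      exact hl ((𝒜.unit_mul_incl k l K a).trans (if_neg fun h => hc h.2)))
    (finite_of_incl _ fun K a => (Set.finite_singleton K.rd).subset fun l hl => by
      classical
      by_contra hc
      exact hl ((𝒜.incl_mul_unit k l K a).trans (if_neg fun h => hc h.2.symm)))

/-- `ρ_l = ∑ k, 𝟏(k; l)`, a strictly convergent sum in `M(A)`. -/
def rho (l : I) : Multiplier 𝒜.Total :=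
  Multiplier.strictSum (fun k => Multiplier.of (𝒜.unit k l))
    (finite_of_incl _ fun K a => (Set.finite_singleton K.lu).subset fun k hk => by
      classical
      by_contra hc
      exact hk ((𝒜.unit_mul_incl k l K a).trans (if_neg fun h => hc h.1)))
    (finite_of_incl _ fun K a => (Set.finite_singleton K.ru).subset fun k hk => by
      classical
      by_contra hc
      exact hk ((𝒜.incl_mul_unit k l K a).trans (if_neg fun h => hc h.1.symm)))

theorem rho_left_of_ne (l : I) (K : M₂ I) (a : 𝒜.A K) (h : l ≠ K.ld) :
    (𝒜.rho l).left (𝒜.incl K a) = 0 := by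
  classical
  refine (finsum_congr fun k => ?_).trans finsum_zero
  exact (𝒜.unit_mul_incl k l K a).trans (if_neg fun hc => h hc.2)

theorem rho_right_of_ne (l : I) (K : M₂ I) (a : 𝒜.A K) (h : l ≠ K.rd) :
    (𝒜.rho l).right (𝒜.incl K a) = 0 := by
  classical
  refine (finsum_congr fun k => ?_).trans finsum_zero
  exact (𝒜.incl_mul_unit k l K a).trans (if_neg fun hc => h hc.2.symm)

theorem lam_right_of_ne (k : I) (K : M₂ I) (a : 𝒜.A K) (h : k ≠ K.ru) :
    (𝒜.lam k).right (𝒜.incl K a) = 0 := by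
  classical
  refine (finsum_congr fun l => ?_).trans finsum_zero
  exact (𝒜.incl_mul_unit k l K a).trans (if_neg fun hc => h hc.1.symm)

/-! ### The total comultiplication, the canonical maps and the maps `Eᵢ`, `Gᵢ` -/

/-- `Δ_{rs}`, extended linearly to the total algebra. -/
def comulTotal (r s : I) : 𝒜.Total →ₗ[ℂ] 𝒜.Total ⊗[ℂ] 𝒜.Total :=
  𝒜.totalLift fun K => TensorProduct.map (𝒜.incl ⟨K.lu, K.ru, r, s⟩) (𝒜.incl ⟨r, s, K.ld, K.rd⟩) ∘ₗ
    𝒜.comul (k := K.lu) (l := K.ru) (m := K.ld) (n := K.rd) r s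

theorem comulTotal_incl (r s : I) (K : M₂ I) (a : 𝒜.A K) :
    𝒜.comulTotal r s (𝒜.incl K a) =
      TensorProduct.map (𝒜.incl ⟨K.lu, K.ru, r, s⟩) (𝒜.incl ⟨r, s, K.ld, K.rd⟩)
        (𝒜.comul (k := K.lu) (l := K.ru) (m := K.ld) (n := K.rd) r s a) :=
  𝒜.totalLift_incl _ K a

variable {𝒜} in
/-- A family indexed by `I × I` is locally finite if its terms at `(r, s)` depend linearly on
`Δ_{rs}(a)` and vanish for `s ≠ s₀`. -/
theorem finite_of_col {V : Type*} [AddCommGroup V] [Module ℂ V]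
    (g : I × I → 𝒜.Total ⊗[ℂ] 𝒜.Total →ₗ[ℂ] V) (K : M₂ I) (s₀ : I)
    (h : ∀ r s, s ≠ s₀ → ∀ u v,
      g (r, s) (𝒜.incl ⟨K.lu, K.ru, r, s⟩ u ⊗ₜ 𝒜.incl ⟨r, s, K.ld, K.rd⟩ v) = 0) (a : 𝒜.A K) :
    {p : I × I | g p (𝒜.comulTotal p.1 p.2 (𝒜.incl K a)) ≠ 0}.Finite := by
  refine ((𝒜.finite_col (k := K.lu) (l := K.ru) (m := K.ld) (n := K.rd) a s₀).prod
    (Set.finite_singleton s₀)).subset ?_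
  rintro ⟨r, s⟩ hp
  have hs : s = s₀ := by
    by_contra hs
    refine hp ?_
    dsimp only
    rw [comulTotal_incl]
    have : g (r, s) ∘ₗ TensorProduct.map (𝒜.incl ⟨K.lu, K.ru, r, s⟩)
        (𝒜.incl ⟨r, s, K.ld, K.rd⟩) = 0 := TensorProduct.ext' fun u v => h r s hs u v
    exact LinearMap.congr_fun this _
  refine ⟨fun h0 => hp ?_, hs⟩
  subst hs
  dsimp only at h0 ⊢
  rw [comulTotal_incl, h0, map_zero, map_zero]

variable {𝒜} in
/-- A family indexed by `I × I` is locally finite if its terms at `(r, s)` depend linearly on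
`Δ_{rs}(a)` and vanish for `r ≠ r₀`. -/
theorem finite_of_row {V : Type*} [AddCommGroup V] [Module ℂ V]
    (g : I × I → 𝒜.Total ⊗[ℂ] 𝒜.Total →ₗ[ℂ] V) (K : M₂ I) (r₀ : I)
    (h : ∀ r s, r ≠ r₀ → ∀ u v,
      g (r, s) (𝒜.incl ⟨K.lu, K.ru, r, s⟩ u ⊗ₜ 𝒜.incl ⟨r, s, K.ld, K.rd⟩ v) = 0) (a : 𝒜.A K) :
    {p : I × I | g p (𝒜.comulTotal p.1 p.2 (𝒜.incl K a)) ≠ 0}.Finite := by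
  refine ((Set.finite_singleton r₀).prod
    (𝒜.finite_row (k := K.lu) (l := K.ru) (m := K.ld) (n := K.rd) a r₀)).subset ?_
  rintro ⟨r, s⟩ hp
  have hr : r = r₀ := by
    by_contra hr
    refine hp ?_
    dsimp only
    rw [comulTotal_incl]
    have : g (r, s) ∘ₗ TensorProduct.map (𝒜.incl ⟨K.lu, K.ru, r, s⟩)
        (𝒜.incl ⟨r, s, K.ld, K.rd⟩) = 0 := TensorProduct.ext' fun u v => h r s hr u v
    exact LinearMap.congr_fun this _
  refine ⟨hr, fun h0 => hp ?_⟩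
  subst hr
  dsimp only at h0 ⊢
  rw [comulTotal_incl, h0, map_zero, map_zero]

theorem incl_mul_of_ne {K L : M₂ I} (h : ¬ (K.ru = L.lu ∧ K.rd = L.ld)) (a : 𝒜.A K) (b : 𝒜.A L) :
    𝒜.incl K a * 𝒜.incl L b = 0 := by
  rw [incl_mul, mulComp_of_ne _ h]
  rfl

theorem finite_comul_mul (a : 𝒜.Total) (x : 𝒜.Total ⊗[ℂ] 𝒜.Total) :
    {p : I × I | 𝒜.comulTotal p.1 p.2 a * x ≠ 0}.Finite := by
  refine finite_of_incl₂ (fun p : I × I => LinearMap.mulLeft ℂ (𝒜.comulTotal p.1 p.2 a))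
    (fun L b M c => ?_) x
  refine finite_of_incl (fun p : I × I =>
    LinearMap.mulRight ℂ (𝒜.incl L b ⊗ₜ[ℂ] 𝒜.incl M c) ∘ₗ 𝒜.comulTotal p.1 p.2)
    (fun K a => ?_) a
  refine finite_of_col (fun _ => LinearMap.mulRight ℂ (𝒜.incl L b ⊗ₜ[ℂ] 𝒜.incl M c)) K M.lu
    (fun r s hs u v => ?_) a
  rw [LinearMap.mulRight_apply, Algebra.TensorProduct.tmul_mul_tmul,
    𝒜.incl_mul_of_ne (K := ⟨r, s, K.ld, K.rd⟩) (fun h => hs h.1), TensorProduct.tmul_zero]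

theorem finite_mul_comul (a : 𝒜.Total) (x : 𝒜.Total ⊗[ℂ] 𝒜.Total) :
    {p : I × I | x * 𝒜.comulTotal p.1 p.2 a ≠ 0}.Finite := by
  refine finite_of_incl₂ (fun p : I × I => LinearMap.mulRight ℂ (𝒜.comulTotal p.1 p.2 a))
    (fun L b M c => ?_) x
  refine finite_of_incl (fun p : I × I =>
    LinearMap.mulLeft ℂ (𝒜.incl L b ⊗ₜ[ℂ] 𝒜.incl M c) ∘ₗ 𝒜.comulTotal p.1 p.2)
    (fun K a => ?_) a
  refine finite_of_row (fun _ => LinearMap.mulLeft ℂ (𝒜.incl L b ⊗ₜ[ℂ] 𝒜.incl M c)) K M.ru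
    (fun r s hr u v => ?_) a
  rw [LinearMap.mulLeft_apply, Algebra.TensorProduct.tmul_mul_tmul,
    𝒜.incl_mul_of_ne (L := ⟨r, s, K.ld, K.rd⟩) (fun h => hr h.1.symm), TensorProduct.tmul_zero]

/-- The total comultiplication `Δ(a) = ∑ r s, Δ_{rs}(a)`, a strictly convergent sum in
`M(A ⊗ A)`. -/
def totalComul : 𝒜.Total →ₗ[ℂ] Multiplier (𝒜.Total ⊗[ℂ] 𝒜.Total) where
  toFun a := Multiplier.strictSum (fun p : I × I => Multiplier.of (𝒜.comulTotal p.1 p.2 a))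
    (𝒜.finite_comul_mul a) (𝒜.finite_mul_comul a)
  map_add' a b := by
    refine Multiplier.ext (fun x => ?_) fun x => ?_
    · change ∑ᶠ p : I × I, 𝒜.comulTotal p.1 p.2 (a + b) * x =
        ∑ᶠ p : I × I, 𝒜.comulTotal p.1 p.2 a * x + ∑ᶠ p : I × I, 𝒜.comulTotal p.1 p.2 b * x
      simp only [map_add, add_mul]
      exact finsum_add_distrib (𝒜.finite_comul_mul a x) (𝒜.finite_comul_mul b x)
    · change ∑ᶠ p : I × I, x * 𝒜.comulTotal p.1 p.2 (a + b) =
        ∑ᶠ p : I × I, x * 𝒜.comulTotal p.1 p.2 a + ∑ᶠ p : I × I, x * 𝒜.comulTotal p.1 p.2 b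
      simp only [map_add, mul_add]
      exact finsum_add_distrib (𝒜.finite_mul_comul a x) (𝒜.finite_mul_comul b x)
  map_smul' c a := by
    refine Multiplier.ext (fun x => ?_) fun x => ?_
    · change ∑ᶠ p : I × I, 𝒜.comulTotal p.1 p.2 (c • a) * x =
        c • ∑ᶠ p : I × I, 𝒜.comulTotal p.1 p.2 a * x
      simp only [map_smul, smul_mul_assoc]
      exact (smul_finsum' c (𝒜.finite_comul_mul a x)).symm
    · change ∑ᶠ p : I × I, x * 𝒜.comulTotal p.1 p.2 (c • a) =
        c • ∑ᶠ p : I × I, x * 𝒜.comulTotal p.1 p.2 a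
      simp only [map_smul, mul_smul_comm]
      exact (smul_finsum' c (𝒜.finite_mul_comul a x)).symm

/-- The counit on the total algebra. -/
def totalCounit : 𝒜.Total →ₗ[ℂ] ℂ :=
  𝒜.totalLift fun K => 𝒜.counit (k := K.lu) (l := K.ru) (m := K.ld) (n := K.rd)

/-- The map `a ⊗ b ↦ Δ_{rs}(a)(1 ⊗ b)`. -/
def T₁Comp (r s : I) : 𝒜.Total ⊗[ℂ] 𝒜.Total →ₗ[ℂ] 𝒜.Total ⊗[ℂ] 𝒜.Total :=
  (LinearMap.mul' ℂ 𝒜.Total).lTensor 𝒜.Total ∘ₗ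
    (TensorProduct.assoc ℂ 𝒜.Total 𝒜.Total 𝒜.Total).toLinearMap ∘ₗ
      (𝒜.comulTotal r s).rTensor 𝒜.Total

/-- The map `a ⊗ b ↦ (a ⊗ 1)Δ_{rs}(b)`. -/
def T₂Comp (r s : I) : 𝒜.Total ⊗[ℂ] 𝒜.Total →ₗ[ℂ] 𝒜.Total ⊗[ℂ] 𝒜.Total :=
  (LinearMap.mul' ℂ 𝒜.Total).rTensor 𝒜.Total ∘ₗ
    (TensorProduct.assoc ℂ 𝒜.Total 𝒜.Total 𝒜.Total).symm.toLinearMap ∘ₗ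
      (𝒜.comulTotal r s).lTensor 𝒜.Total

theorem T₁Comp_tmul (r s : I) (a b : 𝒜.Total) :
    𝒜.T₁Comp r s (a ⊗ₜ b) =
      (LinearMap.mulRight ℂ b).lTensor 𝒜.Total (𝒜.comulTotal r s a) := by
  change (LinearMap.mul' ℂ 𝒜.Total).lTensor 𝒜.Total (TensorProduct.assoc ℂ _ _ _
    (𝒜.comulTotal r s a ⊗ₜ b)) = _
  induction 𝒜.comulTotal r s a with
  | zero => simp
  | add x y hx hy => simp only [TensorProduct.add_tmul, map_add, hx, hy]
  | tmul x y => simp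

theorem T₂Comp_tmul (r s : I) (a b : 𝒜.Total) :
    𝒜.T₂Comp r s (a ⊗ₜ b) =
      (LinearMap.mulLeft ℂ a).rTensor 𝒜.Total (𝒜.comulTotal r s b) := by
  change (LinearMap.mul' ℂ 𝒜.Total).rTensor 𝒜.Total ((TensorProduct.assoc ℂ _ _ _).symm
    (a ⊗ₜ 𝒜.comulTotal r s b)) = _
  induction 𝒜.comulTotal r s b with
  | zero => simp
  | add x y hx hy => simp only [TensorProduct.tmul_add, map_add, hx, hy]
  | tmul x y => simp

theorem finite_T₁Comp (x : 𝒜.Total ⊗[ℂ] 𝒜.Total) :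
    {p : I × I | 𝒜.T₁Comp p.1 p.2 x ≠ 0}.Finite := by
  refine finite_of_incl₂ (fun p : I × I => 𝒜.T₁Comp p.1 p.2) (fun K a M c => ?_) x
  simp only [T₁Comp_tmul]
  refine finite_of_col (fun _ => (LinearMap.mulRight ℂ (𝒜.incl M c)).lTensor 𝒜.Total) K M.lu
    (fun r s hs u v => ?_) a
  rw [LinearMap.lTensor_tmul, LinearMap.mulRight_apply,
    𝒜.incl_mul_of_ne (K := ⟨r, s, K.ld, K.rd⟩) (fun h => hs h.1), TensorProduct.tmul_zero]

theorem finite_T₂Comp (x : 𝒜.Total ⊗[ℂ] 𝒜.Total) :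
    {p : I × I | 𝒜.T₂Comp p.1 p.2 x ≠ 0}.Finite := by
  refine finite_of_incl₂ (fun p : I × I => 𝒜.T₂Comp p.1 p.2) (fun L b K a => ?_) x
  simp only [T₂Comp_tmul]
  refine finite_of_row (fun _ => (LinearMap.mulLeft ℂ (𝒜.incl L b)).rTensor 𝒜.Total) K L.rd
    (fun r s hr u v => ?_) a
  rw [LinearMap.rTensor_tmul, LinearMap.mulLeft_apply,
    𝒜.incl_mul_of_ne (L := ⟨K.lu, K.ru, r, s⟩) (fun h => hr h.2.symm), TensorProduct.zero_tmul]

/-- `T₁(a ⊗ b) = Δ(a)(1 ⊗ b)`, an element of `A ⊗ A`. -/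
def T₁ : 𝒜.Total ⊗[ℂ] 𝒜.Total →ₗ[ℂ] 𝒜.Total ⊗[ℂ] 𝒜.Total :=
  locFinSum (fun p : I × I => 𝒜.T₁Comp p.1 p.2) 𝒜.finite_T₁Comp

/-- `T₂(a ⊗ b) = (a ⊗ 1)Δ(b)`, an element of `A ⊗ A`. -/
def T₂ : 𝒜.Total ⊗[ℂ] 𝒜.Total →ₗ[ℂ] 𝒜.Total ⊗[ℂ] 𝒜.Total :=
  locFinSum (fun p : I × I => 𝒜.T₂Comp p.1 p.2) 𝒜.finite_T₂Comp

theorem of_T₁ (a b : 𝒜.Total) : Multiplier.of (𝒜.T₁ (a ⊗ₜ b)) =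
    𝒜.totalComul a * Multiplier.tensor 1 (Multiplier.of b) := by
  have hf := 𝒜.finite_T₁Comp (a ⊗ₜ b)
  refine Multiplier.ext (fun x => ?_) fun x => ?_
  · change (∑ᶠ p : I × I, 𝒜.T₁Comp p.1 p.2 (a ⊗ₜ b)) * x = ∑ᶠ p : I × I, 𝒜.comulTotal p.1 p.2 a *
      TensorProduct.map LinearMap.id (LinearMap.mulLeft ℂ b) x
    rw [finsum_mul' _ _ hf]
    refine finsum_congr fun p => ?_
    rw [T₁Comp_tmul]
    induction 𝒜.comulTotal p.1 p.2 a with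
    | zero => simp
    | add y y' h h' => simp only [map_add, add_mul, h, h']
    | tmul y z =>
      induction x with
      | zero => simp
      | add y y' h h' => simp only [map_add, mul_add, h, h']
      | tmul u v => simp [_root_.mul_assoc]
  · change x * (∑ᶠ p : I × I, 𝒜.T₁Comp p.1 p.2 (a ⊗ₜ b)) =
      TensorProduct.map LinearMap.id (LinearMap.mulRight ℂ b)
        (∑ᶠ p : I × I, x * 𝒜.comulTotal p.1 p.2 a)
    rw [mul_finsum' _ _ hf]
    refine Eq.trans ?_ ((TensorProduct.map LinearMap.id (LinearMap.mulRight ℂ b)).toAddMonoidHom.map_finsum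
      (𝒜.finite_mul_comul a x)).symm
    refine finsum_congr fun p => ?_
    rw [T₁Comp_tmul]
    change _ = TensorProduct.map LinearMap.id (LinearMap.mulRight ℂ b) _
    induction 𝒜.comulTotal p.1 p.2 a with
    | zero => simp
    | add y y' h h' => simp only [map_add, mul_add, h, h']
    | tmul y z =>
      induction x with
      | zero => simp
      | add y y' h h' => simp only [map_add, add_mul, h, h']
      | tmul u v => simp [_root_.mul_assoc]

theorem of_T₂ (a b : 𝒜.Total) : Multiplier.of (𝒜.T₂ (a ⊗ₜ b)) =
    Multiplier.tensor (Multiplier.of a) 1 * 𝒜.totalComul b := by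
  have hf := 𝒜.finite_T₂Comp (a ⊗ₜ b)
  refine Multiplier.ext (fun x => ?_) fun x => ?_
  · change (∑ᶠ p : I × I, 𝒜.T₂Comp p.1 p.2 (a ⊗ₜ b)) * x =
      TensorProduct.map (LinearMap.mulLeft ℂ a) LinearMap.id
        (∑ᶠ p : I × I, 𝒜.comulTotal p.1 p.2 b * x)
    rw [finsum_mul' _ _ hf]
    refine Eq.trans ?_ ((TensorProduct.map (LinearMap.mulLeft ℂ a) LinearMap.id).toAddMonoidHom.map_finsum
      (𝒜.finite_comul_mul b x)).symm
    refine finsum_congr fun p => ?_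
    rw [T₂Comp_tmul]
    change _ = TensorProduct.map (LinearMap.mulLeft ℂ a) LinearMap.id _
    induction 𝒜.comulTotal p.1 p.2 b with
    | zero => simp
    | add y y' h h' => simp only [map_add, add_mul, h, h']
    | tmul y z =>
      induction x with
      | zero => simp
      | add y y' h h' => simp only [map_add, mul_add, h, h']
      | tmul u v => simp [_root_.mul_assoc]
  · change x * (∑ᶠ p : I × I, 𝒜.T₂Comp p.1 p.2 (a ⊗ₜ b)) =
      ∑ᶠ p : I × I, TensorProduct.map (LinearMap.mulRight ℂ a) LinearMap.id x *
        𝒜.comulTotal p.1 p.2 b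
    rw [mul_finsum' _ _ hf]
    refine finsum_congr fun p => ?_
    rw [T₂Comp_tmul]
    induction 𝒜.comulTotal p.1 p.2 b with
    | zero => simp
    | add y y' h h' => simp only [map_add, mul_add, h, h']
    | tmul y z =>
      induction x with
      | zero => simp
      | add y y' h h' => simp only [map_add, add_mul, h, h']
      | tmul u v => simp [_root_.mul_assoc]

/-- `Δ(1) = ∑ p, ρ_p ⊗ λ_p`, a strictly convergent sum in `M(A ⊗ A)`. -/
def comulOne : Multiplier (𝒜.Total ⊗[ℂ] 𝒜.Total) :=
  Multiplier.strictSum (fun p => Multiplier.tensor (𝒜.rho p) (𝒜.lam p))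
    (finite_of_incl₂ _ fun K a L b => (Set.finite_singleton K.ld).subset fun p hp => by
      by_contra hc
      refine hp ?_
      change (𝒜.rho p).left (𝒜.incl K a) ⊗ₜ (𝒜.lam p).left (𝒜.incl L b) = 0
      rw [rho_left_of_ne _ _ _ _ hc, TensorProduct.zero_tmul])
    (finite_of_incl₂ _ fun K a L b => (Set.finite_singleton K.rd).subset fun p hp => by
      by_contra hc
      refine hp ?_
      change (𝒜.rho p).right (𝒜.incl K a) ⊗ₜ (𝒜.lam p).right (𝒜.incl L b) = 0
      rw [rho_right_of_ne _ _ _ _ hc, TensorProduct.zero_tmul])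

/-- `E₁(a ⊗ b) = Δ(1)(a ⊗ b) = ∑ p, ρ_p a ⊗ λ_p b`. -/
def E₁ : 𝒜.Total ⊗[ℂ] 𝒜.Total →ₗ[ℂ] 𝒜.Total ⊗[ℂ] 𝒜.Total := 𝒜.comulOne.left

/-- `E₂(a ⊗ b) = (a ⊗ b)Δ(1) = ∑ p, a ρ_p ⊗ b λ_p`. -/
def E₂ : 𝒜.Total ⊗[ℂ] 𝒜.Total →ₗ[ℂ] 𝒜.Total ⊗[ℂ] 𝒜.Total := 𝒜.comulOne.right

/-- `G₁(a ⊗ b) = ∑ p, a ρ_p ⊗ ρ_p b`. -/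
def G₁ : 𝒜.Total ⊗[ℂ] 𝒜.Total →ₗ[ℂ] 𝒜.Total ⊗[ℂ] 𝒜.Total :=
  locFinSum (fun p => TensorProduct.map (𝒜.rho p).right (𝒜.rho p).left)
    (finite_of_incl₂ _ fun K a L b => (Set.finite_singleton K.rd).subset fun p hp => by
      by_contra hc
      refine hp ?_
      rw [TensorProduct.map_tmul, rho_right_of_ne _ _ _ _ hc, TensorProduct.zero_tmul])

/-- `G₂(a ⊗ b) = ∑ p, a λ_p ⊗ λ_p b`. -/
def G₂ : 𝒜.Total ⊗[ℂ] 𝒜.Total →ₗ[ℂ] 𝒜.Total ⊗[ℂ] 𝒜.Total :=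
  locFinSum (fun p => TensorProduct.map (𝒜.lam p).right (𝒜.lam p).left)
    (finite_of_incl₂ _ fun K a L b => (Set.finite_singleton K.ru).subset fun p hp => by
      by_contra hc
      refine hp ?_
      rw [TensorProduct.map_tmul, lam_right_of_ne _ _ _ _ hc, TensorProduct.zero_tmul])

/-! ### Antipodes -/

/-- The extension of a family `S : A(K) → A(K^{∘•})` to the total algebra. -/
def totalAntipode (S : ∀ {k l m n : I}, 𝒜.A ⟨k, l, m, n⟩ →ₗ[ℂ] 𝒜.A ⟨n, m, l, k⟩) :
    𝒜.Total →ₗ[ℂ] 𝒜.Total :=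
  𝒜.totalLift fun K => 𝒜.incl ⟨K.rd, K.ld, K.ru, K.lu⟩ ∘ₗ
    S (k := K.lu) (l := K.ru) (m := K.ld) (n := K.rd)

/-- `S` is an antipode: for `a ∈ A(M)`, `M = (k l; m n)`, the sums
`∑ a₍₁₎K S(a₍₂₎L)` over `K * L = M` with `K · L^{∘•} = P` are `ε(a)𝟏(P_l)` if `P_l = P_r` has upper
entry `k`, and zero otherwise; the sums `∑ S(a₍₁₎K) a₍₂₎L` over `K * L = M` with `K^{∘•} · L = P`
are `ε(a)𝟏(P_r)` if `P_l = P_r` has lower entry `n`, and zero otherwise. Here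
`K = (k l; r s)`, `L = (r s; m n)`. The first sum is empty (and `ε(a) = 0` if `l ≠ n`) unless
`l = n` and `P = (k m; r r)`, and then it runs over `s`; the second sum is empty (and `ε(a) = 0` if
`k ≠ m`) unless `k = m` and `P = (s s; l n)`, and then it runs over `r`. -/
structure IsAntipode (S : ∀ {k l m n : I}, 𝒜.A ⟨k, l, m, n⟩ →ₗ[ℂ] 𝒜.A ⟨n, m, l, k⟩) : Prop where
  left : ∀ (k l r : I) (a : 𝒜.A ⟨k, l, k, l⟩),
    ∑ᶠ s : I, TensorProduct.lift
      ((𝒜.mul : 𝒜.A ⟨k, l, r, s⟩ →ₗ[ℂ] 𝒜.A ⟨l, k, s, r⟩ →ₗ[ℂ] 𝒜.A ⟨k, k, r, r⟩).compl₁₂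
        LinearMap.id S) (𝒜.comul r s a) = 𝒜.counit a • 𝒜.one k r
  left_of_ne : ∀ (k l m r : I) (a : 𝒜.A ⟨k, l, m, l⟩), k ≠ m →
    ∑ᶠ s : I, TensorProduct.lift
      ((𝒜.mul : 𝒜.A ⟨k, l, r, s⟩ →ₗ[ℂ] 𝒜.A ⟨l, m, s, r⟩ →ₗ[ℂ] 𝒜.A ⟨k, m, r, r⟩).compl₁₂
        LinearMap.id S) (𝒜.comul r s a) = 0
  right : ∀ (k l s : I) (a : 𝒜.A ⟨k, l, k, l⟩),
    ∑ᶠ r : I, TensorProduct.lift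
      ((𝒜.mul : 𝒜.A ⟨s, r, l, k⟩ →ₗ[ℂ] 𝒜.A ⟨r, s, k, l⟩ →ₗ[ℂ] 𝒜.A ⟨s, s, l, l⟩).compl₁₂
        S LinearMap.id) (𝒜.comul r s a) = 𝒜.counit a • 𝒜.one s l
  right_of_ne : ∀ (k l n s : I) (a : 𝒜.A ⟨k, l, k, n⟩), l ≠ n →
    ∑ᶠ r : I, TensorProduct.lift
      ((𝒜.mul : 𝒜.A ⟨s, r, l, k⟩ →ₗ[ℂ] 𝒜.A ⟨r, s, k, n⟩ →ₗ[ℂ] 𝒜.A ⟨s, s, l, n⟩).compl₁₂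
        S LinearMap.id) (𝒜.comul r s a) = 0

/-- A partial Hopf algebra is a partial bialgebra that admits an antipode. -/
def IsPartialHopf : Prop :=
  ∃ S : ∀ {k l m n : I}, 𝒜.A ⟨k, l, m, n⟩ →ₗ[ℂ] 𝒜.A ⟨n, m, l, k⟩, 𝒜.IsAntipode S

end PartialBialgebra

end

noncomputable section

open LinearMap (comp_apply lTensor_tmul rTensor_tmul mulRight mulLeft mulRight_apply mulLeft_apply
  mul' flip_apply mul'_apply congr_fun lTensor_comp_apply rTensor_comp_apply)
open TensorProduct (assoc_tmul mk_apply add_tmul tmul_add tmul_zero zero_tmul map_tmul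
  rightComm_tmul assoc_symm_tmul smul_tmul' tmul_smul)
open Algebra.TensorProduct (tmul_mul_tmul)
open LinearEquiv (coe_coe)

/-! ### Locally finite sums -/

/-! In Sweedler notation an antipode `S` inverts the canonical maps as for ordinary Hopf algebras:
`R₁(a ⊗ b) = a₁ ⊗ S(a₂)b` and `R₂(a ⊗ b) = aS(b₁) ⊗ b₂`. For instance `T₁R₁(a ⊗ b) = a₁ ⊗ a₂S(a₃)b`;
the antipode law makes this `a₁ε(a₂) ⊗ b` up to a unit `𝟏(k; m)`, which keeps or kills `b`. So the
composites are index-matching projections, namely `Eᵢ` and `Gᵢ`. The infinite sums cause no trouble: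
on homogeneous elements, multiplication by `b` fixes one index of `Δ_{rs}(a)`, and every sum becomes
a row sum `rowComul` or a column sum `colComul`, finite by row and column finiteness. These sums are
coassociative in the mixed form `colComul_rowComul`, `rowComul_colComul`.

Conversely, a generalized inverse is determined by `T`, `E`, `G`, hence it intertwines whatever
these three maps intertwine (`IsGenInverse.intertwine`). So `R₁` is right linear in the second leg,
respects the gradings, and is colinear in the first leg. Put `S(a)b = (ε ⊗ id)R₁(a ⊗ b)`. The
gradings show that `S(a)` lies in the right component, colinearity and the counit give back `R₁(a ⊗
b) = a₁ ⊗ S(a₂)b` (`eq_galoisInv₁`), and `ε ⊗ id` applied to `T₁R₁ = E₁` and `R₁T₁ = G₁` yields the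
two antipode laws. Only `R₁` enters here.

For weak multiplier Hopf algebras, every axiom except those on the ranges and kernels of `T₁`, `T₂`
holds in each partial bialgebra, with `E = Δ(1)`; the remaining ones follow from the generalized
inverses. In the other direction the structure maps are forced. Non-degeneracy fixes the `Tᵢ`. For
`E`, the range of `T₁` gives `Δ(1)E = E`, and since the range of `T₂` generates `(A ⊗ A)Δ(1)` as a
left ideal, `Δ(1)E = Δ(1)` (`data_E`). Slicing their defining identities with `ε` fixes the `Gᵢ`.
Prescribed ranges and kernels then produce the `Rᵢ`, and their uniqueness identifies the two
antipodes. -/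

theorem finite_ne_zero_add {ι M : Type*} [AddMonoid M] {f g : ι → M} (hf : {i | f i ≠ 0}.Finite)
    (hg : {i | g i ≠ 0}.Finite) : {i | f i + g i ≠ 0}.Finite := by
  refine (hf.union hg).subset fun i hi => ?_
  by_contra hc
  simp only [Set.mem_union, Set.mem_ofPred_eq, not_or, not_not] at hc
  exact hi (by rw [hc.1, hc.2, add_zero])

theorem locFinSum_apply {ι V W : Type*} [AddCommGroup V] [Module ℂ V] [AddCommGroup W] [Module ℂ W]
    (f : ι → V →ₗ[ℂ] W) (hf : ∀ x, {i | f i x ≠ 0}.Finite) (x : V) :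
    locFinSum f hf x = ∑ᶠ i, f i x := rfl

/-- Multiplication by a homogeneous element fixes one of the two summation indices of `Δ(a)`; this
and its companion for the first index collapse the double sum accordingly. -/
theorem finsum_prod_eq_of_snd {α β M : Type*} [AddCommMonoid M] (F : α × β → M) (b : β)
    (h : ∀ r s, s ≠ b → F (r, s) = 0) : ∑ᶠ p, F p = ∑ᶠ r, F (r, b) := by
  have hinj : Function.Injective fun r : α => (r, b) := fun x y h => (Prod.ext_iff.1 h).1
  rw [← finsum_mem_range (f := F) hinj, ← finsum_mem_univ]
  refine (finsum_mem_inter_support_eq F _ _ ?_).symm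
  ext ⟨r, s⟩
  simp only [Set.mem_inter_iff, Set.mem_range, Function.mem_support, Set.mem_univ, true_and,
    and_iff_right_iff_imp]
  intro hF
  by_contra hc
  exact hF (h r s fun hs => hc ⟨r, by rw [hs]⟩)

theorem finsum_prod_eq_of_fst {α β M : Type*} [AddCommMonoid M] (F : α × β → M) (a : α)
    (h : ∀ r s, r ≠ a → F (r, s) = 0) : ∑ᶠ p, F p = ∑ᶠ s, F (a, s) := by
  have hinj : Function.Injective fun s : β => (a, s) := fun x y h => (Prod.ext_iff.1 h).2
  rw [← finsum_mem_range (f := F) hinj, ← finsum_mem_univ]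
  refine (finsum_mem_inter_support_eq F _ _ ?_).symm
  ext ⟨r, s⟩
  simp only [Set.mem_inter_iff, Set.mem_range, Function.mem_support, Set.mem_univ, true_and,
    and_iff_right_iff_imp]
  intro hF
  by_contra hc
  exact hF (h r s fun hs => hc ⟨s, by rw [hs]⟩)

/-- A finite rectangle containing the support reduces both iterated sums to one finite sum over
pairs. -/
theorem finsum_finsum_comm {α β M : Type*} [AddCommMonoid M] (F : α → β → M) (s : Set α)
    (t : Set β) (hs : s.Finite) (ht : t.Finite) (h : ∀ a b, F a b ≠ 0 → a ∈ s ∧ b ∈ t) :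
    ∑ᶠ a, ∑ᶠ b, F a b = ∑ᶠ b, ∑ᶠ a, F a b := by
  have hfin : {p : α × β | F p.1 p.2 ≠ 0}.Finite :=
    (hs.prod ht).subset fun p hp => h p.1 p.2 hp
  have hfin' : {p : β × α | F p.2 p.1 ≠ 0}.Finite :=
    (ht.prod hs).subset fun p hp => (h p.2 p.1 hp).symm
  have h1 := finsum_curry (fun p : α × β => F p.1 p.2) hfin
  have h2 := finsum_curry (fun p : β × α => F p.2 p.1) hfin'
  rw [← h1, ← h2]
  exact finsum_comp_equiv (Equiv.prodComm β α) (f := fun p : α × β => F p.1 p.2) |>.symm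

/-! ### Locally finite sums inside tensor products -/

section TensorSums

variable {ι V W U : Type*} [AddCommGroup V] [Module ℂ V] [AddCommGroup W] [Module ℂ W]
  [AddCommGroup U] [Module ℂ U]

theorem finite_rTensor (f : ι → V →ₗ[ℂ] W) (hf : ∀ x, {i | f i x ≠ 0}.Finite) (z : V ⊗[ℂ] U) :
    {i | (f i).rTensor U z ≠ 0}.Finite := by
  induction z with
  | zero => simp
  | add x y hx hy =>
    simpa only [map_add] using finite_ne_zero_add hx hy
  | tmul a b =>
    refine (hf a).subset fun i hi h0 => hi ?_
    rw [rTensor_tmul, h0, zero_tmul]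

theorem finite_lTensor (f : ι → V →ₗ[ℂ] W) (hf : ∀ x, {i | f i x ≠ 0}.Finite) (z : U ⊗[ℂ] V) :
    {i | (f i).lTensor U z ≠ 0}.Finite := by
  induction z with
  | zero => simp
  | add x y hx hy =>
    simpa only [map_add] using finite_ne_zero_add hx hy
  | tmul a b =>
    refine (hf b).subset fun i hi h0 => hi ?_
    rw [lTensor_tmul, h0, tmul_zero]

theorem rTensor_locFinSum (f : ι → V →ₗ[ℂ] W) (hf : ∀ x, {i | f i x ≠ 0}.Finite) (z : V ⊗[ℂ] U) :
    (locFinSum f hf).rTensor U z = ∑ᶠ i, (f i).rTensor U z := by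
  induction z with
  | zero => simp
  | add x y hx hy =>
    simp only [map_add]
    rw [hx, hy, finsum_add_distrib (finite_rTensor f hf x) (finite_rTensor f hf y)]
  | tmul a b =>
    simp only [rTensor_tmul, locFinSum_apply]
    exact map_finsum ((TensorProduct.mk ℂ W U).flip b) (hf a)

theorem lTensor_locFinSum (f : ι → V →ₗ[ℂ] W) (hf : ∀ x, {i | f i x ≠ 0}.Finite) (z : U ⊗[ℂ] V) :
    (locFinSum f hf).lTensor U z = ∑ᶠ i, (f i).lTensor U z := by
  induction z with
  | zero => simp
  | add x y hx hy =>
    simp only [map_add]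
    rw [hx, hy, finsum_add_distrib (finite_lTensor f hf x) (finite_lTensor f hf y)]
  | tmul a b =>
    simp only [lTensor_tmul, locFinSum_apply]
    exact map_finsum (TensorProduct.mk ℂ U W a) (hf b)

end TensorSums

namespace PartialBialgebra

variable {I : Type u} (𝒜 : PartialBialgebra.{u, v} I)

/-! ### Actions of the multipliers `λ_k` and `ρ_l` on components -/

section Components

open scoped Classical

theorem lam_left_incl (k : I) (K : M₂ I) (a : 𝒜.A K) :
    (𝒜.lam k).left (𝒜.incl K a) = if k = K.lu then 𝒜.incl K a else 0 := by
  change ∑ᶠ l, 𝒜.unit k l * 𝒜.incl K a = _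
  simp only [unit_mul_incl]
  rw [finsum_eq_single _ K.ld fun l hl => if_neg fun h => hl h.2]
  simp

theorem lam_right_incl (k : I) (K : M₂ I) (a : 𝒜.A K) :
    (𝒜.lam k).right (𝒜.incl K a) = if k = K.ru then 𝒜.incl K a else 0 := by
  change ∑ᶠ l, 𝒜.incl K a * 𝒜.unit k l = _
  simp only [incl_mul_unit]
  rw [finsum_eq_single _ K.rd fun l hl => if_neg fun h => hl h.2.symm]
  simp [eq_comm]

theorem rho_left_incl (k : I) (K : M₂ I) (a : 𝒜.A K) :
    (𝒜.rho k).left (𝒜.incl K a) = if k = K.ld then 𝒜.incl K a else 0 := by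
  change ∑ᶠ l, 𝒜.unit l k * 𝒜.incl K a = _
  simp only [unit_mul_incl]
  rw [finsum_eq_single _ K.lu fun l hl => if_neg fun h => hl h.1]
  simp

theorem rho_right_incl (k : I) (K : M₂ I) (a : 𝒜.A K) :
    (𝒜.rho k).right (𝒜.incl K a) = if k = K.rd then 𝒜.incl K a else 0 := by
  change ∑ᶠ l, 𝒜.incl K a * 𝒜.unit l k = _
  simp only [incl_mul_unit]
  rw [finsum_eq_single _ K.ru fun l hl => if_neg fun h => hl h.1.symm]
  simp [eq_comm]

variable {𝒜}

theorem ext_incl {V : Type*} [AddCommGroup V] [Module ℂ V] {f g : 𝒜.Total →ₗ[ℂ] V}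
    (h : ∀ K a, f (𝒜.incl K a) = g (𝒜.incl K a)) : f = g := by
  ext x
  induction x using total_induction with
  | zero => simp
  | incl K a => exact h K a
  | add x y hx hy => rw [map_add, map_add, hx, hy]

theorem ext_incl₂ {V : Type*} [AddCommGroup V] [Module ℂ V]
    {f g : 𝒜.Total ⊗[ℂ] 𝒜.Total →ₗ[ℂ] V}
    (h : ∀ K a L b, f (𝒜.incl K a ⊗ₜ 𝒜.incl L b) = g (𝒜.incl K a ⊗ₜ 𝒜.incl L b)) : f = g := by
  refine TensorProduct.ext (ext_incl fun K a => ext_incl fun L b => ?_)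
  simpa using h K a L b

theorem ext_incl₃ {V : Type*} [AddCommGroup V] [Module ℂ V]
    {f g : (𝒜.Total ⊗[ℂ] 𝒜.Total) ⊗[ℂ] 𝒜.Total →ₗ[ℂ] V}
    (h : ∀ K a L b M c, f ((𝒜.incl K a ⊗ₜ 𝒜.incl L b) ⊗ₜ 𝒜.incl M c) =
      g ((𝒜.incl K a ⊗ₜ 𝒜.incl L b) ⊗ₜ 𝒜.incl M c)) : f = g := by
  refine TensorProduct.ext (ext_incl₂ fun K a L b => ext_incl fun M c => ?_)
  simpa using h K a L b M c

variable (𝒜)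

/-- A single `p` survives in the defining sum. Thus `E₁`, `E₂`, `G₁`, `G₂` are diagonal for the
grading, each testing one equality of indices, and compatibility with them becomes a comparison of
indices. -/
theorem E₁_incl (K L : M₂ I) (a : 𝒜.A K) (b : 𝒜.A L) :
    𝒜.E₁ (𝒜.incl K a ⊗ₜ 𝒜.incl L b) =
      if K.ld = L.lu then 𝒜.incl K a ⊗ₜ 𝒜.incl L b else 0 := by
  change ∑ᶠ p, (𝒜.rho p).left (𝒜.incl K a) ⊗ₜ[ℂ] (𝒜.lam p).left (𝒜.incl L b) = _
  simp only [rho_left_incl, lam_left_incl]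
  rw [finsum_eq_single _ K.ld fun l hl => by rw [if_neg hl, zero_tmul], if_pos rfl]
  split_ifs <;> simp

theorem E₂_incl (K L : M₂ I) (a : 𝒜.A K) (b : 𝒜.A L) :
    𝒜.E₂ (𝒜.incl K a ⊗ₜ 𝒜.incl L b) =
      if K.rd = L.ru then 𝒜.incl K a ⊗ₜ 𝒜.incl L b else 0 := by
  change ∑ᶠ p, (𝒜.rho p).right (𝒜.incl K a) ⊗ₜ[ℂ] (𝒜.lam p).right (𝒜.incl L b) = _
  simp only [rho_right_incl, lam_right_incl]
  rw [finsum_eq_single _ K.rd fun l hl => by rw [if_neg hl, zero_tmul], if_pos rfl]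
  split_ifs <;> simp

theorem G₁_incl (K L : M₂ I) (a : 𝒜.A K) (b : 𝒜.A L) :
    𝒜.G₁ (𝒜.incl K a ⊗ₜ 𝒜.incl L b) =
      if K.rd = L.ld then 𝒜.incl K a ⊗ₜ 𝒜.incl L b else 0 := by
  change ∑ᶠ p, (𝒜.rho p).right (𝒜.incl K a) ⊗ₜ[ℂ] (𝒜.rho p).left (𝒜.incl L b) = _
  simp only [rho_right_incl, rho_left_incl]
  rw [finsum_eq_single _ K.rd fun l hl => by rw [if_neg hl, zero_tmul], if_pos rfl]
  split_ifs <;> simp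

theorem G₂_incl (K L : M₂ I) (a : 𝒜.A K) (b : 𝒜.A L) :
    𝒜.G₂ (𝒜.incl K a ⊗ₜ 𝒜.incl L b) =
      if K.ru = L.lu then 𝒜.incl K a ⊗ₜ 𝒜.incl L b else 0 := by
  change ∑ᶠ p, (𝒜.lam p).right (𝒜.incl K a) ⊗ₜ[ℂ] (𝒜.lam p).left (𝒜.incl L b) = _
  simp only [lam_right_incl, lam_left_incl]
  rw [finsum_eq_single _ K.ru fun l hl => by rw [if_neg hl, zero_tmul], if_pos rfl]
  split_ifs <;> simp

end Components

/-! ### Row and column sums of the comultiplication -/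

theorem finite_comulTotal_row (r : I) (x : 𝒜.Total) : {s | 𝒜.comulTotal r s x ≠ 0}.Finite := by
  refine finite_of_incl (fun s => 𝒜.comulTotal r s) (fun K a => ?_) x
  refine (𝒜.finite_row (k := K.lu) (l := K.ru) (m := K.ld) (n := K.rd) a r).subset
    fun s hs h0 => hs ?_
  rw [comulTotal_incl, h0, map_zero]

theorem finite_comulTotal_col (s : I) (x : 𝒜.Total) : {r | 𝒜.comulTotal r s x ≠ 0}.Finite := by
  refine finite_of_incl (fun r => 𝒜.comulTotal r s) (fun K a => ?_) x
  refine (𝒜.finite_col (k := K.lu) (l := K.ru) (m := K.ld) (n := K.rd) a s).subset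
    fun s hs h0 => hs ?_
  rw [comulTotal_incl, h0, map_zero]

/-- The row sum `∑ s, Δ_{rs}`. -/
def rowComul (r : I) : 𝒜.Total →ₗ[ℂ] 𝒜.Total ⊗[ℂ] 𝒜.Total :=
  locFinSum (fun s => 𝒜.comulTotal r s) (𝒜.finite_comulTotal_row r)

/-- The column sum `∑ r, Δ_{rs}`. -/
def colComul (s : I) : 𝒜.Total →ₗ[ℂ] 𝒜.Total ⊗[ℂ] 𝒜.Total :=
  locFinSum (fun r => 𝒜.comulTotal r s) (𝒜.finite_comulTotal_col s)

section Congr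

variable {𝒜} {V : Type*} [AddCommGroup V] [Module ℂ V]

theorem map_rowComul (f : 𝒜.Total ⊗[ℂ] 𝒜.Total →ₗ[ℂ] V) (r : I) (x : 𝒜.Total) :
    f (𝒜.rowComul r x) = ∑ᶠ s, f (𝒜.comulTotal r s x) :=
  map_finsum f (𝒜.finite_comulTotal_row r x)

theorem map_colComul (f : 𝒜.Total ⊗[ℂ] 𝒜.Total →ₗ[ℂ] V) (s : I) (x : 𝒜.Total) :
    f (𝒜.colComul s x) = ∑ᶠ r, f (𝒜.comulTotal r s x) :=
  map_finsum f (𝒜.finite_comulTotal_col s x)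

/-- This replaces Sweedler notation: an identity that is linear in `Δ_{rs}(a)` may be checked on
elementary tensors of homogeneous elements, with the indices of both legs known. -/
theorem comulTotal_congr {f g : 𝒜.Total ⊗[ℂ] 𝒜.Total →ₗ[ℂ] V} (r s : I) (K : M₂ I)
    (h : ∀ u v, f (𝒜.incl ⟨K.lu, K.ru, r, s⟩ u ⊗ₜ 𝒜.incl ⟨r, s, K.ld, K.rd⟩ v) =
      g (𝒜.incl ⟨K.lu, K.ru, r, s⟩ u ⊗ₜ 𝒜.incl ⟨r, s, K.ld, K.rd⟩ v)) (a : 𝒜.A K) :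
    f (𝒜.comulTotal r s (𝒜.incl K a)) = g (𝒜.comulTotal r s (𝒜.incl K a)) := by
  rw [comulTotal_incl]
  have : f ∘ₗ TensorProduct.map (𝒜.incl ⟨K.lu, K.ru, r, s⟩) (𝒜.incl ⟨r, s, K.ld, K.rd⟩) =
      g ∘ₗ TensorProduct.map (𝒜.incl ⟨K.lu, K.ru, r, s⟩) (𝒜.incl ⟨r, s, K.ld, K.rd⟩) :=
    TensorProduct.ext' fun u v => h u v
  exact congr_fun this _

theorem rowComul_congr {f g : 𝒜.Total ⊗[ℂ] 𝒜.Total →ₗ[ℂ] V} (r : I) (K : M₂ I)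
    (h : ∀ s u v, f (𝒜.incl ⟨K.lu, K.ru, r, s⟩ u ⊗ₜ 𝒜.incl ⟨r, s, K.ld, K.rd⟩ v) =
      g (𝒜.incl ⟨K.lu, K.ru, r, s⟩ u ⊗ₜ 𝒜.incl ⟨r, s, K.ld, K.rd⟩ v)) (a : 𝒜.A K) :
    f (𝒜.rowComul r (𝒜.incl K a)) = g (𝒜.rowComul r (𝒜.incl K a)) := by
  rw [map_rowComul, map_rowComul]
  exact finsum_congr fun s => comulTotal_congr r s K (h s) a

theorem colComul_congr {f g : 𝒜.Total ⊗[ℂ] 𝒜.Total →ₗ[ℂ] V} (s : I) (K : M₂ I)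
    (h : ∀ r u v, f (𝒜.incl ⟨K.lu, K.ru, r, s⟩ u ⊗ₜ 𝒜.incl ⟨r, s, K.ld, K.rd⟩ v) =
      g (𝒜.incl ⟨K.lu, K.ru, r, s⟩ u ⊗ₜ 𝒜.incl ⟨r, s, K.ld, K.rd⟩ v)) (a : 𝒜.A K) :
    f (𝒜.colComul s (𝒜.incl K a)) = g (𝒜.colComul s (𝒜.incl K a)) := by
  rw [map_colComul, map_colComul]
  exact finsum_congr fun r => comulTotal_congr r s K (h r) a

end Congr

/-! ### Coassociativity -/

theorem comulTotal_coassoc (p q r s : I) (x : 𝒜.Total) :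
    TensorProduct.assoc ℂ _ _ _ ((𝒜.comulTotal p q).rTensor _ (𝒜.comulTotal r s x)) =
      (𝒜.comulTotal r s).lTensor _ (𝒜.comulTotal p q x) := by
  induction x using total_induction with
  | zero => simp
  | add x y hx hy => simp only [map_add, hx, hy]
  | incl K a =>
    rw [comulTotal_incl, comulTotal_incl]
    have h := congrArg (TensorProduct.map (𝒜.incl ⟨K.lu, K.ru, p, q⟩)
      (TensorProduct.map (𝒜.incl ⟨p, q, r, s⟩) (𝒜.incl ⟨r, s, K.ld, K.rd⟩)))
      (𝒜.coassoc (k := K.lu) (l := K.ru) (m := K.ld) (n := K.rd) p q r s a)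
    have h1 : ∀ z : 𝒜.A ⟨K.lu, K.ru, r, s⟩ ⊗[ℂ] 𝒜.A ⟨r, s, K.ld, K.rd⟩,
        TensorProduct.map (𝒜.incl ⟨K.lu, K.ru, p, q⟩)
          (TensorProduct.map (𝒜.incl ⟨p, q, r, s⟩) (𝒜.incl ⟨r, s, K.ld, K.rd⟩))
          (TensorProduct.assoc ℂ _ _ _ ((𝒜.comul p q).rTensor (𝒜.A ⟨r, s, K.ld, K.rd⟩) z)) =
        TensorProduct.assoc ℂ _ _ _ ((𝒜.comulTotal p q).rTensor _
          (TensorProduct.map (𝒜.incl ⟨K.lu, K.ru, r, s⟩) (𝒜.incl ⟨r, s, K.ld, K.rd⟩) z)) := by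
      intro z
      induction z with
      | zero => simp
      | add x y hx hy => simp only [map_add, hx, hy]
      | tmul u v =>
        simp only [rTensor_tmul, map_tmul, comulTotal_incl]
        generalize 𝒜.comul p q u = w
        induction w with
        | zero => simp
        | add x y hx hy => simp only [map_add, add_tmul, hx, hy]
        | tmul => simp
    have h2 : ∀ z : 𝒜.A ⟨K.lu, K.ru, p, q⟩ ⊗[ℂ] 𝒜.A ⟨p, q, K.ld, K.rd⟩,
        TensorProduct.map (𝒜.incl ⟨K.lu, K.ru, p, q⟩)
          (TensorProduct.map (𝒜.incl ⟨p, q, r, s⟩) (𝒜.incl ⟨r, s, K.ld, K.rd⟩))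
          ((𝒜.comul r s).lTensor (𝒜.A ⟨K.lu, K.ru, p, q⟩) z) =
        (𝒜.comulTotal r s).lTensor _
          (TensorProduct.map (𝒜.incl ⟨K.lu, K.ru, p, q⟩) (𝒜.incl ⟨p, q, K.ld, K.rd⟩) z) := by
      intro z
      induction z with
      | zero => simp
      | add x y hx hy => simp only [map_add, hx, hy]
      | tmul u v => simp only [lTensor_tmul, map_tmul, comulTotal_incl]
    rw [h1, h2] at h
    exact h

/-- Both sides are double sums over `s` and `p` of the same terms by coassociativity of the
`Δ_{rs}`. The fixed indices `q`, `r` lie in different rows, so row and column finiteness together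
leave finitely many pairs. -/
theorem colComul_rowComul (q r : I) (x : 𝒜.Total) :
    TensorProduct.assoc ℂ _ _ _ ((𝒜.colComul q).rTensor _ (𝒜.rowComul r x)) =
      (𝒜.rowComul r).lTensor _ (𝒜.colComul q x) := by
  have h1 : TensorProduct.assoc ℂ _ _ _ ((𝒜.colComul q).rTensor _ (𝒜.rowComul r x)) =
      ∑ᶠ s, ∑ᶠ p, TensorProduct.assoc ℂ _ _ _
        ((𝒜.comulTotal p q).rTensor _ (𝒜.comulTotal r s x)) := by
    rw [map_rowComul, map_finsum (TensorProduct.assoc ℂ 𝒜.Total 𝒜.Total 𝒜.Total)]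
    · refine finsum_congr fun s => ?_
      rw [colComul, rTensor_locFinSum, map_finsum (TensorProduct.assoc ℂ 𝒜.Total 𝒜.Total 𝒜.Total)]
      exact finite_rTensor _ (𝒜.finite_comulTotal_col q) _
    · exact (𝒜.finite_comulTotal_row r x).subset fun s hs h0 => hs (by simp only [h0, map_zero])
  have h2 : (𝒜.rowComul r).lTensor _ (𝒜.colComul q x) =
      ∑ᶠ p, ∑ᶠ s, (𝒜.comulTotal r s).lTensor _ (𝒜.comulTotal p q x) := by
    rw [map_colComul]
    exact finsum_congr fun p => lTensor_locFinSum _ _ _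
  rw [h1, h2, finsum_finsum_comm _ _ _ (𝒜.finite_comulTotal_row r x) (𝒜.finite_comulTotal_col q x)]
  · simp only [comulTotal_coassoc]
  · intro s p h
    -- The term visibly vanishes with `Δ_{rs}(x)`; rewritten by coassociativity, it also vanishes
    -- with `Δ_{pq}(x)`.
    refine ⟨fun h0 => h (by rw [h0, map_zero, map_zero]), fun h0 => h ?_⟩
    rw [comulTotal_coassoc, h0, map_zero]

theorem rowComul_colComul (q r : I) (x : 𝒜.Total) :
    TensorProduct.assoc ℂ _ _ _ ((𝒜.rowComul r).rTensor _ (𝒜.colComul q x)) =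
      (𝒜.colComul q).lTensor _ (𝒜.rowComul r x) := by
  have h1 : TensorProduct.assoc ℂ _ _ _ ((𝒜.rowComul r).rTensor _ (𝒜.colComul q x)) =
      ∑ᶠ p, ∑ᶠ s, TensorProduct.assoc ℂ _ _ _
        ((𝒜.comulTotal r s).rTensor _ (𝒜.comulTotal p q x)) := by
    rw [map_colComul, map_finsum (TensorProduct.assoc ℂ 𝒜.Total 𝒜.Total 𝒜.Total)]
    · refine finsum_congr fun s => ?_
      rw [rowComul, rTensor_locFinSum, map_finsum (TensorProduct.assoc ℂ 𝒜.Total 𝒜.Total 𝒜.Total)]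
      exact finite_rTensor _ (𝒜.finite_comulTotal_row r) _
    · exact (𝒜.finite_comulTotal_col q x).subset fun s hs h0 => hs (by simp only [h0, map_zero])
  have h2 : (𝒜.colComul q).lTensor _ (𝒜.rowComul r x) =
      ∑ᶠ s, ∑ᶠ p, (𝒜.comulTotal p q).lTensor _ (𝒜.comulTotal r s x) := by
    rw [map_rowComul]
    exact finsum_congr fun p => lTensor_locFinSum _ _ _
  rw [h1, h2, finsum_finsum_comm _ _ _ (𝒜.finite_comulTotal_col q x) (𝒜.finite_comulTotal_row r x)]
  · simp only [comulTotal_coassoc]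
  · intro s p h
    refine ⟨fun h0 => h (by rw [h0, map_zero, map_zero]), fun h0 => h ?_⟩
    rw [comulTotal_coassoc, h0, map_zero]

/-! ### The counit -/

theorem totalCounit_incl (K : M₂ I) (a : 𝒜.A K) : 𝒜.totalCounit (𝒜.incl K a) =
    𝒜.counit (k := K.lu) (l := K.ru) (m := K.ld) (n := K.rd) a := 𝒜.totalLift_incl _ K a

theorem totalCounit_incl_of_ne (K : M₂ I) (a : 𝒜.A K) (h : ¬ (K.lu = K.ld ∧ K.ru = K.rd)) :
    𝒜.totalCounit (𝒜.incl K a) = 0 := by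
  rw [totalCounit_incl]
  exact 𝒜.counit_of_ne _ fun hc => h (Prod.ext_iff.1 hc)

theorem sliceLeft_tmul {A : Type*} [NonUnitalRing A] [Module ℂ A] [SMulCommClass ℂ A A]
    [IsScalarTower ℂ A A] (ε : A →ₗ[ℂ] ℂ) (a b : A) : sliceLeft ε (a ⊗ₜ b) = ε a • b := by
  simp [sliceLeft]

theorem sliceRight_tmul {A : Type*} [NonUnitalRing A] [Module ℂ A] [SMulCommClass ℂ A A]
    [IsScalarTower ℂ A A] (ε : A →ₗ[ℂ] ℂ) (a b : A) : sliceRight ε (a ⊗ₜ b) = ε b • a := by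
  simp [sliceRight]

theorem sliceLeft_comulTotal_self (K : M₂ I) (a : 𝒜.A K) :
    sliceLeft 𝒜.totalCounit (𝒜.comulTotal K.lu K.ru (𝒜.incl K a)) = 𝒜.incl K a := by
  conv_rhs => rw [← 𝒜.counit_comul (k := K.lu) (l := K.ru) (m := K.ld) (n := K.rd) a]
  rw [comulTotal_incl]
  generalize 𝒜.comul (k := K.lu) (l := K.ru) (m := K.ld) (n := K.rd) K.lu K.ru a = w
  induction w with
  | zero => simp
  | add x y hx hy => simp only [map_add, hx, hy]
  | tmul x y => simp [sliceLeft_tmul, totalCounit_incl]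

theorem sliceRight_comulTotal_self (K : M₂ I) (a : 𝒜.A K) :
    sliceRight 𝒜.totalCounit (𝒜.comulTotal K.ld K.rd (𝒜.incl K a)) = 𝒜.incl K a := by
  conv_rhs => rw [← 𝒜.comul_counit (k := K.lu) (l := K.ru) (m := K.ld) (n := K.rd) a]
  rw [comulTotal_incl]
  generalize 𝒜.comul (k := K.lu) (l := K.ru) (m := K.ld) (n := K.rd) K.ld K.rd a = w
  induction w with
  | zero => simp
  | add x y hx hy => simp only [map_add, hx, hy]
  | tmul x y => simp [sliceRight_tmul, totalCounit_incl]

theorem sliceLeft_comulTotal_of_ne (r s : I) (K : M₂ I) (a : 𝒜.A K)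
    (h : ¬ (r = K.lu ∧ s = K.ru)) :
    sliceLeft 𝒜.totalCounit (𝒜.comulTotal r s (𝒜.incl K a)) = 0 := by
  refine (comulTotal_congr (g := 0) r s K (fun u v => ?_) a)
  rw [sliceLeft_tmul, totalCounit_incl_of_ne _ _ _ fun hc => h ⟨hc.1.symm, hc.2.symm⟩, zero_smul]
  rfl

theorem sliceRight_comulTotal_of_ne (r s : I) (K : M₂ I) (a : 𝒜.A K)
    (h : ¬ (r = K.ld ∧ s = K.rd)) :
    sliceRight 𝒜.totalCounit (𝒜.comulTotal r s (𝒜.incl K a)) = 0 := by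
  refine (comulTotal_congr (g := 0) r s K (fun u v => ?_) a)
  rw [sliceRight_tmul, totalCounit_incl_of_ne _ _ _ h, zero_smul]
  rfl

open scoped Classical in
-- The counit kills components with unequal rows, so in each row or column sum at most one term
-- survives, and the counit axiom evaluates it. The same holds for the three variants below.
theorem sliceLeft_rowComul (r : I) (K : M₂ I) (a : 𝒜.A K) :
    sliceLeft 𝒜.totalCounit (𝒜.rowComul r (𝒜.incl K a)) =
      if r = K.lu then 𝒜.incl K a else 0 := by
  rw [map_rowComul, finsum_eq_single _ K.ru fun s hs =>
    𝒜.sliceLeft_comulTotal_of_ne r s K a fun h => hs h.2]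
  split_ifs with h
  · subst h
    exact 𝒜.sliceLeft_comulTotal_self K a
  · exact 𝒜.sliceLeft_comulTotal_of_ne r K.ru K a fun hc => h hc.1

open scoped Classical in
theorem sliceLeft_colComul (s : I) (K : M₂ I) (a : 𝒜.A K) :
    sliceLeft 𝒜.totalCounit (𝒜.colComul s (𝒜.incl K a)) =
      if s = K.ru then 𝒜.incl K a else 0 := by
  rw [map_colComul, finsum_eq_single _ K.lu fun r hr =>
    𝒜.sliceLeft_comulTotal_of_ne r s K a fun h => hr h.1]
  split_ifs with h
  · subst h
    exact 𝒜.sliceLeft_comulTotal_self K a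
  · exact 𝒜.sliceLeft_comulTotal_of_ne K.lu s K a fun hc => h hc.2

open scoped Classical in
theorem sliceRight_rowComul (r : I) (K : M₂ I) (a : 𝒜.A K) :
    sliceRight 𝒜.totalCounit (𝒜.rowComul r (𝒜.incl K a)) =
      if r = K.ld then 𝒜.incl K a else 0 := by
  rw [map_rowComul, finsum_eq_single _ K.rd fun s hs =>
    𝒜.sliceRight_comulTotal_of_ne r s K a fun h => hs h.2]
  split_ifs with h
  · subst h
    exact 𝒜.sliceRight_comulTotal_self K a
  · exact 𝒜.sliceRight_comulTotal_of_ne r K.rd K a fun hc => h hc.1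

open scoped Classical in
theorem sliceRight_colComul (s : I) (K : M₂ I) (a : 𝒜.A K) :
    sliceRight 𝒜.totalCounit (𝒜.colComul s (𝒜.incl K a)) =
      if s = K.rd then 𝒜.incl K a else 0 := by
  rw [map_colComul, finsum_eq_single _ K.ld fun r hr =>
    𝒜.sliceRight_comulTotal_of_ne r s K a fun h => hr h.1]
  split_ifs with h
  · subst h
    exact 𝒜.sliceRight_comulTotal_self K a
  · exact 𝒜.sliceRight_comulTotal_of_ne K.ld s K a fun hc => h hc.2

/-! ### The canonical maps on components -/

/-- The second leg of `Δ_{rs}(x)` has `s` as its upper right index, and this must equal the upper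
left index of `b`: only column `L.lu` contributes. -/
theorem T₁_tmul_incl (x : 𝒜.Total) (L : M₂ I) (b : 𝒜.A L) :
    𝒜.T₁ (x ⊗ₜ 𝒜.incl L b) =
      (mulRight ℂ (𝒜.incl L b)).lTensor _ (𝒜.colComul L.lu x) := by
  change ∑ᶠ p : I × I, 𝒜.T₁Comp p.1 p.2 (x ⊗ₜ 𝒜.incl L b) = _
  simp only [T₁Comp_tmul]
  rw [map_colComul]
  refine finsum_prod_eq_of_snd (fun p : I × I => (mulRight ℂ (𝒜.incl L b)).lTensor
    𝒜.Total (𝒜.comulTotal p.1 p.2 x)) L.lu fun r s hs => ?_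
  induction x using total_induction with
  | zero => simp
  | add x y hx hy => dsimp only at hx hy ⊢; rw [map_add, map_add, hx, hy, add_zero]
  | incl K a =>
    refine (comulTotal_congr (g := 0) r s K (fun u v => ?_) a)
    rw [lTensor_tmul, mulRight_apply,
      𝒜.incl_mul_of_ne (K := ⟨r, s, K.ld, K.rd⟩) fun h => hs h.1, tmul_zero]
    rfl

/-- The first leg of `Δ_{rs}(x)` has `r` as its lower left index, which must match the lower right
index of `b`. -/
theorem T₂_incl_tmul (x : 𝒜.Total) (L : M₂ I) (b : 𝒜.A L) :
    𝒜.T₂ (𝒜.incl L b ⊗ₜ x) =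
      (mulLeft ℂ (𝒜.incl L b)).rTensor _ (𝒜.rowComul L.rd x) := by
  change ∑ᶠ p : I × I, 𝒜.T₂Comp p.1 p.2 (𝒜.incl L b ⊗ₜ x) = _
  simp only [T₂Comp_tmul]
  rw [map_rowComul]
  refine finsum_prod_eq_of_fst (fun p : I × I => (mulLeft ℂ (𝒜.incl L b)).rTensor
    𝒜.Total (𝒜.comulTotal p.1 p.2 x)) L.rd fun r s hr => ?_
  induction x using total_induction with
  | zero => simp
  | add x y hx hy => dsimp only at hx hy ⊢; rw [map_add, map_add, hx, hy, add_zero]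
  | incl K a =>
    refine (comulTotal_congr (g := 0) r s K (fun u v => ?_) a)
    rw [rTensor_tmul, mulLeft_apply,
      𝒜.incl_mul_of_ne (L := ⟨K.lu, K.ru, r, s⟩) fun h => hr h.2.symm, zero_tmul]
    rfl

/-- Assigning the zero product to the expected component too allows index computations without a
case distinction on whether columns match. -/
theorem exists_incl_mul_incl (K L : M₂ I) (a : 𝒜.A K) (b : 𝒜.A L) :
    ∃ c, 𝒜.incl K a * 𝒜.incl L b = 𝒜.incl ⟨K.lu, L.ru, K.ld, L.rd⟩ c := by
  by_cases h : K.ru = L.lu ∧ K.rd = L.ld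
  · obtain ⟨k, l, m, n⟩ := K
    obtain ⟨l', p, n', q⟩ := L
    obtain ⟨rfl, rfl⟩ := h
    exact ⟨𝒜.mul a b, by rw [incl_mul, mulComp_eq]⟩
  · exact ⟨0, by rw [incl_mul_of_ne _ h, map_zero]⟩

/-- The index `r` is both the lower left index of the first leg of `Δ_{rs}(a)` and the upper left
index of the second, and right multiplication does not change left columns. -/
theorem E₁_comp_T₁ : 𝒜.E₁ ∘ₗ 𝒜.T₁ = 𝒜.T₁ := by
  refine ext_incl₂ fun K a L b => ?_
  rw [comp_apply, T₁_tmul_incl]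
  refine colComul_congr (f := 𝒜.E₁ ∘ₗ (mulRight ℂ (𝒜.incl L b)).lTensor _)
    L.lu K (fun r u v => ?_) a
  obtain ⟨c, hc⟩ := 𝒜.exists_incl_mul_incl _ _ v b
  rw [comp_apply, lTensor_tmul, mulRight_apply, hc, E₁_incl,
    if_pos rfl]

theorem E₂_comp_T₂ : 𝒜.E₂ ∘ₗ 𝒜.T₂ = 𝒜.T₂ := by
  refine ext_incl₂ fun L b K a => ?_
  rw [comp_apply, T₂_incl_tmul]
  refine rowComul_congr (f := 𝒜.E₂ ∘ₗ (mulLeft ℂ (𝒜.incl L b)).rTensor _)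
    L.rd K (fun r u v => ?_) a
  obtain ⟨c, hc⟩ := 𝒜.exists_incl_mul_incl _ _ b u
  rw [comp_apply, rTensor_tmul, mulLeft_apply, hc, E₂_incl,
    if_pos rfl]

/-! ### The generalized inverses of the canonical maps given by an antipode -/

/-- A linear map on the total algebra that satisfies the laws of the antipode. -/
structure IsTotalAntipode (S : 𝒜.Total →ₗ[ℂ] 𝒜.Total) : Prop where
  grading : ∀ K a, ∃ c, S (𝒜.incl K a) = 𝒜.incl ⟨K.rd, K.ld, K.ru, K.lu⟩ c
  left : ∀ r K a, mul' ℂ _ (S.lTensor _ (𝒜.rowComul r (𝒜.incl K a))) =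
    𝒜.totalCounit (𝒜.incl K a) • 𝒜.unit K.ld r
  right : ∀ s K a, mul' ℂ _ (S.rTensor _ (𝒜.colComul s (𝒜.incl K a))) =
    𝒜.totalCounit (𝒜.incl K a) • 𝒜.unit s K.rd

variable {𝒜} in
-- A nonzero counit forces equal rows, so the unit may be labelled by either row. For `R₁` the lower
-- row is the one independent of the summation index, for `R₂` the upper row; hence two forms of
-- each law.
theorem IsTotalAntipode.left' {S : 𝒜.Total →ₗ[ℂ] 𝒜.Total} (hS : 𝒜.IsTotalAntipode S) (r : I)
    (K : M₂ I) (a : 𝒜.A K) :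
    mul' ℂ _ (S.lTensor _ (𝒜.rowComul r (𝒜.incl K a))) =
      𝒜.totalCounit (𝒜.incl K a) • 𝒜.unit K.lu r := by
  rw [hS.left]
  by_cases h : K.lu = K.ld ∧ K.ru = K.rd
  · rw [h.1]
  · rw [totalCounit_incl_of_ne _ _ _ h, zero_smul, zero_smul]

variable {𝒜} in
theorem IsTotalAntipode.right' {S : 𝒜.Total →ₗ[ℂ] 𝒜.Total} (hS : 𝒜.IsTotalAntipode S) (s : I)
    (K : M₂ I) (a : 𝒜.A K) :
    mul' ℂ _ (S.rTensor _ (𝒜.colComul s (𝒜.incl K a))) =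
      𝒜.totalCounit (𝒜.incl K a) • 𝒜.unit s K.ru := by
  rw [hS.right]
  by_cases h : K.lu = K.ld ∧ K.ru = K.rd
  · rw [h.2]
  · rw [totalCounit_incl_of_ne _ _ _ h, zero_smul, zero_smul]

/-- The map `a ⊗ b ↦ ∑ a₍₁₎ ⊗ S(a₍₂₎)b`. -/
def galoisInv₁ (S : 𝒜.Total →ₗ[ℂ] 𝒜.Total) : 𝒜.Total ⊗[ℂ] 𝒜.Total →ₗ[ℂ] 𝒜.Total ⊗[ℂ] 𝒜.Total :=
  TensorProduct.lift (𝒜.totalLift fun L =>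
    LinearMap.lcomp ℂ _ (𝒜.rowComul L.ld) ∘ₗ LinearMap.lTensorHom 𝒜.Total ∘ₗ
      LinearMap.lcomp ℂ _ S ∘ₗ (LinearMap.mul ℂ 𝒜.Total).flip ∘ₗ 𝒜.incl L).flip

/-- The map `a ⊗ b ↦ ∑ aS(b₍₁₎) ⊗ b₍₂₎`. -/
def galoisInv₂ (S : 𝒜.Total →ₗ[ℂ] 𝒜.Total) : 𝒜.Total ⊗[ℂ] 𝒜.Total →ₗ[ℂ] 𝒜.Total ⊗[ℂ] 𝒜.Total :=
  TensorProduct.lift (𝒜.totalLift fun L =>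
    LinearMap.lcomp ℂ _ (𝒜.colComul L.ru) ∘ₗ LinearMap.rTensorHom 𝒜.Total ∘ₗ
      LinearMap.lcomp ℂ _ S ∘ₗ LinearMap.mul ℂ 𝒜.Total ∘ₗ 𝒜.incl L)

/-- Only one row is needed: for `v` in `(r s; m n)` the element `S(v)` should lie in `(n m; s r)`,
so `S(v)b` vanishes unless `r` is the lower left index of `b`. Symmetrically, `galoisInv₂` uses the
column `L.ru`. -/
theorem galoisInv₁_tmul_incl (S : 𝒜.Total →ₗ[ℂ] 𝒜.Total) (x : 𝒜.Total) (L : M₂ I) (b : 𝒜.A L) :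
    𝒜.galoisInv₁ S (x ⊗ₜ 𝒜.incl L b) =
      (mulRight ℂ (𝒜.incl L b) ∘ₗ S).lTensor _ (𝒜.rowComul L.ld x) := by
  rw [galoisInv₁, TensorProduct.lift.tmul, flip_apply, totalLift_incl]
  rfl

theorem galoisInv₂_incl_tmul (S : 𝒜.Total →ₗ[ℂ] 𝒜.Total) (x : 𝒜.Total) (L : M₂ I) (b : 𝒜.A L) :
    𝒜.galoisInv₂ S (𝒜.incl L b ⊗ₜ x) =
      (mulLeft ℂ (𝒜.incl L b) ∘ₗ S).rTensor _ (𝒜.colComul L.ru x) := by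
  rw [galoisInv₂, TensorProduct.lift.tmul, totalLift_incl]
  rfl

/-- Here `w` stands for the coproduct of one leg. This and the three identities after it move `b`
and the remaining leg into one multiplication, which brings a composite of `Tᵢ` and `Rᵢ` into the
form required by coassociativity. -/
theorem mulRight_mul_lTensor_assoc (S : 𝒜.Total →ₗ[ℂ] 𝒜.Total) (w : 𝒜.Total ⊗[ℂ] 𝒜.Total)
    (v b : 𝒜.Total) :
    (mulRight ℂ b ∘ₗ mul' ℂ _ ∘ₗ S.lTensor _).lTensor _
      (TensorProduct.assoc ℂ _ _ _ (w ⊗ₜ v)) =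
    (mulRight ℂ (S v * b)).lTensor _ w := by
  induction w with
  | zero => simp
  | add x y hx hy => simp only [add_tmul, map_add, hx, hy]
  | tmul x y => simp [_root_.mul_assoc]

theorem mulRight_mul_rTensor_assoc (S : 𝒜.Total →ₗ[ℂ] 𝒜.Total) (w : 𝒜.Total ⊗[ℂ] 𝒜.Total)
    (v b : 𝒜.Total) :
    (mulRight ℂ b ∘ₗ mul' ℂ _ ∘ₗ S.rTensor _).lTensor _
      (TensorProduct.assoc ℂ _ _ _ (w ⊗ₜ v)) =
    (mulRight ℂ (v * b) ∘ₗ S).lTensor _ w := by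
  induction w with
  | zero => simp
  | add x y hx hy => simp only [add_tmul, map_add, hx, hy]
  | tmul x y => simp [_root_.mul_assoc]

theorem mulLeft_mul_rTensor_assoc_symm (S : 𝒜.Total →ₗ[ℂ] 𝒜.Total) (w : 𝒜.Total ⊗[ℂ] 𝒜.Total)
    (u b : 𝒜.Total) :
    (mulLeft ℂ b ∘ₗ mul' ℂ _ ∘ₗ S.rTensor _).rTensor _
      ((TensorProduct.assoc ℂ _ _ _).symm (u ⊗ₜ w)) =
    (mulLeft ℂ (b * S u)).rTensor _ w := by
  induction w with
  | zero => simp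
  | add x y hx hy => simp only [tmul_add, map_add, hx, hy]
  | tmul x y => simp

theorem mulLeft_mul_lTensor_assoc_symm (S : 𝒜.Total →ₗ[ℂ] 𝒜.Total) (w : 𝒜.Total ⊗[ℂ] 𝒜.Total)
    (u b : 𝒜.Total) :
    (mulLeft ℂ b ∘ₗ mul' ℂ _ ∘ₗ S.lTensor _).rTensor _
      ((TensorProduct.assoc ℂ _ _ _).symm (u ⊗ₜ w)) =
    (mulLeft ℂ (b * u) ∘ₗ S).rTensor _ w := by
  induction w with
  | zero => simp
  | add x y hx hy => simp only [tmul_add, map_add, hx, hy]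
  | tmul x y => simp

section

variable {𝒜} {S : 𝒜.Total →ₗ[ℂ] 𝒜.Total}

/-- The right side is `a₁ ⊗ a₂S(a₃)b`. The grading of `S` gives `S(v)b` the upper left index `K.rd`
for every term, so `T₁` always uses the same column and mixed coassociativity applies. -/
theorem T₁_galoisInv₁_incl
    (hg : ∀ K a, ∃ c, S (𝒜.incl K a) = 𝒜.incl ⟨K.rd, K.ld, K.ru, K.lu⟩ c)
    (K L : M₂ I) (a : 𝒜.A K) (b : 𝒜.A L) :
    𝒜.T₁ (𝒜.galoisInv₁ S (𝒜.incl K a ⊗ₜ 𝒜.incl L b)) =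
      (mulRight ℂ (𝒜.incl L b) ∘ₗ mul' ℂ _ ∘ₗ S.lTensor _ ∘ₗ
        𝒜.rowComul L.ld).lTensor _ (𝒜.colComul K.rd (𝒜.incl K a)) := by
  have h := rowComul_congr
    (f := 𝒜.T₁ ∘ₗ (mulRight ℂ (𝒜.incl L b) ∘ₗ S).lTensor _)
    (g := (mulRight ℂ (𝒜.incl L b) ∘ₗ mul' ℂ _ ∘ₗ
      S.lTensor _).lTensor _ ∘ₗ (TensorProduct.assoc ℂ _ _ _).toLinearMap ∘ₗ
        (𝒜.colComul K.rd).rTensor _) L.ld K (fun s u v => ?_) a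
  · simp only [comp_apply, coe_coe, colComul_rowComul] at h
    rw [galoisInv₁_tmul_incl, h, ← lTensor_comp_apply]
    rfl
  · obtain ⟨c, hc⟩ := hg _ v
    obtain ⟨d, hd⟩ := 𝒜.exists_incl_mul_incl _ _ c b
    simp only [comp_apply, coe_coe, lTensor_tmul,
      rTensor_tmul, mulRight_mul_lTensor_assoc, mulRight_apply, hc, hd,
      T₁_tmul_incl]

/-- The right side is `a₁ ⊗ S(a₂)a₃b`. The lower left index of `vb` is `K.ld` for any `S`, so no
grading of `S` is needed. -/
theorem galoisInv₁_T₁_incl (K L : M₂ I) (a : 𝒜.A K) (b : 𝒜.A L) :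
    𝒜.galoisInv₁ S (𝒜.T₁ (𝒜.incl K a ⊗ₜ 𝒜.incl L b)) =
      (mulRight ℂ (𝒜.incl L b) ∘ₗ mul' ℂ _ ∘ₗ S.rTensor _ ∘ₗ
        𝒜.colComul L.lu).lTensor _ (𝒜.rowComul K.ld (𝒜.incl K a)) := by
  have h := colComul_congr
    (f := 𝒜.galoisInv₁ S ∘ₗ (mulRight ℂ (𝒜.incl L b)).lTensor _)
    (g := (mulRight ℂ (𝒜.incl L b) ∘ₗ mul' ℂ _ ∘ₗ
      S.rTensor _).lTensor _ ∘ₗ (TensorProduct.assoc ℂ _ _ _).toLinearMap ∘ₗ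
        (𝒜.rowComul K.ld).rTensor _) L.lu K (fun r u v => ?_) a
  · simp only [comp_apply, coe_coe, rowComul_colComul] at h
    rw [T₁_tmul_incl, h, ← lTensor_comp_apply]
    rfl
  · obtain ⟨d, hd⟩ := 𝒜.exists_incl_mul_incl _ _ v b
    simp only [comp_apply, coe_coe, lTensor_tmul,
      rTensor_tmul, mulRight_mul_rTensor_assoc, mulRight_apply, hd,
      galoisInv₁_tmul_incl]

theorem T₂_galoisInv₂_incl
    (hg : ∀ K a, ∃ c, S (𝒜.incl K a) = 𝒜.incl ⟨K.rd, K.ld, K.ru, K.lu⟩ c)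
    (K L : M₂ I) (a : 𝒜.A K) (b : 𝒜.A L) :
    𝒜.T₂ (𝒜.galoisInv₂ S (𝒜.incl L b ⊗ₜ 𝒜.incl K a)) =
      (mulLeft ℂ (𝒜.incl L b) ∘ₗ mul' ℂ _ ∘ₗ S.rTensor _ ∘ₗ
        𝒜.colComul L.ru).rTensor _ (𝒜.rowComul K.lu (𝒜.incl K a)) := by
  have h := colComul_congr
    (f := 𝒜.T₂ ∘ₗ (mulLeft ℂ (𝒜.incl L b) ∘ₗ S).rTensor _)
    (g := (mulLeft ℂ (𝒜.incl L b) ∘ₗ mul' ℂ _ ∘ₗ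
      S.rTensor _).rTensor _ ∘ₗ (TensorProduct.assoc ℂ _ _ _).symm.toLinearMap ∘ₗ
        (𝒜.rowComul K.lu).lTensor _) L.ru K (fun s u v => ?_) a
  · simp only [comp_apply, coe_coe, ← colComul_rowComul,
      LinearEquiv.symm_apply_apply] at h
    rw [galoisInv₂_incl_tmul, h, ← rTensor_comp_apply]
    rfl
  · obtain ⟨c, hc⟩ := hg _ u
    obtain ⟨d, hd⟩ := 𝒜.exists_incl_mul_incl _ _ b c
    simp only [comp_apply, coe_coe, lTensor_tmul,
      rTensor_tmul, mulLeft_mul_rTensor_assoc_symm, mulLeft_apply, hc, hd,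
      T₂_incl_tmul]

theorem galoisInv₂_T₂_incl (K L : M₂ I) (a : 𝒜.A K) (b : 𝒜.A L) :
    𝒜.galoisInv₂ S (𝒜.T₂ (𝒜.incl L b ⊗ₜ 𝒜.incl K a)) =
      (mulLeft ℂ (𝒜.incl L b) ∘ₗ mul' ℂ _ ∘ₗ S.lTensor _ ∘ₗ
        𝒜.rowComul L.rd).rTensor _ (𝒜.colComul K.ru (𝒜.incl K a)) := by
  have h := rowComul_congr
    (f := 𝒜.galoisInv₂ S ∘ₗ (mulLeft ℂ (𝒜.incl L b)).rTensor _)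
    (g := (mulLeft ℂ (𝒜.incl L b) ∘ₗ mul' ℂ _ ∘ₗ
      S.lTensor _).rTensor _ ∘ₗ (TensorProduct.assoc ℂ _ _ _).symm.toLinearMap ∘ₗ
        (𝒜.colComul K.ru).lTensor _) L.rd K (fun r u v => ?_) a
  · simp only [comp_apply, coe_coe, ← rowComul_colComul,
      LinearEquiv.symm_apply_apply] at h
    rw [T₂_incl_tmul, h, ← rTensor_comp_apply]
    rfl
  · obtain ⟨d, hd⟩ := 𝒜.exists_incl_mul_incl _ _ b u
    simp only [comp_apply, coe_coe, lTensor_tmul,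
      rTensor_tmul, mulLeft_mul_lTensor_assoc_symm, mulLeft_apply, hd,
      galoisInv₂_incl_tmul]

/-- The antipode laws contract two of the three legs to `ε` times a unit with fixed labels, and the
counit then restores `a`. What remains is left multiplication of `b` by that unit, which keeps or
kills `b` by an index comparison; this is `E₁` or `G₁`. -/
theorem IsTotalAntipode.isGenInverse₁ (hS : 𝒜.IsTotalAntipode S) :
    IsGenInverse 𝒜.T₁ 𝒜.E₁ 𝒜.G₁ (𝒜.galoisInv₁ S) := by
  classical
  have hTR : 𝒜.T₁ ∘ₗ 𝒜.galoisInv₁ S = 𝒜.E₁ := by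
    refine ext_incl₂ fun K a L b => ?_
    rw [comp_apply, T₁_galoisInv₁_incl hS.grading]
    refine (colComul_congr (g := (TensorProduct.mk ℂ 𝒜.Total 𝒜.Total).flip
      (𝒜.unit K.ld L.ld * 𝒜.incl L b) ∘ₗ sliceRight 𝒜.totalCounit) K.rd K
      (fun r u v => ?_) a).trans ?_
    · simp only [lTensor_tmul, comp_apply, hS.left, map_smul,
        mulRight_apply, sliceRight_tmul, flip_apply, mk_apply,
        tmul_smul, smul_tmul']
    · rw [comp_apply, sliceRight_colComul, if_pos rfl, flip_apply,
        mk_apply, unit_mul_incl, E₁_incl]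
      split_ifs <;> simp_all
  have hRT : 𝒜.galoisInv₁ S ∘ₗ 𝒜.T₁ = 𝒜.G₁ := by
    refine ext_incl₂ fun K a L b => ?_
    rw [comp_apply, galoisInv₁_T₁_incl]
    refine (rowComul_congr (g := (TensorProduct.mk ℂ 𝒜.Total 𝒜.Total).flip
      (𝒜.unit L.lu K.rd * 𝒜.incl L b) ∘ₗ sliceRight 𝒜.totalCounit) K.ld K
      (fun r u v => ?_) a).trans ?_
    · simp only [lTensor_tmul, comp_apply, hS.right, map_smul,
        mulRight_apply, sliceRight_tmul, flip_apply, mk_apply,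
        tmul_smul, smul_tmul']
    · rw [comp_apply, sliceRight_rowComul, if_pos rfl, flip_apply,
        mk_apply, unit_mul_incl, G₁_incl]
      split_ifs <;> simp_all
  refine ⟨hTR, hRT, ?_, ?_⟩
  · rw [← LinearMap.comp_assoc, hTR, E₁_comp_T₁]
  · rw [← LinearMap.comp_assoc, hRT]
    -- It remains that `G₁` fixes the range of `R₁`: the index `s` is the lower right index of `u`
    -- and the lower left index of `S(v)b`.
    refine ext_incl₂ fun K a L b => ?_
    rw [comp_apply, galoisInv₁_tmul_incl]
    refine rowComul_congr (f := 𝒜.G₁ ∘ₗ (mulRight ℂ (𝒜.incl L b) ∘ₗ S).lTensor _)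
      L.ld K (fun s u v => ?_) a
    obtain ⟨c, hc⟩ := hS.grading _ v
    obtain ⟨d, hd⟩ := 𝒜.exists_incl_mul_incl _ _ c b
    simp only [comp_apply, lTensor_tmul, mulRight_apply, hc, hd,
      G₁_incl, if_true]

theorem IsTotalAntipode.isGenInverse₂ (hS : 𝒜.IsTotalAntipode S) :
    IsGenInverse 𝒜.T₂ 𝒜.E₂ 𝒜.G₂ (𝒜.galoisInv₂ S) := by
  classical
  have hTR : 𝒜.T₂ ∘ₗ 𝒜.galoisInv₂ S = 𝒜.E₂ := by
    refine ext_incl₂ fun L b K a => ?_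
    rw [comp_apply, T₂_galoisInv₂_incl hS.grading]
    refine (rowComul_congr (g := TensorProduct.mk ℂ 𝒜.Total 𝒜.Total
      (𝒜.incl L b * 𝒜.unit L.ru K.ru) ∘ₗ sliceLeft 𝒜.totalCounit) K.lu K
      (fun r u v => ?_) a).trans ?_
    · simp only [rTensor_tmul, comp_apply, hS.right', map_smul,
        mulLeft_apply, sliceLeft_tmul, mk_apply,
        smul_tmul']
    · rw [comp_apply, sliceLeft_rowComul, if_pos rfl,
        mk_apply, incl_mul_unit, E₂_incl]
      split_ifs <;> simp_all
  have hRT : 𝒜.galoisInv₂ S ∘ₗ 𝒜.T₂ = 𝒜.G₂ := by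
    refine ext_incl₂ fun L b K a => ?_
    rw [comp_apply, galoisInv₂_T₂_incl]
    refine (colComul_congr (g := TensorProduct.mk ℂ 𝒜.Total 𝒜.Total
      (𝒜.incl L b * 𝒜.unit K.lu L.rd) ∘ₗ sliceLeft 𝒜.totalCounit) K.ru K
      (fun r u v => ?_) a).trans ?_
    · simp only [rTensor_tmul, comp_apply, hS.left', map_smul,
        mulLeft_apply, sliceLeft_tmul, mk_apply,
        smul_tmul']
    · rw [comp_apply, sliceLeft_colComul, if_pos rfl,
        mk_apply, incl_mul_unit, G₂_incl]
      split_ifs <;> simp_all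
  refine ⟨hTR, hRT, ?_, ?_⟩
  · rw [← LinearMap.comp_assoc, hTR, E₂_comp_T₂]
  · rw [← LinearMap.comp_assoc, hRT]
    refine ext_incl₂ fun L b K a => ?_
    rw [comp_apply, galoisInv₂_incl_tmul]
    refine colComul_congr (f := 𝒜.G₂ ∘ₗ (mulLeft ℂ (𝒜.incl L b) ∘ₗ S).rTensor _)
      L.ru K (fun s u v => ?_) a
    obtain ⟨c, hc⟩ := hS.grading _ u
    obtain ⟨d, hd⟩ := 𝒜.exists_incl_mul_incl _ _ b c
    simp only [comp_apply, rTensor_tmul, mulLeft_apply, hc, hd,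
      G₂_incl, if_true]

end

/-! ### Antipodes and their extensions to the total algebra -/

theorem incl_injective (K : M₂ I) : Function.Injective (𝒜.incl K) := by
  classical
  exact DirectSum.of_injective (β := 𝒜.A) K

section

variable {𝒜} (S : ∀ {k l m n : I}, 𝒜.A ⟨k, l, m, n⟩ →ₗ[ℂ] 𝒜.A ⟨n, m, l, k⟩)

theorem totalAntipode_incl {k l m n : I} (a : 𝒜.A ⟨k, l, m, n⟩) :
    𝒜.totalAntipode S (𝒜.incl ⟨k, l, m, n⟩ a) = 𝒜.incl ⟨n, m, l, k⟩ (S a) :=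
  𝒜.totalLift_incl _ _ a

/-- Translates the antipode sums, which are formed inside a single component, into the total
algebra, where the products are untyped. -/
theorem incl_finsum_mul_antipode (k l m r : I) (a : 𝒜.A ⟨k, l, m, l⟩) :
    𝒜.incl ⟨k, m, r, r⟩ (∑ᶠ s : I, TensorProduct.lift
      ((𝒜.mul : 𝒜.A ⟨k, l, r, s⟩ →ₗ[ℂ] 𝒜.A ⟨l, m, s, r⟩ →ₗ[ℂ] 𝒜.A ⟨k, m, r, r⟩).compl₁₂
        LinearMap.id S) (𝒜.comul r s a)) =
    mul' ℂ _ ((𝒜.totalAntipode S).lTensor _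
      (𝒜.rowComul r (𝒜.incl ⟨k, l, m, l⟩ a))) := by
  have h := map_rowComul (mul' ℂ _ ∘ₗ (𝒜.totalAntipode S).lTensor _) r
    (𝒜.incl ⟨k, l, m, l⟩ a)
  simp only [comp_apply] at h
  rw [h, map_finsum]
  · refine finsum_congr fun s => ?_
    rw [comulTotal_incl]
    change _ = mul' ℂ _ ((𝒜.totalAntipode S).lTensor _
      (TensorProduct.map (𝒜.incl ⟨k, l, r, s⟩) (𝒜.incl ⟨r, s, m, l⟩) (𝒜.comul r s a)))
    generalize 𝒜.comul r s a = w
    induction w with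
    | zero => simp
    | add x y hx hy => simp only [map_add, hx, hy]
    | tmul x y => simp [totalAntipode_incl, incl_mul, mulComp_eq]
  · exact (𝒜.finite_row a r).subset fun s hs h0 => hs (by simp only [h0, map_zero])

theorem incl_finsum_antipode_mul (k l n s : I) (a : 𝒜.A ⟨k, l, k, n⟩) :
    𝒜.incl ⟨s, s, l, n⟩ (∑ᶠ r : I, TensorProduct.lift
      ((𝒜.mul : 𝒜.A ⟨s, r, l, k⟩ →ₗ[ℂ] 𝒜.A ⟨r, s, k, n⟩ →ₗ[ℂ] 𝒜.A ⟨s, s, l, n⟩).compl₁₂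
        S LinearMap.id) (𝒜.comul r s a)) =
    mul' ℂ _ ((𝒜.totalAntipode S).rTensor _
      (𝒜.colComul s (𝒜.incl ⟨k, l, k, n⟩ a))) := by
  have h := map_colComul (mul' ℂ _ ∘ₗ (𝒜.totalAntipode S).rTensor _) s
    (𝒜.incl ⟨k, l, k, n⟩ a)
  simp only [comp_apply] at h
  rw [h, map_finsum]
  · refine finsum_congr fun r => ?_
    rw [comulTotal_incl]
    change _ = mul' ℂ _ ((𝒜.totalAntipode S).rTensor _
      (TensorProduct.map (𝒜.incl ⟨k, l, r, s⟩) (𝒜.incl ⟨r, s, k, n⟩) (𝒜.comul r s a)))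
    generalize 𝒜.comul r s a = w
    induction w with
    | zero => simp
    | add x y hx hy => simp only [map_add, hx, hy]
    | tmul x y => simp [totalAntipode_incl, incl_mul, mulComp_eq]
  · exact (𝒜.finite_col a s).subset fun s hs h0 => hs (by simp only [h0, map_zero])

/-- The total laws also speak of components in which the antipode sums are empty. There the columns
never match, and the counit vanishes as well. -/
theorem IsAntipode.isTotalAntipode (hS : 𝒜.IsAntipode S) :
    𝒜.IsTotalAntipode (𝒜.totalAntipode S) where
  grading K a := ⟨_, totalAntipode_incl S a⟩
  left r K a := by
    obtain ⟨k, l, m, n⟩ := K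
    by_cases hn : l = n
    · subst hn
      rw [← incl_finsum_mul_antipode]
      by_cases hm : k = m
      · subst hm
        rw [hS.left, map_smul, totalCounit_incl]
        rfl
      · rw [hS.left_of_ne _ _ _ _ _ hm, totalCounit_incl_of_ne _ _ _ fun h => hm h.1,
          map_zero, zero_smul]
    -- For `l ≠ n` each product `u S(v)` is zero, since `u` has upper right index `l` and `S(v)` has
    -- upper left index `n`.
    · rw [totalCounit_incl_of_ne _ _ _ fun h => hn h.2, zero_smul]
      refine rowComul_congr (f := mul' ℂ _ ∘ₗ
        (𝒜.totalAntipode S).lTensor _) (g := 0) r _ (fun s u v => ?_) a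
      rw [comp_apply, lTensor_tmul, totalAntipode_incl,
        mul'_apply, incl_mul_of_ne _ fun h => hn h.1]
      rfl
  right s K a := by
    obtain ⟨k, l, m, n⟩ := K
    by_cases hm : k = m
    · subst hm
      rw [← incl_finsum_antipode_mul]
      by_cases hn : l = n
      · subst hn
        rw [hS.right, map_smul, totalCounit_incl]
        rfl
      · rw [hS.right_of_ne _ _ _ _ _ hn, totalCounit_incl_of_ne _ _ _ fun h => hn h.2,
          map_zero, zero_smul]
    · rw [totalCounit_incl_of_ne _ _ _ fun h => hm h.1, zero_smul]
      refine colComul_congr (f := mul' ℂ _ ∘ₗ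
        (𝒜.totalAntipode S).rTensor _) (g := 0) s _ (fun r u v => ?_) a
      rw [comp_apply, rTensor_tmul, totalAntipode_incl,
        mul'_apply, incl_mul_of_ne _ fun h => hm h.2]
      rfl

theorem isAntipode_of_isTotalAntipode (hS : 𝒜.IsTotalAntipode (𝒜.totalAntipode S)) :
    𝒜.IsAntipode S where
  left k l r a := by
    apply 𝒜.incl_injective
    rw [incl_finsum_mul_antipode, hS.left, totalCounit_incl, map_smul]
    rfl
  left_of_ne k l m r a h := by
    apply 𝒜.incl_injective
    rw [incl_finsum_mul_antipode, hS.left, totalCounit_incl_of_ne _ _ _ fun hc => h hc.1,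
      map_zero, zero_smul]
  right k l s a := by
    apply 𝒜.incl_injective
    rw [incl_finsum_antipode_mul, hS.right, totalCounit_incl, map_smul]
    rfl
  right_of_ne k l n s a h := by
    apply 𝒜.incl_injective
    rw [incl_finsum_antipode_mul, hS.right, totalCounit_incl_of_ne _ _ _ fun hc => h hc.2,
      map_zero, zero_smul]

end

end PartialBialgebra

/-! ### Generalized inverses -/

namespace IsGenInverse

variable {V V' : Type*} [AddCommGroup V] [Module ℂ V] [AddCommGroup V'] [Module ℂ V']
  {T E G R R' : V →ₗ[ℂ] V} {T' E' G' S' : V' →ₗ[ℂ] V'}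

/-- `R` is expressible through `T`, `E` and `G` alone, so compatibility with these passes to `R`:
write `S' g = S' E' g = S' g T R = S' T' f R = G' f R = f G R = f R`. The maps `f` and `g` may
differ because `T` may change the leg on which an index is visible. -/
theorem intertwine (h : IsGenInverse T E G R) (h' : IsGenInverse T' E' G' S') {f g : V →ₗ[ℂ] V'}
    (hT : T' ∘ₗ f = g ∘ₗ T) (hE : E' ∘ₗ g = g ∘ₗ E) (hG : G' ∘ₗ f = f ∘ₗ G) :
    S' ∘ₗ g = f ∘ₗ R := by
  calc S' ∘ₗ g = S' ∘ₗ (T' ∘ₗ S') ∘ₗ g := by rw [← LinearMap.comp_assoc, h'.RTR]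
    _ = S' ∘ₗ g ∘ₗ T ∘ₗ R := by rw [h'.TR, hE, h.TR]
    _ = S' ∘ₗ (g ∘ₗ T) ∘ₗ R := rfl
    _ = (S' ∘ₗ T') ∘ₗ f ∘ₗ R := by rw [← hT]; rfl
    _ = f ∘ₗ (R ∘ₗ T) ∘ₗ R := by
      rw [h'.RT, ← LinearMap.comp_assoc, hG, h.RT]; simp only [LinearMap.comp_assoc]
    _ = f ∘ₗ R := by rw [LinearMap.comp_assoc, h.RTR]

theorem unique (h : IsGenInverse T E G R) (h' : IsGenInverse T E G R') : R' = R := by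
  simpa using h.intertwine h' (f := LinearMap.id) (g := LinearMap.id) (by simp) (by simp) (by simp)

theorem lTensor (h : IsGenInverse T E G R) (U : Type*) [AddCommGroup U] [Module ℂ U] :
    IsGenInverse (T.lTensor U) (E.lTensor U) (G.lTensor U) (R.lTensor U) where
  TR := by rw [← LinearMap.lTensor_comp, h.TR]
  RT := by rw [← LinearMap.lTensor_comp, h.RT]
  TRT := by rw [← LinearMap.lTensor_comp, ← LinearMap.lTensor_comp, h.TRT]
  RTR := by rw [← LinearMap.lTensor_comp, ← LinearMap.lTensor_comp, h.RTR]

theorem comp_E (h : IsGenInverse T E G R) : R ∘ₗ E = R := by rw [← h.TR, h.RTR]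

theorem G_comp (h : IsGenInverse T E G R) : G ∘ₗ R = R := by
  rw [← h.RT, LinearMap.comp_assoc, h.RTR]

theorem range_eq (h : IsGenInverse T E G R) : LinearMap.range T = LinearMap.range E := by
  apply le_antisymm
  · rw [← h.TRT, ← LinearMap.comp_assoc, h.TR]
    exact LinearMap.range_comp_le_range _ _
  · rw [← h.TR]
    exact LinearMap.range_comp_le_range _ _

theorem ker_eq (h : IsGenInverse T E G R) :
    LinearMap.ker T = LinearMap.range (LinearMap.id - G) := by
  ext x
  constructor
  · intro hx
    refine ⟨x, ?_⟩
    rw [← h.RT]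
    simp [LinearMap.mem_ker.1 hx]
  · rintro ⟨y, rfl⟩
    have := congr_fun h.TRT y
    simp only [comp_apply] at this
    rw [← h.RT]
    simp [this]

/-- Over a field `T` has a linear section `σ` on its range. Then `R = G σ E` works: `E` projects
onto the range, and `G` removes the ambiguity of `σ` modulo the kernel. -/
theorem exists_of_range_ker (hE : E ∘ₗ E = E) (hG : G ∘ₗ G = G)
    (hr : LinearMap.range T = LinearMap.range E)
    (hk : LinearMap.ker T = LinearMap.range (LinearMap.id - G)) : ∃ R, IsGenInverse T E G R := by
  obtain ⟨σ, hσ⟩ := T.rangeRestrict.exists_rightInverse_of_surjective T.range_rangeRestrict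
  have hσ' : ∀ y : LinearMap.range T, T (σ y) = y := fun y =>
    congrArg Subtype.val (congr_fun hσ y)
  have hEr : ∀ x, E x ∈ LinearMap.range T := fun x => hr ▸ LinearMap.mem_range_self E x
  have hET : ∀ x, E (T x) = T x := fun x => by
    obtain ⟨y, hy⟩ : T x ∈ LinearMap.range E := hr ▸ LinearMap.mem_range_self T x
    rw [← hy]
    exact congr_fun hE y
  have hTG : ∀ x, T (G x) = T x := fun x => by
    have : x - G x ∈ LinearMap.ker T := hk ▸ ⟨x, rfl⟩
    rw [LinearMap.mem_ker, map_sub, sub_eq_zero] at this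
    exact this.symm
  have hGk : ∀ x, T x = 0 → G x = 0 := fun x hx => by
    obtain ⟨y, rfl⟩ : x ∈ LinearMap.range (LinearMap.id - G) := hk ▸ hx
    have := congr_fun hG y
    simp only [comp_apply] at this
    simp [this]
  have hTR : T ∘ₗ G ∘ₗ σ ∘ₗ E.codRestrict _ hEr = E := by
    ext x
    simp [hTG, hσ']
  have hRT : (G ∘ₗ σ ∘ₗ E.codRestrict _ hEr) ∘ₗ T = G := by
    ext x
    -- The section changes `x` only by an element of the kernel of `T`, on which `G` vanishes.
    have := hGk (σ (E.codRestrict _ hEr (T x)) - x) (by simp [hσ', hET])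
    rw [map_sub, sub_eq_zero] at this
    exact this
  refine ⟨G ∘ₗ σ ∘ₗ E.codRestrict _ hEr, hTR, hRT, ?_, ?_⟩
  · rw [hRT]
    ext x
    exact hTG x
  · rw [← LinearMap.comp_assoc, hRT, ← LinearMap.comp_assoc, hG]

end IsGenInverse

namespace PartialBialgebra

variable {I : Type u} (𝒜 : PartialBialgebra.{u, v} I)

/-! ### The antipode given by a generalized inverse of `T₁` -/

section Intertwiners

open scoped Classical

variable {𝒜} {R : 𝒜.Total ⊗[ℂ] 𝒜.Total →ₗ[ℂ] 𝒜.Total ⊗[ℂ] 𝒜.Total}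
  (h : IsGenInverse 𝒜.T₁ 𝒜.E₁ 𝒜.G₁ R)

include h

theorem genInverse_mulRight (M : M₂ I) (c : 𝒜.A M) :
    R ∘ₗ (mulRight ℂ (𝒜.incl M c)).lTensor _ =
      (mulRight ℂ (𝒜.incl M c)).lTensor _ ∘ₗ R := by
  refine h.intertwine h (ext_incl₂ fun K a L b => ?_) (ext_incl₂ fun K a L b => ?_)
    (ext_incl₂ fun K a L b => ?_)
  all_goals
    obtain ⟨d, hd⟩ := 𝒜.exists_incl_mul_incl _ _ b c
  · simp only [comp_apply, lTensor_tmul, mulRight_apply, hd,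
      T₁_tmul_incl]
    rw [← lTensor_comp_apply, ← hd]
    congr 2
    ext x
    simp [_root_.mul_assoc]
  · simp only [comp_apply, lTensor_tmul, mulRight_apply, hd, E₁_incl]
    split_ifs <;> simp [hd]
  · simp only [comp_apply, lTensor_tmul, mulRight_apply, hd, G₁_incl]
    split_ifs <;> simp [hd]

/-- The source is `Δ(a)(1 ⊗ λ_n) = Δ(a)(ρ_n ⊗ 1)`: the upper left index of `b` reappears after `T₁`
as the lower right index of the first leg. -/
theorem genInverse_rho_right (n : I) :
    R ∘ₗ (𝒜.rho n).right.rTensor _ = (𝒜.lam n).left.lTensor _ ∘ₗ R := by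
  refine h.intertwine h (ext_incl₂ fun K a L b => ?_) (ext_incl₂ fun K a L b => ?_)
    (ext_incl₂ fun K a L b => ?_)
  · rw [comp_apply, comp_apply, lTensor_tmul, lam_left_incl,
      T₁_tmul_incl]
    refine Eq.trans ?_ (colComul_congr (f := if n = L.lu then
      (mulRight ℂ (𝒜.incl L b)).lTensor _ else 0)
      (g := (𝒜.rho n).right.rTensor _ ∘ₗ
        (mulRight ℂ (𝒜.incl L b)).lTensor _) _ _ (fun r u v => ?_) _)
    · split_ifs
      · rw [T₁_tmul_incl]
      · simp
    · simp only [comp_apply, lTensor_tmul, rTensor_tmul,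
        rho_right_incl]
      split_ifs <;> simp
  · simp only [comp_apply, rTensor_tmul, rho_right_incl, E₁_incl]
    split_ifs <;> simp_all [E₁_incl, rho_right_incl]
  · simp only [comp_apply, lTensor_tmul, lam_left_incl, G₁_incl]
    split_ifs <;> simp_all [G₁_incl, lam_left_incl]

/-- `T₁` carries the lower left index of `a` to the second leg, so `R` carries it back from the
second leg to the first. -/
theorem genInverse_rho_left (m : I) :
    R ∘ₗ (𝒜.rho m).left.lTensor _ = (𝒜.rho m).left.rTensor _ ∘ₗ R := by
  refine h.intertwine h (ext_incl₂ fun K a L b => ?_) (ext_incl₂ fun K a L b => ?_)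
    (ext_incl₂ fun K a L b => ?_)
  · rw [comp_apply, comp_apply, rTensor_tmul, rho_left_incl,
      T₁_tmul_incl, T₁_tmul_incl]
    refine Eq.trans ?_ (colComul_congr (f := if m = K.ld then
      (mulRight ℂ (𝒜.incl L b)).lTensor _ else 0)
      (g := (𝒜.rho m).left.lTensor _ ∘ₗ
        (mulRight ℂ (𝒜.incl L b)).lTensor _) _ _ (fun r u v => ?_) _)
    · split_ifs <;> simp
    · obtain ⟨d, hd⟩ := 𝒜.exists_incl_mul_incl _ _ v b
      simp only [comp_apply, lTensor_tmul, mulRight_apply, hd,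
        rho_left_incl]
      split_ifs <;> simp [hd]
  · simp only [comp_apply, lTensor_tmul, rho_left_incl, E₁_incl]
    split_ifs <;> simp_all [E₁_incl, rho_left_incl]
  · simp only [comp_apply, rTensor_tmul, rho_left_incl, G₁_incl]
    split_ifs <;> simp_all [G₁_incl, rho_left_incl]

theorem genInverse_lam_left (k : I) :
    R ∘ₗ (𝒜.lam k).left.rTensor _ = (𝒜.lam k).left.rTensor _ ∘ₗ R := by
  refine h.intertwine h (ext_incl₂ fun K a L b => ?_) (ext_incl₂ fun K a L b => ?_)
    (ext_incl₂ fun K a L b => ?_)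
  · rw [comp_apply, comp_apply, rTensor_tmul, lam_left_incl,
      T₁_tmul_incl, T₁_tmul_incl]
    refine Eq.trans ?_ (colComul_congr (f := if k = K.lu then
      (mulRight ℂ (𝒜.incl L b)).lTensor _ else 0)
      (g := (𝒜.lam k).left.rTensor _ ∘ₗ
        (mulRight ℂ (𝒜.incl L b)).lTensor _) _ _ (fun r u v => ?_) _)
    · split_ifs <;> simp
    · simp only [comp_apply, lTensor_tmul, rTensor_tmul,
        lam_left_incl]
      split_ifs <;> simp
  · simp only [comp_apply, rTensor_tmul, lam_left_incl, E₁_incl]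
    split_ifs <;> simp_all [E₁_incl, lam_left_incl]
  · simp only [comp_apply, rTensor_tmul, lam_left_incl, G₁_incl]
    split_ifs <;> simp_all [G₁_incl, lam_left_incl]

theorem genInverse_lam_right (l : I) :
    R ∘ₗ (𝒜.lam l).right.rTensor _ = (𝒜.lam l).right.rTensor _ ∘ₗ R := by
  refine h.intertwine h (ext_incl₂ fun K a L b => ?_) (ext_incl₂ fun K a L b => ?_)
    (ext_incl₂ fun K a L b => ?_)
  · rw [comp_apply, comp_apply, rTensor_tmul, lam_right_incl,
      T₁_tmul_incl, T₁_tmul_incl]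
    refine Eq.trans ?_ (colComul_congr (f := if l = K.ru then
      (mulRight ℂ (𝒜.incl L b)).lTensor _ else 0)
      (g := (𝒜.lam l).right.rTensor _ ∘ₗ
        (mulRight ℂ (𝒜.incl L b)).lTensor _) _ _ (fun r u v => ?_) _)
    · split_ifs <;> simp
    · simp only [comp_apply, lTensor_tmul, rTensor_tmul,
        lam_right_incl]
      split_ifs <;> simp
  · simp only [comp_apply, rTensor_tmul, lam_right_incl, E₁_incl]
    split_ifs <;> simp_all [E₁_incl, lam_right_incl]
  · simp only [comp_apply, rTensor_tmul, lam_right_incl, G₁_incl]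
    split_ifs <;> simp_all [G₁_incl, lam_right_incl]

/-- Colinearity of `R` in the first leg. By mixed coassociativity `T₁` is colinear, and `E₁`, `G₁`
depend only on indices of `a` that are unchanged in the second leg of its coproduct. -/
theorem genInverse_rowComul (r : I) :
    R.lTensor _ ∘ₗ (TensorProduct.assoc ℂ _ _ _).toLinearMap ∘ₗ
        (𝒜.rowComul r).rTensor _ =
      ((TensorProduct.assoc ℂ _ _ _).toLinearMap ∘ₗ (𝒜.rowComul r).rTensor _) ∘ₗ R := by
  refine h.intertwine (h.lTensor _) (ext_incl₂ fun K a L b => ?_)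
    (ext_incl₂ fun K a L b => ?_) (ext_incl₂ fun K a L b => ?_)
  · have h1 : ∀ z : 𝒜.Total ⊗[ℂ] 𝒜.Total, 𝒜.T₁.lTensor _
        (TensorProduct.assoc ℂ _ _ _ (z ⊗ₜ 𝒜.incl L b)) =
        ((mulRight ℂ (𝒜.incl L b)).lTensor _ ∘ₗ
          𝒜.colComul L.lu).lTensor _ z := by
      intro z
      induction z with
      | zero => simp
      | add x y hx hy => simp only [add_tmul, map_add, hx, hy]
      | tmul x y => simp [T₁_tmul_incl]
    have h2 : ∀ z : 𝒜.Total ⊗[ℂ] 𝒜.Total, TensorProduct.assoc ℂ _ _ _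
        ((𝒜.rowComul r).rTensor _ ((mulRight ℂ (𝒜.incl L b)).lTensor _ z)) =
        ((mulRight ℂ (𝒜.incl L b)).lTensor _).lTensor _
          (TensorProduct.assoc ℂ _ _ _ ((𝒜.rowComul r).rTensor _ z)) := by
      intro z
      induction z with
      | zero => simp
      | add x y hx hy => simp only [map_add, hx, hy]
      | tmul x y =>
        simp only [lTensor_tmul, rTensor_tmul]
        generalize 𝒜.rowComul r x = w
        induction w with
        | zero => simp
        | add x y hx hy => simp only [add_tmul, map_add, hx, hy]
        | tmul x y => simp
    simp only [comp_apply, coe_coe, rTensor_tmul, h1,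
      T₁_tmul_incl, h2, rowComul_colComul]
    rw [← lTensor_comp_apply]
  · have := rowComul_congr (f := 𝒜.E₁.lTensor _ ∘ₗ
      (TensorProduct.assoc ℂ _ _ _).toLinearMap ∘ₗ (TensorProduct.mk ℂ _ _).flip (𝒜.incl L b))
      (g := if K.ld = L.lu then (TensorProduct.assoc ℂ _ _ _).toLinearMap ∘ₗ
        (TensorProduct.mk ℂ _ _).flip (𝒜.incl L b) else 0) r K (fun s u v => by
          simp only [comp_apply, flip_apply, mk_apply,
            coe_coe, assoc_tmul, lTensor_tmul, E₁_incl]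
          split_ifs <;> simp) a
    refine this.trans ?_
    simp only [comp_apply, E₁_incl]
    split_ifs <;> simp
  · have := rowComul_congr (f := 𝒜.G₁.lTensor _ ∘ₗ
      (TensorProduct.assoc ℂ _ _ _).toLinearMap ∘ₗ (TensorProduct.mk ℂ _ _).flip (𝒜.incl L b))
      (g := if K.rd = L.ld then (TensorProduct.assoc ℂ _ _ _).toLinearMap ∘ₗ
        (TensorProduct.mk ℂ _ _).flip (𝒜.incl L b) else 0) r K (fun s u v => by
          simp only [comp_apply, flip_apply, mk_apply,
            coe_coe, assoc_tmul, lTensor_tmul, G₁_incl]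
          split_ifs <;> simp) a
    refine this.trans ?_
    simp only [comp_apply, G₁_incl]
    split_ifs <;> simp

end Intertwiners

/-! ### Reconstruction of the antipode from a generalized inverse -/

open scoped Classical in
/-- The projection of the total algebra onto a component. -/
def component (K : M₂ I) : 𝒜.Total →ₗ[ℂ] 𝒜.A K := DirectSum.component ℂ (M₂ I) 𝒜.A K

theorem component_incl (K : M₂ I) (a : 𝒜.A K) : 𝒜.component K (𝒜.incl K a) = a := by
  classical
  exact DirectSum.component.lof_self ℂ K a

theorem exists_eq_incl {k l m n : I} {x : 𝒜.Total} (hk : (𝒜.lam k).left x = x)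
    (hm : (𝒜.rho m).left x = x) (hln : x * 𝒜.unit l n = x) : ∃ c, x = 𝒜.incl ⟨k, l, m, n⟩ c := by
  classical
  have key : ∀ y : 𝒜.Total,
      ∃ c, (𝒜.lam k).left ((𝒜.rho m).left (y * 𝒜.unit l n)) = 𝒜.incl ⟨k, l, m, n⟩ c := by
    intro y
    induction y using total_induction with
    | zero => exact ⟨0, by simp⟩
    | add y z hy hz =>
      obtain ⟨c, hc⟩ := hy
      obtain ⟨d, hd⟩ := hz
      exact ⟨c + d, by rw [add_mul, map_add, map_add, hc, hd, map_add]⟩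
    | incl K a =>
      by_cases h : (K.ru = l ∧ K.rd = n) ∧ k = K.lu ∧ m = K.ld
      · obtain ⟨⟨rfl, rfl⟩, rfl, rfl⟩ := h
        refine ⟨a, ?_⟩
        rw [incl_mul_unit, if_pos ⟨rfl, rfl⟩, rho_left_incl, if_pos rfl, lam_left_incl, if_pos rfl]
      · refine ⟨0, ?_⟩
        rw [incl_mul_unit]
        split_ifs with h1
        · rw [rho_left_incl]
          split_ifs with h2
          · rw [lam_left_incl, if_neg fun h3 => h ⟨h1, h3, h2⟩, map_zero]
          · simp
        · simp
  obtain ⟨c, hc⟩ := key x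
  exact ⟨c, by rw [← hc, hln, hm, hk]⟩

theorem sliceLeft_comp_lTensor (φ : 𝒜.Total →ₗ[ℂ] 𝒜.Total) (z : 𝒜.Total ⊗[ℂ] 𝒜.Total) :
    sliceLeft 𝒜.totalCounit (φ.lTensor _ z) = φ (sliceLeft 𝒜.totalCounit z) := by
  induction z with
  | zero => simp
  | add x y hx hy => simp only [map_add, hx, hy]
  | tmul x y => simp [sliceLeft_tmul]

section

variable {𝒜} (R : 𝒜.Total ⊗[ℂ] 𝒜.Total →ₗ[ℂ] 𝒜.Total ⊗[ℂ] 𝒜.Total)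

/-- The antipode `S(a) = (ε ⊗ id)R(a ⊗ 𝟏(m; k))`, for `a ∈ A(k l; m n)`, given by a generalized
inverse `R` of `T₁`. -/
def antipodeOfInverse {k l m n : I} : 𝒜.A ⟨k, l, m, n⟩ →ₗ[ℂ] 𝒜.A ⟨n, m, l, k⟩ :=
  𝒜.component ⟨n, m, l, k⟩ ∘ₗ sliceLeft 𝒜.totalCounit ∘ₗ R ∘ₗ
    (TensorProduct.mk ℂ 𝒜.Total 𝒜.Total).flip (𝒜.unit m k) ∘ₗ 𝒜.incl ⟨k, l, m, n⟩

variable {R} (h : IsGenInverse 𝒜.T₁ 𝒜.E₁ 𝒜.G₁ R)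

include h

/-- The intertwiners give the first leg of `R(a ⊗ 𝟏(m; r))` the left column `(K.lu; r)`, and `ε`
kills it when these entries differ. -/
theorem sliceLeft_genInverse_unit_of_ne (K : M₂ I) (a : 𝒜.A K) (r : I) (hr : r ≠ K.lu) :
    sliceLeft 𝒜.totalCounit (R (𝒜.incl K a ⊗ₜ 𝒜.unit K.ld r)) = 0 := by
  classical
  have h1 := congr_fun (genInverse_rho_left h r) (𝒜.incl K a ⊗ₜ 𝒜.unit K.ld r)
  have h2 := congr_fun (genInverse_lam_left h K.lu) (𝒜.incl K a ⊗ₜ 𝒜.unit K.ld r)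
  simp only [comp_apply, lTensor_tmul, rTensor_tmul, unit,
    rho_left_incl, lam_left_incl, if_true] at h1 h2
  have h3 : sliceLeft 𝒜.totalCounit ∘ₗ (𝒜.rho r).left.rTensor _ ∘ₗ
      (𝒜.lam K.lu).left.rTensor _ = 0 := by
    refine ext_incl₂ fun M c N d => ?_
    simp only [comp_apply, rTensor_tmul, lam_left_incl]
    split_ifs with hM
    · rw [rho_left_incl]
      split_ifs with hM'
      · rw [sliceLeft_tmul, totalCounit_incl_of_ne _ _ _ fun hc =>
          hr (hM'.trans (hc.1.symm.trans hM.symm)), zero_smul]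
        rfl
      · simp
    · simp
  have h4 := congr_fun h3 (R (𝒜.incl K a ⊗ₜ 𝒜.unit K.ld r))
  simp only [comp_apply, unit, ← h2, ← h1] at h4
  exact h4

/-- The intertwiners with `ρ` and with right multiplication by the unit give the upper left index
and the right column. The lower left index needs the counit as well. -/
theorem sliceLeft_genInverse_unit (K : M₂ I) (a : 𝒜.A K) (r : I) :
    ∃ c, sliceLeft 𝒜.totalCounit (R (𝒜.incl K a ⊗ₜ 𝒜.unit K.ld r)) =
      𝒜.incl ⟨K.rd, K.ld, K.ru, r⟩ c := by
  classical
  have h1 := congr_fun (genInverse_rho_right h K.rd) (𝒜.incl K a ⊗ₜ 𝒜.unit K.ld r)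
  have h2 := congr_fun (genInverse_lam_right h K.ru) (𝒜.incl K a ⊗ₜ 𝒜.unit K.ld r)
  have h3 := congr_fun (genInverse_mulRight h ⟨K.ld, K.ld, r, r⟩ (𝒜.one K.ld r))
    (𝒜.incl K a ⊗ₜ 𝒜.unit K.ld r)
  have hu : 𝒜.unit K.ld r * 𝒜.unit K.ld r = 𝒜.unit K.ld r :=
    (𝒜.incl_mul_unit K.ld r ⟨K.ld, K.ld, r, r⟩ (𝒜.one K.ld r)).trans (if_pos ⟨rfl, rfl⟩)
  simp only [comp_apply, lTensor_tmul, rTensor_tmul,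
    rho_right_incl, lam_right_incl, if_true, mulRight_apply] at h1 h2 h3
  rw [← unit, hu] at h3
  refine 𝒜.exists_eq_incl ?_ ?_ ?_
  · conv_rhs => rw [h1]
    rw [sliceLeft_comp_lTensor]
  -- The first leg has upper right index `K.ru`; `ε` survives only if its lower right index is the
  -- same; and since `G₁R = R`, that index is the lower left index of the second leg.
  · have h4 : sliceLeft 𝒜.totalCounit ∘ₗ (𝒜.rho K.ru).left.lTensor _ ∘ₗ 𝒜.G₁ ∘ₗ
        (𝒜.lam K.ru).right.rTensor _ = sliceLeft 𝒜.totalCounit ∘ₗ 𝒜.G₁ ∘ₗ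
        (𝒜.lam K.ru).right.rTensor _ := by
      refine ext_incl₂ fun M c N d => ?_
      simp only [comp_apply, rTensor_tmul, lam_right_incl]
      split_ifs with hM
      · rw [G₁_incl]
        split_ifs with hN
        · rw [lTensor_tmul, rho_left_incl]
          split_ifs with hN'
          · rfl
          · rw [tmul_zero, map_zero, sliceLeft_tmul,
              totalCounit_incl_of_ne _ _ _ fun hc => hN' (hM.trans (hc.2.trans hN)), zero_smul]
        · simp
      · simp
    have h5 := congr_fun h4 (R (𝒜.incl K a ⊗ₜ 𝒜.unit K.ld r))
    have h6 := congr_fun h.G_comp (𝒜.incl K a ⊗ₜ 𝒜.unit K.ld r)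
    simp only [comp_apply] at h5 h6
    rw [← h2, h6, sliceLeft_comp_lTensor] at h5
    exact h5
  · conv_rhs => rw [h3]
    rw [sliceLeft_comp_lTensor]
    rfl

theorem totalAntipode_antipodeOfInverse (K : M₂ I) (a : 𝒜.A K) :
    𝒜.totalAntipode (antipodeOfInverse R) (𝒜.incl K a) =
      sliceLeft 𝒜.totalCounit (R (𝒜.incl K a ⊗ₜ 𝒜.unit K.ld K.lu)) := by
  obtain ⟨k, l, m, n⟩ := K
  rw [totalAntipode_incl]
  obtain ⟨c, hc⟩ := sliceLeft_genInverse_unit h _ a k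
  dsimp only at hc ⊢
  rw [hc]
  congr 1
  change 𝒜.component ⟨n, m, l, k⟩ (sliceLeft 𝒜.totalCounit (R (𝒜.incl _ a ⊗ₜ 𝒜.unit m k))) = c
  rw [hc, component_incl]

open scoped Classical in
-- Write `b` as a unit times `b` and use right linearity of `R`. If no unit with upper index `K.ld`
-- fits `b`, then `R = RE₁` kills `a ⊗ b`.
theorem sliceLeft_genInverse (K L : M₂ I) (a : 𝒜.A K) (b : 𝒜.A L) :
    sliceLeft 𝒜.totalCounit (R (𝒜.incl K a ⊗ₜ 𝒜.incl L b)) =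
      if L.ld = K.lu then 𝒜.totalAntipode (antipodeOfInverse R) (𝒜.incl K a) * 𝒜.incl L b
      else 0 := by
  by_cases hKL : K.ld = L.lu
  · have h1 := congr_fun (genInverse_mulRight h L b) (𝒜.incl K a ⊗ₜ 𝒜.unit K.ld L.ld)
    simp only [comp_apply, lTensor_tmul, mulRight_apply] at h1
    rw [unit_mul_incl, if_pos ⟨hKL, rfl⟩] at h1
    rw [h1, sliceLeft_comp_lTensor]
    split_ifs with hL
    · rw [totalAntipode_antipodeOfInverse h, hL]
      rfl
    · rw [sliceLeft_genInverse_unit_of_ne h K a L.ld hL, map_zero]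
  · have h1 := congr_fun h.comp_E (𝒜.incl K a ⊗ₜ 𝒜.incl L b)
    rw [comp_apply, E₁_incl, if_neg hKL, map_zero] at h1
    rw [← h1, map_zero, totalAntipode_incl, incl_mul_of_ne _ fun hc => hKL hc.1, ite_self]

/-- Colinearity plus counit: `R(a ⊗ b) = (ρ ⊗ 1)R(a ⊗ b)` for the lower left index of `b`, and `ρ_r`
is `id ⊗ ε` after the row sum `r`. Moving that row sum through `R` gives `a₁ ⊗ (ε ⊗ id)R(a₂ ⊗ b) =
a₁ ⊗ S(a₂)b`. -/
theorem eq_galoisInv₁ : R = 𝒜.galoisInv₁ (𝒜.totalAntipode (antipodeOfInverse R)) := by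
  classical
  refine ext_incl₂ fun K a L b => ?_
  rw [galoisInv₁_tmul_incl]
  have h1 := congr_fun (genInverse_rho_left h L.ld) (𝒜.incl K a ⊗ₜ 𝒜.incl L b)
  have h2 := congr_fun (genInverse_rowComul h L.ld) (𝒜.incl K a ⊗ₜ 𝒜.incl L b)
  simp only [comp_apply, lTensor_tmul, rho_left_incl, if_true,
    coe_coe, rTensor_tmul] at h1 h2
  have h3 : (𝒜.rho L.ld).left = sliceRight 𝒜.totalCounit ∘ₗ 𝒜.rowComul L.ld := by
    refine ext_incl fun M c => ?_
    rw [comp_apply, sliceRight_rowComul, rho_left_incl]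
  have h4 : ∀ z : 𝒜.Total ⊗[ℂ] 𝒜.Total,
      (sliceRight 𝒜.totalCounit ∘ₗ 𝒜.rowComul L.ld).rTensor _ z =
      (sliceLeft 𝒜.totalCounit).lTensor _
        (TensorProduct.assoc ℂ _ _ _ ((𝒜.rowComul L.ld).rTensor _ z)) := by
    intro z
    induction z with
    | zero => simp
    | add x y hx hy => simp only [map_add, hx, hy]
    | tmul x y =>
      simp only [rTensor_tmul, comp_apply]
      generalize 𝒜.rowComul L.ld x = w
      induction w with
      | zero => simp
      | add x y hx hy => simp only [add_tmul, map_add, hx, hy]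
      | tmul x y => simp [sliceRight_tmul, sliceLeft_tmul, TensorProduct.smul_tmul]
  rw [h1, h3, h4, ← h2, ← lTensor_comp_apply]
  refine rowComul_congr (f := (sliceLeft 𝒜.totalCounit ∘ₗ R).lTensor _ ∘ₗ
    (TensorProduct.assoc ℂ _ _ _).toLinearMap ∘ₗ (TensorProduct.mk ℂ _ _).flip (𝒜.incl L b))
    L.ld K (fun s u v => ?_) a
  simp only [comp_apply, flip_apply, mk_apply,
    coe_coe, assoc_tmul, lTensor_tmul,
    sliceLeft_genInverse h, if_true, mulRight_apply]

/-- Each antipode law is `ε ⊗ id` applied to `T₁R = E₁` or `RT₁ = G₁` at `a ⊗ 𝟏`, with the unit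
chosen so that the projection fixes this tensor. -/
theorem isAntipode_antipodeOfInverse : 𝒜.IsAntipode (antipodeOfInverse R) := by
  classical
  refine isAntipode_of_isTotalAntipode _ ?_
  have hg : ∀ K a, ∃ c, 𝒜.totalAntipode (antipodeOfInverse R) (𝒜.incl K a) =
      𝒜.incl ⟨K.rd, K.ld, K.ru, K.lu⟩ c := fun K a => ⟨_, totalAntipode_incl _ _⟩
  have hR := eq_galoisInv₁ h
  refine ⟨hg, fun r K a => ?_, fun s K a => ?_⟩
  · have h1 := congrArg (sliceLeft 𝒜.totalCounit)
      (T₁_galoisInv₁_incl hg K ⟨K.ld, K.ld, r, r⟩ a (𝒜.one K.ld r))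
    have h2 := congr_fun h.TR (𝒜.incl K a ⊗ₜ 𝒜.unit K.ld r)
    rw [comp_apply, unit, E₁_incl, if_pos rfl] at h2
    rw [← hR, h2, sliceLeft_tmul, sliceLeft_comp_lTensor, sliceLeft_colComul] at h1
    rw [← unit] at h1
    rw [h1]
    -- If `K.ru = K.rd`, the extra unit on the right acts trivially, as every `u S(v)` has right
    -- column `(K.ld; r)`. Otherwise the counit side is zero and all products `u S(v)` vanish.
    split_ifs with hK
    · refine rowComul_congr (f := mul' ℂ _ ∘ₗ
        (𝒜.totalAntipode (antipodeOfInverse R)).lTensor _)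
        (g := mulRight ℂ (𝒜.unit K.ld r) ∘ₗ mul' ℂ _ ∘ₗ
        (𝒜.totalAntipode (antipodeOfInverse R)).lTensor _) r K (fun q u v => ?_) a
      obtain ⟨c, hc⟩ := hg _ v
      obtain ⟨d, hd⟩ := 𝒜.exists_incl_mul_incl _ _ u c
      simp only [comp_apply, lTensor_tmul, mul'_apply, hc, hd,
        mulRight_apply]
      rw [incl_mul_unit, if_pos ⟨rfl, rfl⟩]
    · rw [map_zero]
      refine rowComul_congr (f := mul' ℂ _ ∘ₗ
        (𝒜.totalAntipode (antipodeOfInverse R)).lTensor _) (g := 0) r K (fun q u v => ?_) a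
      obtain ⟨c, hc⟩ := hg _ v
      rw [comp_apply, lTensor_tmul, mul'_apply, hc,
        incl_mul_of_ne _ fun hc' => hK hc'.1.symm]
      rfl
  · have h1 := congrArg (sliceLeft 𝒜.totalCounit) (galoisInv₁_T₁_incl
      (S := 𝒜.totalAntipode (antipodeOfInverse R)) K ⟨s, s, K.rd, K.rd⟩ a (𝒜.one s K.rd))
    have h2 := congr_fun h.RT (𝒜.incl K a ⊗ₜ 𝒜.unit s K.rd)
    rw [comp_apply, unit, G₁_incl, if_pos rfl] at h2
    rw [← hR, h2, sliceLeft_tmul, sliceLeft_comp_lTensor, sliceLeft_rowComul] at h1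
    rw [← unit] at h1
    rw [h1]
    split_ifs with hK
    · refine colComul_congr (f := mul' ℂ _ ∘ₗ
        (𝒜.totalAntipode (antipodeOfInverse R)).rTensor _)
        (g := mulRight ℂ (𝒜.unit s K.rd) ∘ₗ mul' ℂ _ ∘ₗ
        (𝒜.totalAntipode (antipodeOfInverse R)).rTensor _) s K (fun q u v => ?_) a
      obtain ⟨c, hc⟩ := hg _ u
      obtain ⟨d, hd⟩ := 𝒜.exists_incl_mul_incl _ _ c v
      simp only [comp_apply, rTensor_tmul, mul'_apply, hc, hd,
        mulRight_apply]
      rw [incl_mul_unit, if_pos ⟨rfl, rfl⟩]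
    · rw [map_zero]
      refine colComul_congr (f := mul' ℂ _ ∘ₗ
        (𝒜.totalAntipode (antipodeOfInverse R)).rTensor _) (g := 0) s K (fun q u v => ?_) a
      obtain ⟨c, hc⟩ := hg _ u
      rw [comp_apply, rTensor_tmul, mul'_apply, hc,
        incl_mul_of_ne _ fun hc' => hK hc'.2.symm]
      rfl

end

end PartialBialgebra

/-! ### Non-degeneracy -/

section Nondegenerate

variable {ι κ V W : Type*} [AddCommGroup V] [Module ℂ V] [AddCommGroup W] [Module ℂ W]

/-- A family of endomorphisms whose sum is locally finite and equal to the identity. -/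
def IsResolution (e : ι → V →ₗ[ℂ] V) : Prop :=
  ∀ x, {i | e i x ≠ 0}.Finite ∧ ∑ᶠ i, e i x = x

/-- Local units survive tensor products. Non-degeneracy of `A ⊗ A` and `A ⊗ A ⊗ A` thus follows from
the resolution of `A` by the units `𝟏(k; l)`. -/
theorem IsResolution.tensor {e : ι → V →ₗ[ℂ] V} {f : κ → W →ₗ[ℂ] W} (he : IsResolution e)
    (hf : IsResolution f) : IsResolution fun p : ι × κ => TensorProduct.map (e p.1) (f p.2) := by
  intro x
  induction x with
  | zero => simp
  | add x y hx hy =>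
    constructor
    · simpa only [map_add] using finite_ne_zero_add hx.1 hy.1
    · simp only [map_add]
      rw [finsum_add_distrib hx.1 hy.1, hx.2, hy.2]
  | tmul a b =>
    have hfin : {p : ι × κ | TensorProduct.map (e p.1) (f p.2) (a ⊗ₜ b) ≠ 0}.Finite := by
      refine ((he a).1.prod (hf b).1).subset fun p hp => ⟨fun h0 => hp ?_, fun h0 => hp ?_⟩
      · rw [map_tmul, h0, zero_tmul]
      · rw [map_tmul, h0, tmul_zero]
    refine ⟨hfin, ?_⟩
    rw [finsum_curry _ hfin]
    have h1 : ∀ i, ∑ᶠ j, TensorProduct.map (e i) (f j) (a ⊗ₜ b) = e i a ⊗ₜ b := fun i => by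
      conv_rhs => rw [← (hf b).2]
      exact (map_finsum (TensorProduct.mk ℂ V W (e i a)) (hf b).1).symm
    simp only [h1]
    conv_rhs => rw [← (he a).2]
    exact (map_finsum ((TensorProduct.mk ℂ V W).flip b) (he a).1).symm

theorem IsResolution.eq_zero {e : ι → V →ₗ[ℂ] V} (he : IsResolution e) {x : V}
    (h : ∀ i, e i x = 0) : x = 0 := by
  rw [← (he x).2]
  simp [h]

variable {A B : Type*} [NonUnitalRing A] [Module ℂ A] [SMulCommClass ℂ A A] [IsScalarTower ℂ A A]
  [NonUnitalRing B] [Module ℂ B] [SMulCommClass ℂ B B] [IsScalarTower ℂ B B]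

theorem IsResolution.tensor_mulRight {e : ι → A} {f : κ → B}
    (he : IsResolution fun i => mulRight ℂ (e i))
    (hf : IsResolution fun i => mulRight ℂ (f i)) :
    IsResolution fun p : ι × κ => mulRight ℂ (e p.1 ⊗ₜ[ℂ] f p.2) := by
  convert he.tensor hf using 2 with p
  refine TensorProduct.ext' fun a b => ?_
  simp

theorem IsResolution.tensor_mulLeft {e : ι → A} {f : κ → B}
    (he : IsResolution fun i => mulLeft ℂ (e i))
    (hf : IsResolution fun i => mulLeft ℂ (f i)) :
    IsResolution fun p : ι × κ => mulLeft ℂ (e p.1 ⊗ₜ[ℂ] f p.2) := by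
  convert he.tensor hf using 2 with p
  refine TensorProduct.ext' fun a b => ?_
  simp

/-! ### Multipliers of non-degenerate algebras -/

namespace Multiplier

/-- The relation `R(a) b = a L(b)` determines the right action from the left one when no nonzero
element annihilates everything; equalities of multipliers then need only one side. -/
theorem ext_left (hA : ∀ x : A, (∀ y, x * y = 0) → x = 0) {m n : Multiplier A}
    (h : m.left = n.left) : m = n := by
  refine ext (fun a => by rw [h]) fun a => ?_
  rw [← sub_eq_zero]
  refine hA _ fun y => ?_
  rw [sub_mul, right_mul, right_mul, h, sub_self]

theorem ext_right (hA : ∀ x : A, (∀ y, y * x = 0) → x = 0) {m n : Multiplier A}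
    (h : m.right = n.right) : m = n := by
  refine ext (fun a => ?_) fun a => by rw [h]
  rw [← sub_eq_zero]
  refine hA _ fun y => ?_
  rw [mul_sub, ← right_mul, ← right_mul, h, sub_self]

theorem right_mul_eq (hA : ∀ x : A, (∀ y, x * y = 0) → x = 0) (m : Multiplier A) (a b : A) :
    m.right (a * b) = a * m.right b := by
  rw [← sub_eq_zero]
  refine hA _ fun y => ?_
  rw [sub_mul, right_mul, _root_.mul_assoc, _root_.mul_assoc, right_mul, sub_self]

theorem of_injective (hA : ∀ x : A, (∀ y, x * y = 0) → x = 0) :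
    Function.Injective (of : A →ₗ[ℂ] Multiplier A) := by
  intro a b hab
  rw [← sub_eq_zero]
  refine hA _ fun y => ?_
  rw [sub_mul, sub_eq_zero]
  exact congrArg (fun m : Multiplier A => m.left y) hab

end Multiplier

end Nondegenerate

namespace PartialBialgebra

variable {I : Type u} (𝒜 : PartialBialgebra.{u, v} I)

theorem isResolution_mulRight_unit :
    IsResolution fun p : I × I => mulRight ℂ (𝒜.unit p.1 p.2) := by
  classical
  intro x
  induction x using total_induction with
  | zero => simp
  | add x y hx hy =>
    constructor
    · simpa only [map_add] using finite_ne_zero_add hx.1 hy.1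
    · simp only [map_add]
      rw [finsum_add_distrib hx.1 hy.1, hx.2, hy.2]
  | incl K a =>
    have h : ∀ p : I × I, p ≠ (K.ru, K.rd) →
        mulRight ℂ (𝒜.unit p.1 p.2) (𝒜.incl K a) = 0 := fun p hp => by
      rw [mulRight_apply, incl_mul_unit, if_neg fun hc => hp (Prod.ext hc.1.symm hc.2.symm)]
    constructor
    · refine (Set.finite_singleton (K.ru, K.rd)).subset fun p hp => ?_
      by_contra hc
      exact hp (h p hc)
    · rw [finsum_eq_single _ _ h, mulRight_apply, incl_mul_unit, if_pos ⟨rfl, rfl⟩]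

theorem isResolution_mulLeft_unit :
    IsResolution fun p : I × I => mulLeft ℂ (𝒜.unit p.1 p.2) := by
  classical
  intro x
  induction x using total_induction with
  | zero => simp
  | add x y hx hy =>
    constructor
    · simpa only [map_add] using finite_ne_zero_add hx.1 hy.1
    · simp only [map_add]
      rw [finsum_add_distrib hx.1 hy.1, hx.2, hy.2]
  | incl K a =>
    have h : ∀ p : I × I, p ≠ (K.lu, K.ld) →
        mulLeft ℂ (𝒜.unit p.1 p.2) (𝒜.incl K a) = 0 := fun p hp => by
      rw [mulLeft_apply, unit_mul_incl, if_neg fun hc => hp (Prod.ext hc.1 hc.2)]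
    constructor
    · refine (Set.finite_singleton (K.lu, K.ld)).subset fun p hp => ?_
      by_contra hc
      exact hp (h p hc)
    · rw [finsum_eq_single _ _ h, mulLeft_apply, unit_mul_incl, if_pos ⟨rfl, rfl⟩]

theorem eq_zero_of_mul (x : 𝒜.Total) (h : ∀ y, x * y = 0) : x = 0 :=
  𝒜.isResolution_mulRight_unit.eq_zero fun _ => h _

theorem eq_zero_of_mul_left (x : 𝒜.Total) (h : ∀ y, y * x = 0) : x = 0 :=
  𝒜.isResolution_mulLeft_unit.eq_zero fun p => h (𝒜.unit p.1 p.2)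

theorem eq_zero_of_mul₂ (x : 𝒜.Total ⊗[ℂ] 𝒜.Total) (h : ∀ y, x * y = 0) : x = 0 :=
  (𝒜.isResolution_mulRight_unit.tensor_mulRight 𝒜.isResolution_mulRight_unit).eq_zero fun _ => h _

theorem eq_zero_of_mul_left₂ (x : 𝒜.Total ⊗[ℂ] 𝒜.Total) (h : ∀ y, y * x = 0) : x = 0 :=
  (𝒜.isResolution_mulLeft_unit.tensor_mulLeft 𝒜.isResolution_mulLeft_unit).eq_zero fun _ => h _

theorem eq_zero_of_mul₃ (x : (𝒜.Total ⊗[ℂ] 𝒜.Total) ⊗[ℂ] 𝒜.Total) (h : ∀ y, x * y = 0) : x = 0 :=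
  ((𝒜.isResolution_mulRight_unit.tensor_mulRight 𝒜.isResolution_mulRight_unit).tensor_mulRight
    𝒜.isResolution_mulRight_unit).eq_zero fun _ => h _

theorem span_mul_eq_top : Submodule.span ℂ {x : 𝒜.Total | ∃ a b, a * b = x} = ⊤ := by
  classical
  rw [eq_top_iff]
  rintro x -
  induction x using total_induction with
  | zero => exact zero_mem _
  | add x y hx hy => exact add_mem hx hy
  | incl K a =>
    exact Submodule.subset_span ⟨𝒜.unit K.lu K.ld, 𝒜.incl K a,
      (𝒜.unit_mul_incl _ _ K a).trans (if_pos ⟨rfl, rfl⟩)⟩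

/-! ### The total comultiplication is a homomorphism -/

theorem comulTotal_mul (r s : I) (a b : 𝒜.Total) :
    𝒜.comulTotal r s (a * b) = ∑ᶠ t, 𝒜.comulTotal r t a * 𝒜.comulTotal t s b := by
  have hfin : ∀ a b : 𝒜.Total, {t | 𝒜.comulTotal r t a * 𝒜.comulTotal t s b ≠ 0}.Finite :=
    fun a b => (𝒜.finite_comulTotal_row r a).subset fun t ht h0 => ht (by rw [h0, zero_mul])
  induction a using total_induction with
  | zero => simp
  | add x y hx hy =>
    simp only [add_mul, map_add]
    rw [finsum_add_distrib (hfin x b) (hfin y b), hx, hy]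
  | incl K a =>
  induction b using total_induction with
  | zero => simp
  | add x y hx hy =>
    simp only [mul_add, map_add]
    rw [finsum_add_distrib (hfin _ x) (hfin _ y), hx, hy]
  | incl L b =>
  obtain ⟨k, l, m, n⟩ := K
  obtain ⟨l', p, n', q⟩ := L
  by_cases h : l = l' ∧ n = n'
  · obtain ⟨rfl, rfl⟩ := h
    rw [incl_mul, mulComp_eq, comulTotal_incl]
    dsimp only
    rw [𝒜.comul_mul, map_finsum]
    · refine finsum_congr fun t => ?_
      rw [comulTotal_incl, comulTotal_incl]
      dsimp only
      generalize 𝒜.comul r t a = w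
      generalize 𝒜.comul t s b = w'
      induction w with
      | zero => simp
      | add x y hx hy => simp only [map_add, LinearMap.add_apply, add_mul, hx, hy]
      | tmul x y =>
        induction w' with
        | zero => simp
        | add x y hx hy => simp only [map_add, mul_add, hx, hy]
        | tmul x' y' => simp [incl_mul, mulComp_eq]
    · exact (𝒜.finite_row a r).subset fun t ht h0 => ht (by simp only [h0, map_zero,
        LinearMap.zero_apply])
  · rw [incl_mul_of_ne _ h, map_zero, ← finsum_zero (α := I)]
    refine finsum_congr fun t => ?_
    refine Eq.symm (comulTotal_congr (f := mulRight ℂ (𝒜.comulTotal t s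
      (𝒜.incl ⟨l', p, n', q⟩ b))) (g := 0) r t _ (fun u v => ?_) a)
    refine comulTotal_congr (f := mulLeft ℂ (𝒜.incl _ u ⊗ₜ[ℂ] 𝒜.incl _ v)) (g := 0) t s _
      (fun u' v' => ?_) b
    rw [mulLeft_apply, tmul_mul_tmul]
    -- With mismatched columns one leg of each product vanishes: the first if `l ≠ l'`, the second
    -- if `n ≠ n'`.
    by_cases hl : l = l'
    · rw [𝒜.incl_mul_of_ne (K := ⟨r, t, m, n⟩) (L := ⟨t, s, n', q⟩) fun hc => h ⟨hl, hc.2⟩,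
        tmul_zero]
      rfl
    · rw [𝒜.incl_mul_of_ne (K := ⟨k, l, r, t⟩) (L := ⟨l', p, t, s⟩) fun hc => hl hc.1,
        zero_tmul]
      rfl

theorem colComul_mul (s : I) (a b : 𝒜.Total) :
    𝒜.colComul s (a * b) = ∑ᶠ t, 𝒜.colComul t a * 𝒜.comulTotal t s b := by
  have h1 : 𝒜.colComul s (a * b) = ∑ᶠ r, ∑ᶠ t, 𝒜.comulTotal r t a * 𝒜.comulTotal t s b :=
    finsum_congr fun r => 𝒜.comulTotal_mul r s a b
  have h2 : ∀ t, 𝒜.colComul t a * 𝒜.comulTotal t s b =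
      ∑ᶠ r, 𝒜.comulTotal r t a * 𝒜.comulTotal t s b := fun t =>
    map_colComul (mulRight ℂ (𝒜.comulTotal t s b)) t a
  simp only [h1, h2]
  -- Column `s` of the coproduct of `b` leaves finitely many `t`, and each such `t` leaves finitely
  -- many `r` by column finiteness for `a`.
  refine finsum_finsum_comm _ (⋃ t ∈ {t | 𝒜.comulTotal t s b ≠ 0}, {r | 𝒜.comulTotal r t a ≠ 0})
    {t | 𝒜.comulTotal t s b ≠ 0} ?_ (𝒜.finite_comulTotal_col s b) fun r t h => ?_
  · exact (𝒜.finite_comulTotal_col s b).biUnion fun t _ => 𝒜.finite_comulTotal_col t a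
  · have ht : 𝒜.comulTotal t s b ≠ 0 := fun h0 => h (by rw [h0, mul_zero])
    exact ⟨Set.mem_biUnion (x := t) ht fun h0 => h (by rw [h0, zero_mul]), ht⟩

theorem totalComul_left_tmul_incl (x a : 𝒜.Total) (L : M₂ I) (b : 𝒜.A L) :
    (𝒜.totalComul x).left (a ⊗ₜ 𝒜.incl L b) = 𝒜.colComul L.lu x * (a ⊗ₜ 𝒜.incl L b) := by
  change ∑ᶠ p : I × I, 𝒜.comulTotal p.1 p.2 x * (a ⊗ₜ 𝒜.incl L b) = _
  refine Eq.trans ?_ (map_colComul (mulRight ℂ (a ⊗ₜ[ℂ] 𝒜.incl L b)) L.lu x).symm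
  refine finsum_prod_eq_of_snd (fun p : I × I => 𝒜.comulTotal p.1 p.2 x * (a ⊗ₜ 𝒜.incl L b)) L.lu
    fun r s hs => ?_
  induction x using total_induction with
  | zero => simp
  | add x y hx hy => dsimp only at hx hy ⊢; rw [map_add, add_mul, hx, hy, add_zero]
  | incl K c =>
    refine comulTotal_congr (f := mulRight ℂ (a ⊗ₜ[ℂ] 𝒜.incl L b)) (g := 0) r s K
      (fun u v => ?_) c
    rw [mulRight_apply, tmul_mul_tmul,
      𝒜.incl_mul_of_ne (K := ⟨r, s, K.ld, K.rd⟩) fun h => hs h.1, tmul_zero]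
    rfl

/-- The second leg of `Δ_{ts}(b)x` has upper left index `t`, so `Δ(a)` acts on it through its column
`t` only. This matches the sum over `t` in `colComul_mul`. -/
theorem totalComul_left_comulTotal_mul (a b : 𝒜.Total) (t s : I) (x : 𝒜.Total ⊗[ℂ] 𝒜.Total) :
    (𝒜.totalComul a).left (𝒜.comulTotal t s b * x) =
      𝒜.colComul t a * (𝒜.comulTotal t s b * x) := by
  have key : ∀ (K : M₂ I) (b : 𝒜.A K), (𝒜.totalComul a).left ∘ₗ
      mulLeft ℂ (𝒜.comulTotal t s (𝒜.incl K b)) =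
      mulLeft ℂ (𝒜.colComul t a) ∘ₗ
        mulLeft ℂ (𝒜.comulTotal t s (𝒜.incl K b)) := by
    refine fun K b => ext_incl₂ fun L c M d => ?_
    refine comulTotal_congr (f := (𝒜.totalComul a).left ∘ₗ
      mulRight ℂ (𝒜.incl L c ⊗ₜ[ℂ] 𝒜.incl M d)) (g := mulLeft ℂ (𝒜.colComul t a)
        ∘ₗ mulRight ℂ (𝒜.incl L c ⊗ₜ[ℂ] 𝒜.incl M d)) t s K (fun u v => ?_) b
    obtain ⟨e, he⟩ := 𝒜.exists_incl_mul_incl _ _ v d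
    simp only [comp_apply, mulRight_apply, mulLeft_apply,
      tmul_mul_tmul, he, totalComul_left_tmul_incl]
  induction b using total_induction with
  | zero => simp
  | add y z hy hz => simp only [map_add, add_mul, mul_add, hy, hz]
  | incl K b => exact congr_fun (key K b) x

theorem totalComul_mul (a b : 𝒜.Total) :
    𝒜.totalComul (a * b) = 𝒜.totalComul a * 𝒜.totalComul b := by
  refine Multiplier.ext_left 𝒜.eq_zero_of_mul₂ (ext_incl₂ fun K x L y => ?_)
  change _ = (𝒜.totalComul a).left ((𝒜.totalComul b).left _)
  rw [totalComul_left_tmul_incl, totalComul_left_tmul_incl, colComul_mul]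
  set X := 𝒜.incl K x ⊗ₜ[ℂ] 𝒜.incl L y
  have h1 := map_colComul ((𝒜.totalComul a).left ∘ₗ mulRight ℂ X) L.lu b
  simp only [comp_apply, mulRight_apply, totalComul_left_comulTotal_mul] at h1
  rw [h1, finsum_mul']
  · simp only [_root_.mul_assoc]
  · exact (𝒜.finite_comulTotal_col L.lu b).subset fun t ht h0 => ht (by simp only [h0, mul_zero])

/-! ### Axioms of weak multiplier Hopf algebras that hold for every partial bialgebra -/

theorem comulOne_left : 𝒜.comulOne.left = 𝒜.E₁ := rfl

theorem comulOne_right : 𝒜.comulOne.right = 𝒜.E₂ := rfl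

theorem E₁_comp_E₁ : 𝒜.E₁ ∘ₗ 𝒜.E₁ = 𝒜.E₁ := by
  classical
  refine ext_incl₂ fun K a L b => ?_
  rw [comp_apply, E₁_incl]
  split_ifs with h
  · rw [E₁_incl, if_pos h]
  · rw [map_zero]

theorem E₂_comp_E₂ : 𝒜.E₂ ∘ₗ 𝒜.E₂ = 𝒜.E₂ := by
  classical
  refine ext_incl₂ fun K a L b => ?_
  rw [comp_apply, E₂_incl]
  split_ifs with h
  · rw [E₂_incl, if_pos h]
  · rw [map_zero]

theorem G₁_comp_G₁ : 𝒜.G₁ ∘ₗ 𝒜.G₁ = 𝒜.G₁ := by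
  classical
  refine ext_incl₂ fun K a L b => ?_
  rw [comp_apply, G₁_incl]
  split_ifs with h
  · rw [G₁_incl, if_pos h]
  · rw [map_zero]

theorem G₂_comp_G₂ : 𝒜.G₂ ∘ₗ 𝒜.G₂ = 𝒜.G₂ := by
  classical
  refine ext_incl₂ fun K a L b => ?_
  rw [comp_apply, G₂_incl]
  split_ifs with h
  · rw [G₂_incl, if_pos h]
  · rw [map_zero]

theorem comulOne_mul_comulOne : 𝒜.comulOne * 𝒜.comulOne = 𝒜.comulOne :=
  Multiplier.ext_left 𝒜.eq_zero_of_mul₂ 𝒜.E₁_comp_E₁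

/-- For homogeneous `a` and `c` the outer multiplications select the row `K.rd` and the column
`M.lu`, which leaves `rowComul_colComul`. -/
theorem onLegs12_T₂_comp_onLegs23_T₁ :
    onLegs12 𝒜.T₂ ∘ₗ onLegs23 𝒜.T₁ = onLegs23 𝒜.T₁ ∘ₗ onLegs12 𝒜.T₂ := by
  refine ext_incl₃ fun K a L b M c => ?_
  have h1 : ∀ z : 𝒜.Total ⊗[ℂ] 𝒜.Total, 𝒜.T₂.rTensor _
      ((TensorProduct.assoc ℂ _ _ _).symm
        (𝒜.incl K a ⊗ₜ (mulRight ℂ (𝒜.incl M c)).lTensor _ z)) =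
      TensorProduct.map ((mulLeft ℂ (𝒜.incl K a)).rTensor _)
        (mulRight ℂ (𝒜.incl M c)) ((𝒜.rowComul K.rd).rTensor _ z) := by
    intro z
    induction z with
    | zero => simp
    | add x y hx hy => simp only [map_add, tmul_add, hx, hy]
    | tmul x y => simp [T₂_incl_tmul]
  have h2 : ∀ z : 𝒜.Total ⊗[ℂ] 𝒜.Total, (TensorProduct.assoc ℂ _ _ _).symm
      (𝒜.T₁.lTensor _ (TensorProduct.assoc ℂ _ _ _
        ((mulLeft ℂ (𝒜.incl K a)).rTensor _ z ⊗ₜ 𝒜.incl M c))) =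
      TensorProduct.map ((mulLeft ℂ (𝒜.incl K a)).rTensor _)
        (mulRight ℂ (𝒜.incl M c)) ((TensorProduct.assoc ℂ _ _ _).symm
          ((𝒜.colComul M.lu).lTensor _ z)) := by
    intro z
    induction z with
    | zero => simp
    | add x y hx hy => simp only [map_add, add_tmul, hx, hy]
    | tmul x y =>
      simp only [rTensor_tmul, lTensor_tmul, assoc_tmul,
        T₁_tmul_incl]
      generalize 𝒜.colComul M.lu y = w
      induction w with
      | zero => simp
      | add x y hx hy => simp only [map_add, tmul_add, hx, hy]
      | tmul u v => simp
  simp only [onLegs12, onLegs23, comp_apply, coe_coe,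
    assoc_tmul, lTensor_tmul, rTensor_tmul, T₁_tmul_incl,
    T₂_incl_tmul, h1, h2, ← rowComul_colComul, LinearEquiv.symm_apply_apply]

/-- This unit selects exactly the column from which `id ⊗ ε` recovers `a`. -/
theorem T₁_unit (K : M₂ I) (a : 𝒜.A K) :
    𝒜.T₁ (𝒜.incl K a ⊗ₜ 𝒜.unit K.rd K.rd) = 𝒜.colComul K.rd (𝒜.incl K a) := by
  classical
  rw [unit, T₁_tmul_incl, ← unit]
  refine colComul_congr (g := LinearMap.id) _ K (fun r u v => ?_) a
  rw [lTensor_tmul, mulRight_apply, incl_mul_unit, if_pos ⟨rfl, rfl⟩]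
  rfl

theorem T₂_unit (K : M₂ I) (a : 𝒜.A K) :
    𝒜.T₂ (𝒜.unit K.lu K.lu ⊗ₜ 𝒜.incl K a) = 𝒜.rowComul K.lu (𝒜.incl K a) := by
  classical
  rw [unit, T₂_incl_tmul, ← unit]
  refine rowComul_congr (g := LinearMap.id) _ K (fun r u v => ?_) a
  rw [rTensor_tmul, mulLeft_apply, unit_mul_incl, if_pos ⟨rfl, rfl⟩]
  rfl

/-- Slicing an element of `V ⊗ A` by `id ⊗ ε` lands in `V`, and every homogeneous `a` is such a
slice of some `T₁(a ⊗ 𝟏)`. -/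
theorem left_full (V : Submodule ℂ 𝒜.Total)
    (hV : ∀ a b, 𝒜.T₁ (a ⊗ₜ b) ∈ LinearMap.range (V.subtype.rTensor _)) : V = ⊤ := by
  classical
  have key : ∀ w : V ⊗[ℂ] 𝒜.Total,
      sliceRight 𝒜.totalCounit (V.subtype.rTensor _ w) ∈ V := by
    intro w
    induction w with
    | zero => simp
    | add x y hx hy => simp only [map_add]; exact add_mem hx hy
    | tmul x y => simpa [sliceRight_tmul] using V.smul_mem _ x.2
  rw [eq_top_iff]
  rintro x -
  induction x using total_induction with
  | zero => exact zero_mem _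
  | add x y hx hy => exact add_mem hx hy
  | incl K a =>
    obtain ⟨w, hw⟩ := hV (𝒜.incl K a) (𝒜.unit K.rd K.rd)
    have := key w
    rwa [hw, T₁_unit, sliceRight_colComul, if_pos rfl] at this

theorem right_full (W : Submodule ℂ 𝒜.Total)
    (hW : ∀ a b, 𝒜.T₂ (a ⊗ₜ b) ∈ LinearMap.range (W.subtype.lTensor _)) : W = ⊤ := by
  classical
  have key : ∀ w : 𝒜.Total ⊗[ℂ] W,
      sliceLeft 𝒜.totalCounit (W.subtype.lTensor _ w) ∈ W := by
    intro w
    induction w with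
    | zero => simp
    | add x y hx hy => simp only [map_add]; exact add_mem hx hy
    | tmul x y => simpa [sliceLeft_tmul] using W.smul_mem _ y.2
  rw [eq_top_iff]
  rintro x -
  induction x using total_induction with
  | zero => exact zero_mem _
  | add x y hx hy => exact add_mem hx hy
  | incl K a =>
    obtain ⟨w, hw⟩ := hW (𝒜.unit K.lu K.lu) (𝒜.incl K a)
    have := key w
    rwa [hw, T₂_unit, sliceLeft_rowComul, if_pos rfl] at this

theorem sliceRight_comp_rTensor (φ : 𝒜.Total →ₗ[ℂ] 𝒜.Total) (z : 𝒜.Total ⊗[ℂ] 𝒜.Total) :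
    sliceRight 𝒜.totalCounit (φ.rTensor _ z) = φ (sliceRight 𝒜.totalCounit z) := by
  induction z with
  | zero => simp
  | add x y hx hy => simp only [map_add, hx, hy]
  | tmul x y => simp [sliceRight_tmul]

theorem sliceLeft_T₁ (a b : 𝒜.Total) : sliceLeft 𝒜.totalCounit (𝒜.T₁ (a ⊗ₜ b)) = a * b := by
  classical
  have h : sliceLeft 𝒜.totalCounit ∘ₗ 𝒜.T₁ = mul' ℂ _ := by
    refine ext_incl₂ fun K a L b => ?_
    rw [comp_apply, T₁_tmul_incl, sliceLeft_comp_lTensor, sliceLeft_colComul,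
      mul'_apply]
    split_ifs with h
    · rfl
    · rw [map_zero, incl_mul_of_ne _ fun hc => h hc.1.symm]
  exact congr_fun h (a ⊗ₜ b)

theorem sliceRight_T₂ (a b : 𝒜.Total) : sliceRight 𝒜.totalCounit (𝒜.T₂ (a ⊗ₜ b)) = a * b := by
  classical
  have h : sliceRight 𝒜.totalCounit ∘ₗ 𝒜.T₂ = mul' ℂ _ := by
    refine ext_incl₂ fun K a L b => ?_
    rw [comp_apply, T₂_incl_tmul, sliceRight_comp_rTensor, sliceRight_rowComul,
      mul'_apply]
    split_ifs with h
    · rfl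
    · rw [map_zero, incl_mul_of_ne _ fun hc => h hc.2]
  exact congr_fun h (a ⊗ₜ b)

/-! ### `Δ(1)` on three legs, and the identities for `G₁` and `G₂` -/

section Legs

open scoped Classical

theorem leg12_comulOne_left_incl (K L M : M₂ I) (a : 𝒜.A K) (b : 𝒜.A L) (c : 𝒜.A M) :
    (leg12 𝒜.comulOne).left ((𝒜.incl K a ⊗ₜ 𝒜.incl L b) ⊗ₜ 𝒜.incl M c) =
      if K.ld = L.lu then (𝒜.incl K a ⊗ₜ 𝒜.incl L b) ⊗ₜ 𝒜.incl M c else 0 := by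
  change 𝒜.E₁ (𝒜.incl K a ⊗ₜ 𝒜.incl L b) ⊗ₜ[ℂ] 𝒜.incl M c = _
  rw [E₁_incl]
  split_ifs <;> simp

theorem leg23_comulOne_left_incl (K L M : M₂ I) (a : 𝒜.A K) (b : 𝒜.A L) (c : 𝒜.A M) :
    (leg23 𝒜.comulOne).left ((𝒜.incl K a ⊗ₜ 𝒜.incl L b) ⊗ₜ 𝒜.incl M c) =
      if L.ld = M.lu then (𝒜.incl K a ⊗ₜ 𝒜.incl L b) ⊗ₜ 𝒜.incl M c else 0 := by
  change (TensorProduct.assoc ℂ _ _ _).symm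
    (𝒜.incl K a ⊗ₜ[ℂ] 𝒜.E₁ (𝒜.incl L b ⊗ₜ 𝒜.incl M c)) = _
  rw [E₁_incl]
  split_ifs <;> simp

theorem legs_comulOne_left_incl (K L M : M₂ I) (a : 𝒜.A K) (b : 𝒜.A L) (c : 𝒜.A M) :
    (leg12 𝒜.comulOne * leg23 𝒜.comulOne).left ((𝒜.incl K a ⊗ₜ 𝒜.incl L b) ⊗ₜ 𝒜.incl M c) =
      if K.ld = L.lu ∧ L.ld = M.lu then (𝒜.incl K a ⊗ₜ 𝒜.incl L b) ⊗ₜ 𝒜.incl M c else 0 := by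
  change (leg12 𝒜.comulOne).left ((leg23 𝒜.comulOne).left _) = _
  rw [leg23_comulOne_left_incl]
  by_cases h : L.ld = M.lu
  · rw [if_pos h, leg12_comulOne_left_incl]
    simp only [h, and_true]
  · rw [if_neg h, if_neg fun hc => h hc.2, map_zero]

theorem leg12_mul_leg23_comm :
    leg12 𝒜.comulOne * leg23 𝒜.comulOne = leg23 𝒜.comulOne * leg12 𝒜.comulOne := by
  refine Multiplier.ext_left 𝒜.eq_zero_of_mul₃ (ext_incl₃ fun K a L b M c => ?_)
  rw [legs_comulOne_left_incl]
  change _ = (leg23 𝒜.comulOne).left ((leg12 𝒜.comulOne).left _)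
  rw [leg12_comulOne_left_incl]
  by_cases h : K.ld = L.lu
  · rw [if_pos h, leg23_comulOne_left_incl]
    simp only [h, true_and]
  · rw [if_neg h, if_neg fun hc => h hc.1, map_zero]

theorem legs_mul_leg12 : leg12 𝒜.comulOne * leg23 𝒜.comulOne * leg12 𝒜.comulOne =
    leg12 𝒜.comulOne * leg23 𝒜.comulOne := by
  refine Multiplier.ext_left 𝒜.eq_zero_of_mul₃ (ext_incl₃ fun K a L b M c => ?_)
  change (leg12 𝒜.comulOne * leg23 𝒜.comulOne).left ((leg12 𝒜.comulOne).left _) = _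
  rw [leg12_comulOne_left_incl]
  split_ifs with h
  · rfl
  · rw [map_zero, legs_comulOne_left_incl, if_neg fun hc => h hc.1]

theorem legs_mul_leg23 : leg12 𝒜.comulOne * leg23 𝒜.comulOne * leg23 𝒜.comulOne =
    leg12 𝒜.comulOne * leg23 𝒜.comulOne := by
  refine Multiplier.ext_left 𝒜.eq_zero_of_mul₃ (ext_incl₃ fun K a L b M c => ?_)
  change (leg12 𝒜.comulOne * leg23 𝒜.comulOne).left ((leg23 𝒜.comulOne).left _) = _
  rw [leg23_comulOne_left_incl]
  split_ifs with h
  · rfl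
  · rw [map_zero, legs_comulOne_left_incl, if_neg fun hc => h hc.2]

theorem leg12_mul_legs : leg12 𝒜.comulOne * (leg12 𝒜.comulOne * leg23 𝒜.comulOne) =
    leg12 𝒜.comulOne * leg23 𝒜.comulOne := by
  refine Multiplier.ext_left 𝒜.eq_zero_of_mul₃ (ext_incl₃ fun K a L b M c => ?_)
  change (leg12 𝒜.comulOne).left ((leg12 𝒜.comulOne * leg23 𝒜.comulOne).left _) = _
  rw [legs_comulOne_left_incl]
  split_ifs with h
  · rw [leg12_comulOne_left_incl, if_pos h.1]
  · rw [map_zero]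

theorem leg23_mul_legs : leg23 𝒜.comulOne * (leg12 𝒜.comulOne * leg23 𝒜.comulOne) =
    leg12 𝒜.comulOne * leg23 𝒜.comulOne := by
  refine Multiplier.ext_left 𝒜.eq_zero_of_mul₃ (ext_incl₃ fun K a L b M c => ?_)
  change (leg23 𝒜.comulOne).left ((leg12 𝒜.comulOne * leg23 𝒜.comulOne).left _) = _
  rw [legs_comulOne_left_incl]
  split_ifs with h
  · rw [leg23_comulOne_left_incl, if_pos h.2]
  · rw [map_zero]

variable {𝒜} in
theorem total_induction₂ {p : 𝒜.Total ⊗[ℂ] 𝒜.Total → Prop} (x : 𝒜.Total ⊗[ℂ] 𝒜.Total) (zero : p 0)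
    (incl : ∀ K a L b, p (𝒜.incl K a ⊗ₜ 𝒜.incl L b)) (add : ∀ x y, p x → p y → p (x + y)) :
    p x := by
  induction x with
  | zero => exact zero
  | add x y hx hy => exact add x y hx hy
  | tmul x y =>
    induction x using total_induction with
    | zero => rwa [zero_tmul]
    | add x x' hx hx' => rw [add_tmul]; exact add _ _ hx hx'
    | incl K a =>
      induction y using total_induction with
      | zero => rwa [tmul_zero]
      | add x x' hx hx' => rw [tmul_add]; exact add _ _ hx hx'
      | incl L b => exact incl K a L b

theorem multiplier_mul_add {C : Type*} [NonUnitalRing C] [Module ℂ C] [SMulCommClass ℂ C C]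
    [IsScalarTower ℂ C C] (m n n' : Multiplier C) : m * (n + n') = m * n + m * n' :=
  Multiplier.ext (fun a => map_add m.left (n.left a) (n'.left a)) fun _ => rfl

theorem multiplier_add_mul {C : Type*} [NonUnitalRing C] [Module ℂ C] [SMulCommClass ℂ C C]
    [IsScalarTower ℂ C C] (m m' n : Multiplier C) : (m + m') * n = m * n + m' * n :=
  Multiplier.ext (fun _ => rfl) fun a => map_add n.right (m.right a) (m'.right a)

theorem multiplier_mul_zero {C : Type*} [NonUnitalRing C] [Module ℂ C] [SMulCommClass ℂ C C]
    [IsScalarTower ℂ C C] (m : Multiplier C) : m * 0 = 0 :=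
  Multiplier.ext (fun _ => map_zero m.left) fun _ => rfl

theorem multiplier_zero_mul {C : Type*} [NonUnitalRing C] [Module ℂ C] [SMulCommClass ℂ C C]
    [IsScalarTower ℂ C C] (n : Multiplier C) : 0 * n = 0 :=
  Multiplier.ext (fun _ => rfl) fun _ => map_zero n.right

theorem comulTensorId_left_incl (x y : 𝒜.Total) (N P Q : M₂ I) (c : 𝒜.A N) (d : 𝒜.A P)
    (e : 𝒜.A Q) :
    (comulTensorId 𝒜.totalComul (x ⊗ₜ y)).left ((𝒜.incl N c ⊗ₜ 𝒜.incl P d) ⊗ₜ 𝒜.incl Q e) =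
      (𝒜.colComul P.lu x * (𝒜.incl N c ⊗ₜ 𝒜.incl P d)) ⊗ₜ (y * 𝒜.incl Q e) := by
  rw [← totalComul_left_tmul_incl]
  rfl

theorem idTensorComul_left_incl (x y : 𝒜.Total) (N P Q : M₂ I) (c : 𝒜.A N) (d : 𝒜.A P)
    (e : 𝒜.A Q) :
    (idTensorComul 𝒜.totalComul (x ⊗ₜ y)).left ((𝒜.incl N c ⊗ₜ 𝒜.incl P d) ⊗ₜ 𝒜.incl Q e) =
      (TensorProduct.assoc ℂ _ _ _).symm
        ((x * 𝒜.incl N c) ⊗ₜ (𝒜.colComul Q.lu y * (𝒜.incl P d ⊗ₜ 𝒜.incl Q e))) := by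
  rw [← totalComul_left_tmul_incl]
  rfl

/-- In `Δ(a) ⊗ b` the first two legs already match, so `E ⊗ 1` acts trivially from the left and only
the matching of the last two legs is tested, which is the condition that `E` puts on `a ⊗ b`. -/
theorem extendsTo_comulTensorId : ExtendsTo (comulTensorId 𝒜.totalComul) (leg12 𝒜.comulOne)
    𝒜.comulOne (leg12 𝒜.comulOne * leg23 𝒜.comulOne) where
  mul_unit := 𝒜.legs_mul_leg12
  unit_mul := 𝒜.leg12_mul_legs
  mul_apply x := by
    induction x using total_induction₂ with
    | zero => simp only [map_zero, multiplier_mul_zero]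
    | add x y hx hy => simp only [map_add, multiplier_mul_add, hx, hy]
    | incl K a L b =>
    refine Multiplier.ext_left 𝒜.eq_zero_of_mul₃ (ext_incl₃ fun N c P d Q e => ?_)
    change (leg12 𝒜.comulOne * leg23 𝒜.comulOne).left
      ((comulTensorId 𝒜.totalComul (𝒜.incl K a ⊗ₜ[ℂ] 𝒜.incl L b)).left _) = _
    rw [comulOne_left, E₁_incl, comulTensorId_left_incl]
    refine (colComul_congr (f := (leg12 𝒜.comulOne * leg23 𝒜.comulOne).left ∘ₗ
      (TensorProduct.mk ℂ _ _).flip (𝒜.incl L b * 𝒜.incl Q e) ∘ₗ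
        mulRight ℂ (𝒜.incl N c ⊗ₜ[ℂ] 𝒜.incl P d))
      (g := if K.ld = L.lu then (TensorProduct.mk ℂ _ _).flip (𝒜.incl L b * 𝒜.incl Q e) ∘ₗ
        mulRight ℂ (𝒜.incl N c ⊗ₜ[ℂ] 𝒜.incl P d) else 0) P.lu K
      (fun r u v => ?_) a).trans ?_
    · obtain ⟨c', hc'⟩ := 𝒜.exists_incl_mul_incl _ _ u c
      obtain ⟨d', hd'⟩ := 𝒜.exists_incl_mul_incl _ _ v d
      obtain ⟨e', he'⟩ := 𝒜.exists_incl_mul_incl _ _ b e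
      simp only [comp_apply, mulRight_apply, flip_apply,
        mk_apply, tmul_mul_tmul, hc', hd', he',
        legs_comulOne_left_incl, true_and]
      split_ifs
      · simp [hc', hd']
      · rfl
    · split_ifs
      · rw [comulTensorId_left_incl]
        rfl
      · rw [map_zero]
        rfl
  apply_mul x := by
    induction x using total_induction₂ with
    | zero => simp only [map_zero, multiplier_zero_mul]
    | add x y hx hy => simp only [map_add, multiplier_add_mul, hx, hy]
    | incl K a L b =>
    refine Multiplier.ext_left 𝒜.eq_zero_of_mul₃ (ext_incl₃ fun N c P d Q e => ?_)
    change (comulTensorId 𝒜.totalComul (𝒜.incl K a ⊗ₜ[ℂ] 𝒜.incl L b)).left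
      ((leg12 𝒜.comulOne * leg23 𝒜.comulOne).left _) = _
    rw [comulOne_right, E₂_incl, legs_comulOne_left_incl]
    have h := colComul_congr (f := if N.ld = P.lu ∧ P.ld = Q.lu then
        (TensorProduct.mk ℂ _ _).flip (𝒜.incl L b * 𝒜.incl Q e) ∘ₗ
        mulRight ℂ (𝒜.incl N c ⊗ₜ[ℂ] 𝒜.incl P d) else 0)
      (g := if K.rd = L.ru then (TensorProduct.mk ℂ _ _).flip (𝒜.incl L b * 𝒜.incl Q e) ∘ₗ
        mulRight ℂ (𝒜.incl N c ⊗ₜ[ℂ] 𝒜.incl P d) else 0) P.lu K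
      (fun r u v => ?_) a
    · refine Eq.trans (Eq.trans ?_ h) ?_
      · split_ifs
        · rw [comulTensorId_left_incl]
          rfl
        · rw [map_zero]
          rfl
      · split_ifs
        · rw [comulTensorId_left_incl]
          rfl
        · rw [map_zero]
          rfl
    -- Unless a product vanishes, its matching columns transport the conditions on `c`, `d`, `e` to
    -- the condition `K.rd = L.ru`.
    · by_cases h0 : 𝒜.incl ⟨K.lu, K.ru, r, P.lu⟩ u * 𝒜.incl N c = 0 ∨
          𝒜.incl ⟨r, P.lu, K.ld, K.rd⟩ v * 𝒜.incl P d = 0 ∨ 𝒜.incl L b * 𝒜.incl Q e = 0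
      · split_ifs <;> rcases h0 with h0 | h0 | h0 <;> simp [h0]
      · have h1 : P.lu = N.ld := by
          by_contra hc
          exact h0 (Or.inl (𝒜.incl_mul_of_ne (K := ⟨K.lu, K.ru, r, P.lu⟩) (fun h => hc h.2) u c))
        have h2 : K.rd = P.ld := by
          by_contra hc
          exact h0 (Or.inr (Or.inl (𝒜.incl_mul_of_ne (K := ⟨r, P.lu, K.ld, K.rd⟩)
            (fun h => hc h.2) v d)))
        have h3 : L.ru = Q.lu := by
          by_contra hc
          exact h0 (Or.inr (Or.inr (𝒜.incl_mul_of_ne (fun h => hc h.1) b e)))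
        have hiff : (N.ld = P.lu ∧ P.ld = Q.lu) ↔ K.rd = L.ru := by
          rw [h1, h2, h3, and_iff_right rfl]
        by_cases hK : K.rd = L.ru
        · rw [if_pos hK, if_pos (hiff.2 hK)]
        · rw [if_neg hK, if_neg fun hc => hK (hiff.1 hc)]

theorem extendsTo_idTensorComul : ExtendsTo (idTensorComul 𝒜.totalComul) (leg23 𝒜.comulOne)
    𝒜.comulOne (leg12 𝒜.comulOne * leg23 𝒜.comulOne) where
  mul_unit := 𝒜.legs_mul_leg23
  unit_mul := 𝒜.leg23_mul_legs
  mul_apply x := by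
    induction x using total_induction₂ with
    | zero => simp only [map_zero, multiplier_mul_zero]
    | add x y hx hy => simp only [map_add, multiplier_mul_add, hx, hy]
    | incl K a L b =>
    refine Multiplier.ext_left 𝒜.eq_zero_of_mul₃ (ext_incl₃ fun N c P d Q e => ?_)
    change (leg12 𝒜.comulOne * leg23 𝒜.comulOne).left
      ((idTensorComul 𝒜.totalComul (𝒜.incl K a ⊗ₜ[ℂ] 𝒜.incl L b)).left _) = _
    rw [comulOne_left, E₁_incl, idTensorComul_left_incl]
    refine (colComul_congr (f := (leg12 𝒜.comulOne * leg23 𝒜.comulOne).left ∘ₗ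
      (TensorProduct.assoc ℂ _ _ _).symm.toLinearMap ∘ₗ
      TensorProduct.mk ℂ _ _ (𝒜.incl K a * 𝒜.incl N c) ∘ₗ
        mulRight ℂ (𝒜.incl P d ⊗ₜ[ℂ] 𝒜.incl Q e))
      (g := if K.ld = L.lu then (TensorProduct.assoc ℂ _ _ _).symm.toLinearMap ∘ₗ
        TensorProduct.mk ℂ _ _ (𝒜.incl K a * 𝒜.incl N c) ∘ₗ
        mulRight ℂ (𝒜.incl P d ⊗ₜ[ℂ] 𝒜.incl Q e) else 0) Q.lu L
      (fun r u v => ?_) b).trans ?_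
    · obtain ⟨c', hc'⟩ := 𝒜.exists_incl_mul_incl _ _ a c
      obtain ⟨d', hd'⟩ := 𝒜.exists_incl_mul_incl _ _ u d
      obtain ⟨e', he'⟩ := 𝒜.exists_incl_mul_incl _ _ v e
      simp only [comp_apply, mulRight_apply, coe_coe,
        mk_apply, tmul_mul_tmul, hc', hd', he',
        assoc_symm_tmul, legs_comulOne_left_incl, and_true]
      split_ifs
      · simp [hd', he']
      · rfl
    · split_ifs
      · rw [idTensorComul_left_incl]
        rfl
      · rw [map_zero]
        rfl
  apply_mul x := by
    induction x using total_induction₂ with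
    | zero => simp only [map_zero, multiplier_zero_mul]
    | add x y hx hy => simp only [map_add, multiplier_add_mul, hx, hy]
    | incl K a L b =>
    refine Multiplier.ext_left 𝒜.eq_zero_of_mul₃ (ext_incl₃ fun N c P d Q e => ?_)
    change (idTensorComul 𝒜.totalComul (𝒜.incl K a ⊗ₜ[ℂ] 𝒜.incl L b)).left
      ((leg12 𝒜.comulOne * leg23 𝒜.comulOne).left _) = _
    rw [comulOne_right, E₂_incl, legs_comulOne_left_incl]
    have h := colComul_congr (f := if N.ld = P.lu ∧ P.ld = Q.lu then
        (TensorProduct.assoc ℂ _ _ _).symm.toLinearMap ∘ₗ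
        TensorProduct.mk ℂ _ _ (𝒜.incl K a * 𝒜.incl N c) ∘ₗ
        mulRight ℂ (𝒜.incl P d ⊗ₜ[ℂ] 𝒜.incl Q e) else 0)
      (g := if K.rd = L.ru then (TensorProduct.assoc ℂ _ _ _).symm.toLinearMap ∘ₗ
        TensorProduct.mk ℂ _ _ (𝒜.incl K a * 𝒜.incl N c) ∘ₗ
        mulRight ℂ (𝒜.incl P d ⊗ₜ[ℂ] 𝒜.incl Q e) else 0) Q.lu L
      (fun r u v => ?_) b
    · refine Eq.trans (Eq.trans ?_ h) ?_
      · split_ifs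
        · rw [idTensorComul_left_incl]
          rfl
        · rw [map_zero]
          rfl
      · split_ifs
        · rw [idTensorComul_left_incl]
          rfl
        · rw [map_zero]
          rfl
    · by_cases h0 : 𝒜.incl ⟨L.lu, L.ru, r, Q.lu⟩ u * 𝒜.incl P d = 0 ∨
          𝒜.incl ⟨r, Q.lu, L.ld, L.rd⟩ v * 𝒜.incl Q e = 0 ∨ 𝒜.incl K a * 𝒜.incl N c = 0
      · split_ifs <;> rcases h0 with h0 | h0 | h0 <;> simp [h0]
      · have h1 : L.ru = P.lu ∧ Q.lu = P.ld := by
          by_contra hc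
          exact h0 (Or.inl (𝒜.incl_mul_of_ne (K := ⟨L.lu, L.ru, r, Q.lu⟩) hc u d))
        have h3 : K.rd = N.ld := by
          by_contra hc
          exact h0 (Or.inr (Or.inr (𝒜.incl_mul_of_ne (fun h => hc h.2) a c)))
        have hiff : (N.ld = P.lu ∧ P.ld = Q.lu) ↔ K.rd = L.ru := by
          rw [h1.1, h1.2, h3, and_iff_left rfl]
        by_cases hK : K.rd = L.ru
        · rw [if_pos hK, if_pos (hiff.2 hK)]
        · rw [if_neg hK, if_neg fun hc => hK (hiff.1 hc)]

/-- The first leg of `T₁(a ⊗ c)` has lower right index `M.lu`. Hence `G₁` on this leg and `b` makes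
the same test as `E` on `b ⊗ c`. -/
theorem G₁_spec :
    onLegs12 𝒜.G₁ ∘ₗ onLegs13 𝒜.T₁ = onLegs13 𝒜.T₁ ∘ₗ onLegs23 𝒜.comulOne.left := by
  refine ext_incl₃ fun K a L b M c => ?_
  rw [comulOne_left]
  simp only [onLegs12, onLegs13, onLegs23, comp_apply, coe_coe,
    rightComm_tmul, assoc_tmul, rTensor_tmul,
    lTensor_tmul, T₁_tmul_incl, E₁_incl]
  refine (colComul_congr (f := 𝒜.G₁.rTensor _ ∘ₗ
    (TensorProduct.rightComm ℂ 𝒜.Total 𝒜.Total 𝒜.Total).toLinearMap ∘ₗ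
      (TensorProduct.mk ℂ _ _).flip (𝒜.incl L b) ∘ₗ
        (mulRight ℂ (𝒜.incl M c)).lTensor _)
    (g := if L.ld = M.lu then (TensorProduct.rightComm ℂ 𝒜.Total 𝒜.Total 𝒜.Total).toLinearMap ∘ₗ
      (TensorProduct.mk ℂ _ _).flip (𝒜.incl L b) ∘ₗ
        (mulRight ℂ (𝒜.incl M c)).lTensor _ else 0) M.lu K
    (fun r u v => ?_) a).trans ?_
  · simp only [comp_apply, lTensor_tmul, flip_apply,
      mk_apply, coe_coe, rightComm_tmul,
      rTensor_tmul, G₁_incl, eq_comm (a := M.lu)]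
    split_ifs <;> simp
  · split_ifs
    · simp [T₁_tmul_incl]
    · simp

theorem G₂_spec :
    onLegs23 𝒜.G₂ ∘ₗ onLegs13 𝒜.T₂ = onLegs13 𝒜.T₂ ∘ₗ onLegs12 𝒜.comulOne.right := by
  refine ext_incl₃ fun K a L b M c => ?_
  rw [comulOne_right]
  simp only [onLegs12, onLegs13, onLegs23, comp_apply, coe_coe,
    rightComm_tmul, rTensor_tmul, T₂_incl_tmul, E₂_incl]
  refine (rowComul_congr (f := (TensorProduct.assoc ℂ 𝒜.Total 𝒜.Total 𝒜.Total).symm.toLinearMap ∘ₗ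
    𝒜.G₂.lTensor _ ∘ₗ (TensorProduct.assoc ℂ 𝒜.Total 𝒜.Total 𝒜.Total).toLinearMap ∘ₗ
    (TensorProduct.rightComm ℂ 𝒜.Total 𝒜.Total 𝒜.Total).toLinearMap ∘ₗ
      (TensorProduct.mk ℂ _ _).flip (𝒜.incl L b) ∘ₗ
        (mulLeft ℂ (𝒜.incl K a)).rTensor _)
    (g := if K.rd = L.ru then (TensorProduct.rightComm ℂ 𝒜.Total 𝒜.Total 𝒜.Total).toLinearMap ∘ₗ
      (TensorProduct.mk ℂ _ _).flip (𝒜.incl L b) ∘ₗ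
        (mulLeft ℂ (𝒜.incl K a)).rTensor _ else 0) K.rd M
    (fun r u v => ?_) c).trans ?_
  · simp only [comp_apply, rTensor_tmul, flip_apply,
      mk_apply, coe_coe, rightComm_tmul,
      assoc_tmul, lTensor_tmul, G₂_incl, eq_comm (a := L.ru)]
    split_ifs <;> simp
  · split_ifs
    · simp [T₂_incl_tmul]
    · simp

end Legs

/-- The structure maps of the weak multiplier Hopf algebra given by generalized inverses of the
canonical maps. -/
def weakMultiplierHopfData {R₁ R₂ : 𝒜.Total ⊗[ℂ] 𝒜.Total →ₗ[ℂ] 𝒜.Total ⊗[ℂ] 𝒜.Total}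
    (h₁ : IsGenInverse 𝒜.T₁ 𝒜.E₁ 𝒜.G₁ R₁) (h₂ : IsGenInverse 𝒜.T₂ 𝒜.E₂ 𝒜.G₂ R₂) :
    WeakMultiplierHopfData 𝒜.totalComul 𝒜.totalCounit where
  left_nondeg := 𝒜.eq_zero_of_mul
  right_nondeg := 𝒜.eq_zero_of_mul_left
  idempotent := 𝒜.span_mul_eq_top
  map_mul := 𝒜.totalComul_mul
  T₁ := 𝒜.T₁
  T₂ := 𝒜.T₂
  T₁_spec := 𝒜.of_T₁
  T₂_spec := 𝒜.of_T₂
  coassoc := 𝒜.onLegs12_T₂_comp_onLegs23_T₁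
  left_full := 𝒜.left_full
  right_full := 𝒜.right_full
  counit_left := 𝒜.sliceLeft_T₁
  counit_right := 𝒜.sliceRight_T₂
  E := 𝒜.comulOne
  E_idem := 𝒜.comulOne_mul_comulOne
  range_T₁ := h₁.range_eq
  range_T₂ := h₂.range_eq
  comulTensorId_E := 𝒜.extendsTo_comulTensorId
  idTensorComul_E := 𝒜.extendsTo_idTensorComul
  E_comm := 𝒜.leg12_mul_leg23_comm
  G₁ := 𝒜.G₁
  G₂ := 𝒜.G₂
  G₁_spec := 𝒜.G₁_spec
  G₂_spec := 𝒜.G₂_spec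
  ker_T₁ := h₁.ker_eq
  ker_T₂ := h₂.ker_eq

/-! ### Uniqueness of the structure maps -/

section Unique

variable {𝒜} (D : WeakMultiplierHopfData 𝒜.totalComul 𝒜.totalCounit)

theorem data_T₁ : D.T₁ = 𝒜.T₁ :=
  TensorProduct.ext' fun a b => Multiplier.of_injective 𝒜.eq_zero_of_mul₂
    ((D.T₁_spec a b).trans (𝒜.of_T₁ a b).symm)

theorem data_T₂ : D.T₂ = 𝒜.T₂ :=
  TensorProduct.ext' fun a b => Multiplier.of_injective 𝒜.eq_zero_of_mul₂
    ((D.T₂_spec a b).trans (𝒜.of_T₂ a b).symm)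

/-- The range of `E` is that of `T₁`, which `E₁` fixes pointwise. -/
theorem data_E_left_comp : 𝒜.E₁ ∘ₗ D.E.left = D.E.left := by
  ext1
  ext x y
  obtain ⟨z, hz⟩ : D.E.left (x ⊗ₜ y) ∈ LinearMap.range D.T₁ :=
    D.range_T₁ ▸ LinearMap.mem_range_self _ _
  change 𝒜.E₁ (D.E.left (x ⊗ₜ y)) = D.E.left (x ⊗ₜ y)
  rw [← hz, data_T₁]
  exact congr_fun 𝒜.E₁_comp_T₁ z

theorem data_E_right_T₂ (z : 𝒜.Total ⊗[ℂ] 𝒜.Total) : D.E.right (𝒜.T₂ z) = 𝒜.T₂ z := by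
  obtain ⟨w, hw⟩ : 𝒜.T₂ z ∈ LinearMap.range D.E.right := by
    rw [← D.range_T₂, data_T₂]
    exact LinearMap.mem_range_self _ _
  rw [← hw]
  exact congrArg (fun m : Multiplier _ => m.right w) D.E_idem

/-- Right multiplication by `E` fixes the range of `T₂`, hence the left ideal generated by it, and
this ideal contains `(A ⊗ A)Δ(1)`. -/
theorem data_E_right_comp : D.E.right ∘ₗ 𝒜.E₂ = 𝒜.E₂ := by
  classical
  refine ext_incl₂ fun K a L b => ?_
  rw [comp_apply, E₂_incl]
  split_ifs with h
  -- In row `K.rd` the coproduct of a unit has a single nonzero term, `𝟏(K.ru; K.rd) ⊗ 𝟏(K.rd;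
  -- L.rd)`. Its second leg is a right unit for `b` exactly when `K.rd = L.ru`.
  · have h1 : 𝒜.T₂ (𝒜.incl K a ⊗ₜ 𝒜.unit K.ru L.rd) =
        𝒜.incl K a ⊗ₜ 𝒜.unit K.rd L.rd := by
      rw [T₂_incl_tmul, map_rowComul, unit, finsum_eq_single _ K.rd fun s hs => ?_]
      · rw [comulTotal_incl]
        dsimp only
        rw [𝒜.comul_one, map_tmul, rTensor_tmul, mulLeft_apply]
        congr 1
        exact (𝒜.incl_mul_unit _ _ K a).trans (if_pos ⟨rfl, rfl⟩)
      · rw [comulTotal_incl]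
        dsimp only
        rw [𝒜.comul_one_of_ne _ _ _ _ hs.symm, map_zero, map_zero]
    have h2 : 𝒜.incl K a ⊗ₜ[ℂ] 𝒜.incl L b = (𝒜.unit K.lu K.ld ⊗ₜ[ℂ] 𝒜.incl L b) *
        𝒜.T₂ (𝒜.incl K a ⊗ₜ 𝒜.unit K.ru L.rd) := by
      rw [h1, tmul_mul_tmul, unit_mul_incl, if_pos ⟨rfl, rfl⟩, incl_mul_unit,
        if_pos ⟨h.symm, rfl⟩]
    rw [h2, Multiplier.right_mul_eq 𝒜.eq_zero_of_mul₂, data_E_right_T₂]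
  · rw [map_zero]

theorem data_E : D.E = 𝒜.comulOne :=
  have h1 : 𝒜.comulOne * D.E = D.E :=
    Multiplier.ext_left 𝒜.eq_zero_of_mul₂ (data_E_left_comp D)
  have h2 : 𝒜.comulOne * D.E = 𝒜.comulOne :=
    Multiplier.ext_right 𝒜.eq_zero_of_mul_left₂ (data_E_right_comp D)
  h1.symm.trans h2

/-- Taking a suitable unit in the third leg and then applying `ε` there turns `T₁` on legs one and
three into the identity on `a`, so `G(a ⊗ b)` can be read off. -/
theorem eq_of_onLegs12_comp {G G' : 𝒜.Total ⊗[ℂ] 𝒜.Total →ₗ[ℂ] 𝒜.Total ⊗[ℂ] 𝒜.Total}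
    (h : onLegs12 G ∘ₗ onLegs13 𝒜.T₁ = onLegs12 G' ∘ₗ onLegs13 𝒜.T₁) : G = G' := by
  classical
  refine ext_incl₂ fun K a L b => ?_
  have h1 : ∀ (G : 𝒜.Total ⊗[ℂ] 𝒜.Total →ₗ[ℂ] 𝒜.Total ⊗[ℂ] 𝒜.Total) (w : 𝒜.Total ⊗[ℂ] 𝒜.Total),
      TensorProduct.rid ℂ _ (𝒜.totalCounit.lTensor (𝒜.Total ⊗[ℂ] 𝒜.Total) (G.rTensor _
        (TensorProduct.rightComm ℂ 𝒜.Total 𝒜.Total 𝒜.Total (w ⊗ₜ 𝒜.incl L b)))) =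
      G (sliceRight 𝒜.totalCounit w ⊗ₜ 𝒜.incl L b) := by
    intro G w
    induction w with
    | zero => simp
    | add x y hx hy => simp only [map_add, add_tmul, hx, hy]
    | tmul x y =>
      simp only [rightComm_tmul, rTensor_tmul, lTensor_tmul,
        TensorProduct.rid_tmul, sliceRight_tmul]
      rw [← smul_tmul', map_smul]
  have h2 := congrArg (fun z => TensorProduct.rid ℂ _
    (𝒜.totalCounit.lTensor (𝒜.Total ⊗[ℂ] 𝒜.Total) z))
    (congr_fun h ((𝒜.incl K a ⊗ₜ 𝒜.incl L b) ⊗ₜ 𝒜.unit K.rd K.rd))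
  simp only [onLegs12, onLegs13, comp_apply, coe_coe,
    rightComm_tmul, rTensor_tmul, T₁_unit, h1, sliceRight_colComul,
    if_true] at h2
  exact h2

theorem eq_of_onLegs23_comp {G G' : 𝒜.Total ⊗[ℂ] 𝒜.Total →ₗ[ℂ] 𝒜.Total ⊗[ℂ] 𝒜.Total}
    (h : onLegs23 G ∘ₗ onLegs13 𝒜.T₂ = onLegs23 G' ∘ₗ onLegs13 𝒜.T₂) : G = G' := by
  classical
  refine ext_incl₂ fun L b K a => ?_
  have h1 : ∀ (G : 𝒜.Total ⊗[ℂ] 𝒜.Total →ₗ[ℂ] 𝒜.Total ⊗[ℂ] 𝒜.Total) (w : 𝒜.Total ⊗[ℂ] 𝒜.Total),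
      TensorProduct.lid ℂ _ (𝒜.totalCounit.rTensor (𝒜.Total ⊗[ℂ] 𝒜.Total) (G.lTensor _
        (TensorProduct.assoc ℂ 𝒜.Total 𝒜.Total 𝒜.Total
          (TensorProduct.rightComm ℂ 𝒜.Total 𝒜.Total 𝒜.Total (w ⊗ₜ 𝒜.incl L b))))) =
      G (𝒜.incl L b ⊗ₜ sliceLeft 𝒜.totalCounit w) := by
    intro G w
    induction w with
    | zero => simp
    | add x y hx hy => simp only [map_add, add_tmul, tmul_add, hx, hy]
    | tmul x y => simp [sliceLeft_tmul]
  have h2 := congrArg (fun z => TensorProduct.lid ℂ _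
    (𝒜.totalCounit.rTensor (𝒜.Total ⊗[ℂ] 𝒜.Total) (TensorProduct.assoc ℂ _ _ _ z)))
    (congr_fun h ((𝒜.unit K.lu K.lu ⊗ₜ 𝒜.incl L b) ⊗ₜ 𝒜.incl K a))
  simp only [onLegs23, onLegs13, comp_apply, coe_coe,
    rightComm_tmul, rTensor_tmul, T₂_unit, LinearEquiv.apply_symm_apply, h1,
    sliceLeft_rowComul, if_true] at h2
  exact h2

theorem data_G₁ : D.G₁ = 𝒜.G₁ := by
  refine eq_of_onLegs12_comp ?_
  rw [G₁_spec, ← data_T₁ D, D.G₁_spec, data_E]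

theorem data_G₂ : D.G₂ = 𝒜.G₂ := by
  refine eq_of_onLegs23_comp ?_
  rw [G₂_spec, ← data_T₂ D, D.G₂_spec, data_E]

include D in
theorem exists_isGenInverse₁ : ∃ R, IsGenInverse 𝒜.T₁ 𝒜.E₁ 𝒜.G₁ R := by
  refine IsGenInverse.exists_of_range_ker 𝒜.E₁_comp_E₁ 𝒜.G₁_comp_G₁ ?_ ?_
  · rw [← data_T₁ D, D.range_T₁, data_E, comulOne_left]
  · rw [← data_T₁ D, D.ker_T₁, data_G₁]

include D in
theorem exists_isGenInverse₂ : ∃ R, IsGenInverse 𝒜.T₂ 𝒜.E₂ 𝒜.G₂ R := by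
  refine IsGenInverse.exists_of_range_ker 𝒜.E₂_comp_E₂ 𝒜.G₂_comp_G₂ ?_ ?_
  · rw [← data_T₂ D, D.range_T₂, data_E, comulOne_right]
  · rw [← data_T₂ D, D.ker_T₂, data_G₂]

end Unique

/-! ### The antipode in terms of the generalized inverses -/

/-- The counit contracts `a₁ ⊗ S(a₂)b` to `S(a)b`; when the row `L.ld` is not the upper row of `a`,
the slice is zero and so is `S(a)b` by the grading. -/
theorem sliceLeft_galoisInv₁ {S : 𝒜.Total →ₗ[ℂ] 𝒜.Total}
    (hg : ∀ K a, ∃ c, S (𝒜.incl K a) = 𝒜.incl ⟨K.rd, K.ld, K.ru, K.lu⟩ c) (a b : 𝒜.Total) :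
    sliceLeft 𝒜.totalCounit (𝒜.galoisInv₁ S (a ⊗ₜ b)) = S a * b := by
  classical
  have h : sliceLeft 𝒜.totalCounit ∘ₗ 𝒜.galoisInv₁ S =
      mul' ℂ _ ∘ₗ S.rTensor _ := by
    refine ext_incl₂ fun K a L b => ?_
    rw [comp_apply, galoisInv₁_tmul_incl, sliceLeft_comp_lTensor, sliceLeft_rowComul,
      comp_apply, comp_apply, rTensor_tmul, mul'_apply]
    split_ifs with h
    · rfl
    · obtain ⟨c, hc⟩ := hg K a
      rw [map_zero, map_zero, hc, incl_mul_of_ne _ fun hc' => h hc'.2.symm]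
  exact congr_fun h (a ⊗ₜ b)

theorem sliceRight_galoisInv₂ {S : 𝒜.Total →ₗ[ℂ] 𝒜.Total}
    (hg : ∀ K a, ∃ c, S (𝒜.incl K a) = 𝒜.incl ⟨K.rd, K.ld, K.ru, K.lu⟩ c) (a b : 𝒜.Total) :
    sliceRight 𝒜.totalCounit (𝒜.galoisInv₂ S (a ⊗ₜ b)) = a * S b := by
  classical
  have h : sliceRight 𝒜.totalCounit ∘ₗ 𝒜.galoisInv₂ S =
      mul' ℂ _ ∘ₗ S.lTensor _ := by
    refine ext_incl₂ fun L b K a => ?_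
    rw [comp_apply, galoisInv₂_incl_tmul, sliceRight_comp_rTensor, sliceRight_colComul,
      comp_apply, comp_apply, lTensor_tmul, mul'_apply]
    split_ifs with h
    · rfl
    · obtain ⟨c, hc⟩ := hg K a
      rw [map_zero, map_zero, hc, incl_mul_of_ne _ fun hc' => h hc'.1]
  exact congr_fun h (a ⊗ₜ b)

end PartialBialgebra

end

/-! ### The equivalences and the comparison of antipodes -/

theorem mainTheorem2 {I : Type u} (𝒜 : PartialBialgebra.{u, v} I) :
    List.TFAE [
      𝒜.IsPartialHopf,
      ∃ R₁ R₂ : 𝒜.Total ⊗[ℂ] 𝒜.Total →ₗ[ℂ] 𝒜.Total ⊗[ℂ] 𝒜.Total,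
        IsGenInverse 𝒜.T₁ 𝒜.E₁ 𝒜.G₁ R₁ ∧ IsGenInverse 𝒜.T₂ 𝒜.E₂ 𝒜.G₂ R₂,
      IsWeakMultiplierHopf 𝒜.totalComul 𝒜.totalCounit] ∧
    ∀ S : ∀ {k l m n : I}, 𝒜.A ⟨k, l, m, n⟩ →ₗ[ℂ] 𝒜.A ⟨n, m, l, k⟩, 𝒜.IsAntipode S →
      ∀ S' : 𝒜.Total →ₗ[ℂ] Multiplier 𝒜.Total,
        IsWeakMultiplierHopfAntipode 𝒜.totalComul 𝒜.totalCounit S' ↔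
          ∀ a, S' a = Multiplier.of (𝒜.totalAntipode S a) := by
  constructor
  · tfae_have 1 → 2 := fun ⟨S, hS⟩ =>
      ⟨_, _, (hS.isTotalAntipode S).isGenInverse₁, (hS.isTotalAntipode S).isGenInverse₂⟩
    -- A generalized inverse of `T₁` alone yields an antipode, and with it one of `T₂`.
    tfae_have 2 → 1 := fun ⟨_, _, h₁, _⟩ => ⟨_, PartialBialgebra.isAntipode_antipodeOfInverse h₁⟩
    tfae_have 2 → 3 := fun ⟨_, _, h₁, h₂⟩ => ⟨𝒜.weakMultiplierHopfData h₁ h₂⟩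
    tfae_have 3 → 2 := fun ⟨D⟩ => by
      obtain ⟨R₁, h₁⟩ := PartialBialgebra.exists_isGenInverse₁ D
      obtain ⟨R₂, h₂⟩ := PartialBialgebra.exists_isGenInverse₂ D
      exact ⟨R₁, R₂, h₁, h₂⟩
    tfae_finish
  · intro S hS S'
    have hT := hS.isTotalAntipode S
    constructor
    · rintro ⟨D, R₁, R₂, h₁, h₂, hl, hr⟩ a
      rw [PartialBialgebra.data_T₁, PartialBialgebra.data_E, PartialBialgebra.data_G₁] at h₁
      rw [PartialBialgebra.data_T₂, PartialBialgebra.data_E, PartialBialgebra.data_G₂] at h₂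
      -- The structure maps being forced, `R₁` and `R₂` are the generalized inverses built from `S`,
      -- whose slices are `S(a)b` and `bS(a)`.
      rw [hT.isGenInverse₁.unique h₁] at hl
      rw [hT.isGenInverse₂.unique h₂] at hr
      refine Multiplier.ext (fun b => ?_) fun b => ?_
      · rw [hl, 𝒜.sliceLeft_galoisInv₁ hT.grading]
        rfl
      · rw [hr, 𝒜.sliceRight_galoisInv₂ hT.grading]
        rfl
    · intro h
      refine ⟨𝒜.weakMultiplierHopfData hT.isGenInverse₁ hT.isGenInverse₂, _, _, hT.isGenInverse₁,
        hT.isGenInverse₂, fun a b => ?_, fun a b => ?_⟩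
      · rw [h, 𝒜.sliceLeft_galoisInv₁ hT.grading]
        rfl
      · rw [h, 𝒜.sliceRight_galoisInv₂ hT.grading]
        rfl
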